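/- **Setting.** $|\cdot|$ is the Euclidean norm on vectors and the Frobenius norm on matrices, $A\cdot B=\operatorname{tr}(A^\top B)$, $\operatorname{sym}F=\frac12(F+F^\top)$, and $\iota(A)\in\mathbb R^{3\times3}$ has upper left block $A\in\mathbb R^{2\times 2}$ and zeros elsewhere. Let $S\subseteq\mathbb R^2$ be a bounded Lipschitz domain (open, connected, non-empty), $\bar r\in\mathbb R$, $\bar\varepsilon>0$. *Stored energy.* Let $C_W>0$, $q_W>4$, and let $r_W:[0,\infty)\to[0,\infty]$ be nondecreasing with $\lim_{\delta\to0}r_W(\delta)=0$. Let $W:(-\frac12,\frac12)\times\mathbb R^{3\times3}\to[0,\infty]$ be Borel such that for all $x_3\in(-\frac12,\frac12)$ and all $F,G\in\mathbb R^{3\times 3}$: $W(x_3,RF)=W(x_3,F)$ for $R\in SO(3)$; $W(x_3,F)\ge\frac1{C_W}\operatorname{dist}^2(F,SO(3))$; $W(x_3,F)\le C_W\operatorname{dist}^2(F,SO(3))$ if $\operatorname{dist}^2(F,SO(3))\le\frac1{C_W}$; $|W(x_3,I+G)-Q(x_3,G)|\le|G|^2r_W(|G|)$ for a quadratic form $Q(x_3,\cdot)$;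 $W(x_3,F)\ge\frac1{C_W}\max\{|F|^{q_W},(\det F)^{-q_W/2}\}-C_W$ if $\det F>0$, and $W(x_3,F)=\infty$ if $\det F\le0$. *Effective quantities.* For $A,U\in\mathbb R^{2\times2}_{\rm sym}$ put $$Q_2(x_3,A)=\min_{d\in\mathbb R^3}Q(x_3,\iota(A)+\operatorname{sym}(d\otimes e_3)),\qquad Q_{\rm el}(A)=\min_{M\in\mathbb R^{2\times2}_{\rm sym}}\int_{-1/2}^{1/2}Q_2(x_3,x_3A+M)\,dx_3,$$ $$E_{\rm res}(U)=\min_{A,M\in\mathbb R^{2\times2}_{\rm sym}}\int_{-1/2}^{1/2}Q_2\big(x_3,x_3A+M+\mathbf 1(x_3>0)\tfrac12U\big)\,dx_3,\qquad \mathbb B(U)=\sum_{i=1}^3(U\cdot G_i)A_i,$$ where $G_1=e_1\otimes e_1$, $G_2=e_2\otimes e_2$, $G_3=\frac1{\sqrt2}(e_1\otimes e_2+e_2\otimes e_1)$ and $(A_i,M_i)$ is the unique minimizer over $\mathbb R^{2\times2}_{\rm sym}\times\mathbb R^{2\times2}_{\rm sym}$ of $(A,M)\mapsto\int_{-1/2}^{1/2}Q_2(x_3,\mathbf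 1(x_3>0)\frac12G_i-(x_3A+M))\,dx_3$. *Energy.* Let $\mathcal A_2$ be the set of $(y,n)\in H^2(S;\mathbb R^3)\times H^1(S;\mathbb R^3)$ with $(\nabla'y)^\top\nabla'y=I$ and $|n|=1$ a.e. in $S$. With $b_y=\partial_1y\wedge\partial_2y$, $\mathrm{II}_y=\nabla'y^\top\nabla'b_y$ and $U_{y,n}=\frac13I_{2\times2}-\nabla'y^\top n\otimes\nabla'y^\top n$, define on $\mathcal A_2$ $$\mathcal E_{\rm el}(y,n)=\int_S Q_{\rm el}(\mathrm{II}_y+\bar r\,\mathbb B(U_{y,n}))+\bar r^2E_{\rm res}(U_{y,n})\,dx',\quad \mathcal E_{OF}(n)=\frac12\int_S|\nabla'n|^2dx',\quad \mathcal E=\mathcal E_{\rm el}+\bar\varepsilon^2\mathcal E_{OF},$$ and extend $\mathcal E$ to $L^2(S;\mathbb R^3)\times L^2(S;\mathbb R^3)$ by $\mathcal E=\infty$ outside $\mathcal A_2$. **Lemma (compactness and continuity of the limiting energy).** (a) There is $C>0$ depending only on $S$, $C_W$ and $\bar r$ such that for all $(y,n)\in\mathcal A_2$ the integrand of $\mathcal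 E_{\rm el}(y,n)$ is integrable and $\int_S|\nabla'\nabla'y|^2dx'\le C(\mathcal E_{\rm el}(y,n)+1)$. (b) For every $C>0$ the sublevel $\{(y,n)\in\mathcal A_2:\mathcal E(y,n)\le C,\ \|y\|_{L^2(S;\mathbb R^3)}\le C\}$ is compact, both in the strong topology of $L^2(S;\mathbb R^3)\times L^2(S;\mathbb R^3)$ and in the weak topology of $H^2(S;\mathbb R^3)\times H^1(S;\mathbb R^3)$. (c) If $(y^k,n^k),(y,n)\in\mathcal A_2$ and $(y^k,n^k)\to(y,n)$ strongly in $L^2(S)\times L^2(S)$, then $\liminf_k\mathcal E_{OF}(n^k)\ge\mathcal E_{OF}(n)$; moreover $\liminf_k\mathcal E_{\rm el}(y^k,n^k)\ge\mathcal E_{\rm el}(y,n)$ provided $\limsup_k\mathcal E_{OF}(n^k)<\infty$; and in any case $\liminf_k\mathcal E(y^k,n^k)\ge\mathcal E(y,n)$. (d) If $(y^k,n^k),(y,n)\in\mathcal A_2$ and $y^k\to y$ strongly in $H^2(S;\mathbb R^3)$, then $\mathcal E_{\rm el}(y^k,n^k)\to\mathcal E_{\rm el}(y,n)$ if $n^k\rightharpoonup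 n$ weakly in $H^1(S;\mathbb R^3)$, and $\mathcal E_{OF}(n^k)\to\mathcal E_{OF}(n)$ if $n^k\to n$ strongly in $H^1(S;\mathbb R^3)$. -/

import Mathlib

open Set Filter Topology MeasureTheory
open scoped ENNReal NNReal ContDiff

noncomputable section

namespace LCEPlate

/-- The plane, with the Euclidean norm. -/
abbrev E2 : Type := EuclideanSpace ℝ (Fin 2)

/-- Three-dimensional space, with the Euclidean norm. -/
abbrev E3 : Type := EuclideanSpace ℝ (Fin 3)

/-- Real `2 × 2` matrices. -/
abbrev M2 : Type := Matrix (Fin 2) (Fin 2) ℝ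

/-- Real `3 × 3` matrices. -/
abbrev M3 : Type := Matrix (Fin 3) (Fin 3) ℝ

/-! ### Lipschitz domains -/

/-- A (bounded) Lipschitz domain in the plane: a bounded connected open set which, near each of its
boundary points and in suitable Cartesian coordinates, is the region above the graph of a
Lipschitz function. -/
def IsLipschitzDomain (S : Set E2) : Prop :=
  IsOpen S ∧ IsConnected S ∧ Bornology.IsBounded S ∧
    ∀ p ∈ frontier S, ∃ (U : Set E2) (e : E2 ≃ₗᵢ[ℝ] E2) (γ : ℝ → ℝ) (K : ℝ≥0),
      IsOpen U ∧ p ∈ U ∧ LipschitzWith K γ ∧ ∀ x ∈ U, (x ∈ S ↔ γ (e x 0) < e x 1)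

/-! ### Sobolev spaces of `ℝ³`-valued functions on `S` -/

/-- `g` is the weak partial derivative `∂ᵢ u` on the open set `S`. -/
def HasWeakPartial (S : Set E2) (i : Fin 2) (u g : E2 → E3) : Prop :=
  LocallyIntegrableOn u S ∧ LocallyIntegrableOn g S ∧
    ∀ φ : E2 → ℝ, ContDiff ℝ ∞ φ → HasCompactSupport φ → tsupport φ ⊆ S →
      ∫ x in S, (fderiv ℝ φ x (EuclideanSpace.single i 1)) • u x = - ∫ x in S, φ x • g x

open Classical in
/-- The weak partial derivative `∂ᵢ u` on `S` (unique a.e. in `S`), and `0` if there is none. -/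
def weakPartial (S : Set E2) (i : Fin 2) (u : E2 → E3) : E2 → E3 :=
  if h : ∃ g, HasWeakPartial S i u g then h.choose else 0

/-- `L²(S; ℝ³)`. -/
abbrev L2 (S : Set E2) : Type := Lp E3 2 (volume.restrict S)

theorem L2.locallyIntegrable {S : Set E2} (u : L2 S) :
    LocallyIntegrable (u : E2 → E3) (volume.restrict S) :=
  (Lp.memLp u).locallyIntegrable (by norm_num)

theorem L2.locallyIntegrableOn {S : Set E2} (u : L2 S) :
    LocallyIntegrableOn (u : E2 → E3) S := by
  intro x _
  obtain ⟨U, hU, hi⟩ := L2.locallyIntegrable u x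
  refine ⟨S ∩ U, inter_mem_nhdsWithin S hU, ?_⟩
  have h : Integrable (u : E2 → E3) ((volume.restrict S).restrict U) := hi
  have h2 : volume.restrict (S ∩ U) ≤ (volume.restrict S).restrict U := by
    rw [inter_comm]
    refine Measure.le_iff.2 fun t ht => ?_
    rw [Measure.restrict_apply ht, Measure.restrict_apply ht]
    rw [← inter_assoc]
    exact Measure.le_restrict_apply S (t ∩ U)
  exact h.mono_measure h2

theorem L2.integrable_smul {S : Set E2} (u : L2 S) {ψ : E2 → ℝ} (hc : Continuous ψ)
    (hs : HasCompactSupport ψ) : Integrable (fun x => ψ x • u x) (volume.restrict S) :=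
  (L2.locallyIntegrable u).integrable_smul_left_of_hasCompactSupport hc hs

theorem HasWeakPartial.zero (S : Set E2) (i : Fin 2) :
    HasWeakPartial S i ((0 : L2 S) : E2 → E3) ((0 : L2 S) : E2 → E3) := by
  refine ⟨L2.locallyIntegrableOn 0, L2.locallyIntegrableOn 0, ?_⟩
  intro φ _ _ _
  have h0 : ((0 : L2 S) : E2 → E3) =ᵐ[volume.restrict S] 0 := Lp.coeFn_zero E3 2 _
  have h (ψ : E2 → ℝ) : ∫ x in S, ψ x • ((0 : L2 S) : E2 → E3) x = 0 := by
    apply integral_eq_zero_of_ae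
    filter_upwards [h0] with x hx
    rw [hx]
    simp
  rw [h, h, neg_zero]

theorem HasWeakPartial.add {S : Set E2} {i : Fin 2} {u g v k : L2 S}
    (h₁ : HasWeakPartial S i u g) (h₂ : HasWeakPartial S i v k) :
    HasWeakPartial S i (u + v : L2 S) (g + k : L2 S) := by
  refine ⟨L2.locallyIntegrableOn _, L2.locallyIntegrableOn _, ?_⟩
  intro φ hφ hc hs
  have key (a b : L2 S) (ψ : E2 → ℝ) (hψ : Continuous ψ) (hψc : HasCompactSupport ψ) :
      ∫ x in S, ψ x • ((a + b : L2 S) : E2 → E3) x =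
        (∫ x in S, ψ x • a x) + ∫ x in S, ψ x • b x := by
    rw [← integral_add (L2.integrable_smul a hψ hψc) (L2.integrable_smul b hψ hψc)]
    apply integral_congr_ae
    filter_upwards [Lp.coeFn_add a b] with x hx
    rw [hx, Pi.add_apply, smul_add]
  rw [key u v _ ((hφ.continuous_fderiv (by simp)).clm_apply continuous_const)
      (hc.fderiv_apply (𝕜 := ℝ) _), key g k φ hφ.continuous hc, h₁.2.2 φ hφ hc hs,
    h₂.2.2 φ hφ hc hs, neg_add]

theorem HasWeakPartial.smul {S : Set E2} {i : Fin 2} {u g : L2 S} (c : ℝ)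
    (h₁ : HasWeakPartial S i u g) :
    HasWeakPartial S i (c • u : L2 S) (c • g : L2 S) := by
  refine ⟨L2.locallyIntegrableOn _, L2.locallyIntegrableOn _, ?_⟩
  intro φ hφ hc hs
  have key (a : L2 S) (ψ : E2 → ℝ) :
      ∫ x in S, ψ x • ((c • a : L2 S) : E2 → E3) x = c • ∫ x in S, ψ x • a x := by
    rw [← integral_smul]
    apply integral_congr_ae
    filter_upwards [Lp.coeFn_smul c a] with x hx
    rw [hx, Pi.smul_apply, smul_comm]
  rw [key, key, h₁.2.2 φ hφ hc hs, smul_neg]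

/-- The Sobolev space `H¹(S; ℝ³)`, with its Hilbert space structure: a function is stored together
with its first weak derivatives, and the squared norm is the sum of the squared `L²`-norms. -/
def H1Space (S : Set E2) : Submodule ℝ (PiLp 2 fun _ : Unit ⊕ Fin 2 => L2 S) where
  carrier := {u | ∀ i : Fin 2, HasWeakPartial S i (u (.inl ())) (u (.inr i))}
  zero_mem' := fun i => HasWeakPartial.zero S i
  add_mem' := fun h₁ h₂ i => (h₁ i).add (h₂ i)
  smul_mem' := fun c _ h i => (h i).smul c

/-- The Sobolev space `H²(S; ℝ³)`, with its Hilbert space structure: a function is stored together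
with its first and second weak derivatives, and the squared norm is the sum of the squared
`L²`-norms. -/
def H2Space (S : Set E2) :
    Submodule ℝ (PiLp 2 fun _ : Unit ⊕ Fin 2 ⊕ Fin 2 × Fin 2 => L2 S) where
  carrier := {u | (∀ i : Fin 2, HasWeakPartial S i (u (.inl ())) (u (.inr (.inl i)))) ∧
    ∀ i j : Fin 2, HasWeakPartial S j (u (.inr (.inl i))) (u (.inr (.inr (i, j))))}
  zero_mem' := ⟨fun i => HasWeakPartial.zero S i, fun _ j => HasWeakPartial.zero S j⟩
  add_mem' := fun h₁ h₂ =>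
    ⟨fun i => (h₁.1 i).add (h₂.1 i), fun i j => (h₁.2 i j).add (h₂.2 i j)⟩
  smul_mem' := fun c _ h => ⟨fun i => (h.1 i).smul c, fun i j => (h.2 i j).smul c⟩

/-- `H¹(S; ℝ³)` as a type. -/
abbrev H1 (S : Set E2) : Type := H1Space S

/-- `H²(S; ℝ³)` as a type. -/
abbrev H2 (S : Set E2) : Type := H2Space S

/-- The `L²` function underlying an element of `H¹`. -/
def H1.fn {S : Set E2} (n : H1 S) : L2 S := n.1 (.inl ())

/-- `∂ᵢ n` for `n ∈ H¹`. -/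
def H1.grad {S : Set E2} (n : H1 S) (i : Fin 2) : L2 S := n.1 (.inr i)

/-- The `L²` function underlying an element of `H²`. -/
def H2.fn {S : Set E2} (y : H2 S) : L2 S := y.1 (.inl ())

/-- `∂ᵢ y` for `y ∈ H²`. -/
def H2.grad {S : Set E2} (y : H2 S) (i : Fin 2) : L2 S := y.1 (.inr (.inl i))

/-- `∂ⱼ ∂ᵢ y` for `y ∈ H²`. -/
def H2.hess {S : Set E2} (y : H2 S) (i j : Fin 2) : L2 S := y.1 (.inr (.inr (i, j)))

/-- The embedding `H² × H¹ → L² × L²`. -/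
def toL2 {S : Set E2} (q : H2 S × H1 S) : L2 S × L2 S := (q.1.fn, q.2.fn)

/-- The set of admissible pairs `(y, n)`: `y` is an isometry of class `H²`, i.e. `(∇y)ᵀ ∇y = I`
a.e., and `n ∈ H¹` has values in the unit sphere. -/
def A2 (S : Set E2) : Set (H2 S × H1 S) :=
  {q | (∀ i j : Fin 2, ∀ᵐ x ∂(volume.restrict S),
      inner ℝ (q.1.grad i x) (q.1.grad j x) = if i = j then (1 : ℝ) else 0) ∧
    ∀ᵐ x ∂(volume.restrict S), ‖q.2.fn x‖ = 1}

/-! ### Matrices and the stored energy function -/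

/-- The Frobenius norm of a `3 × 3` matrix. -/
def frob (F : M3) : ℝ := Real.sqrt (∑ i, ∑ j, F i j ^ 2)

/-- The squared Frobenius distance of `F` to `SO(3)`. -/
def distSqSO3 (F : M3) : ℝ :=
  ⨅ R : Matrix.specialOrthogonalGroup (Fin 3) ℝ, frob (F - (R : M3)) ^ 2

/-- The assumptions on the stored energy function `W : (-1/2, 1/2) × ℝ^{3×3} → [0, ∞]`, with
constants `C_W > 0`, `q_W > 4` and modulus `r_W : [0, ∞) → [0, ∞]`; `Q x₃` is the quadratic form
of the expansion of `W x₃` at the identity. Only arguments `x₃ ∈ (-1/2, 1/2)` of `W` and `Q` and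
nonnegative arguments of `r_W` matter. -/
structure IsStoredEnergy (CW qW : ℝ) (rW : ℝ → ℝ≥0∞) (W : ℝ → M3 → ℝ≥0∞)
    (Q : ℝ → QuadraticForm ℝ M3) : Prop where
  CW_pos : 0 < CW
  qW_gt : 4 < qW
  rW_mono : MonotoneOn rW (Ici 0)
  rW_tendsto : Tendsto rW (𝓝[>] 0) (𝓝 0)
  borel : Measurable fun p : Ioo (-1 / 2 : ℝ) (1 / 2) × (Fin 3 → Fin 3 → ℝ) =>
    W p.1 (Matrix.of p.2)
  frame_indifference : ∀ x₃ ∈ Ioo (-1 / 2 : ℝ) (1 / 2),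
    ∀ R ∈ Matrix.specialOrthogonalGroup (Fin 3) ℝ, ∀ F : M3, W x₃ (R * F) = W x₃ F
  lower_bound : ∀ x₃ ∈ Ioo (-1 / 2 : ℝ) (1 / 2), ∀ F : M3,
    ENNReal.ofReal (1 / CW * distSqSO3 F) ≤ W x₃ F
  upper_bound : ∀ x₃ ∈ Ioo (-1 / 2 : ℝ) (1 / 2), ∀ F : M3, distSqSO3 F ≤ 1 / CW →
    W x₃ F ≤ ENNReal.ofReal (CW * distSqSO3 F)
  expansion : ∀ x₃ ∈ Ioo (-1 / 2 : ℝ) (1 / 2), ∀ G : M3,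
    ((W x₃ (1 + G) : EReal) - ((Q x₃ G : ℝ) : EReal)).abs ≤
      ENNReal.ofReal (frob G ^ 2) * rW (frob G)
  growth : ∀ x₃ ∈ Ioo (-1 / 2 : ℝ) (1 / 2), ∀ F : M3, 0 < F.det →
    ENNReal.ofReal (1 / CW * max (frob F ^ qW) (F.det ^ (-(qW / 2))) - CW) ≤ W x₃ F
  growth_top : ∀ x₃ ∈ Ioo (-1 / 2 : ℝ) (1 / 2), ∀ F : M3, F.det ≤ 0 → W x₃ F = ⊤

/-- `ι(A)`: the `3 × 3` matrix with upper left `2 × 2` block `A` and zeros elsewhere. -/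
def iota (A : M2) : M3 := !![A 0 0, A 0 1, 0; A 1 0, A 1 1, 0; 0, 0, 0]

/-- The symmetric part of a matrix. -/
def symPart (F : M3) : M3 := (1 / 2 : ℝ) • (F + F.transpose)

/-- Symmetric `2 × 2` matrices. -/
abbrev Sym2x2 : Type := {A : M2 // A.IsSymm}

/-! ### The effective quantities -/

/-- `Q₂(x₃, A) = min_d Q(x₃, ι(A) + sym (d ⊗ e₃))`. -/
def Q2 (Q : ℝ → QuadraticForm ℝ M3) (x₃ : ℝ) (A : M2) : ℝ :=
  ⨅ d : Fin 3 → ℝ, Q x₃ (iota A + symPart (Matrix.vecMulVec d (Pi.single 2 1)))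

/-- `1(x₃ > 0) ½ U`. -/
def halfTop (x₃ : ℝ) (U : M2) : M2 := if 0 < x₃ then (1 / 2 : ℝ) • U else 0

/-- The bending stiffness `Q_el(A)`. -/
def Qel (Q : ℝ → QuadraticForm ℝ M3) (A : M2) : ℝ :=
  ⨅ M : Sym2x2, ∫ x₃ in Ioo (-1 / 2 : ℝ) (1 / 2), Q2 Q x₃ (x₃ • A + M.1)

/-- The residual energy `E_res(U)`. -/
def Eres (Q : ℝ → QuadraticForm ℝ M3) (U : M2) : ℝ :=
  ⨅ p : Sym2x2 × Sym2x2,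
    ∫ x₃ in Ioo (-1 / 2 : ℝ) (1 / 2), Q2 Q x₃ (x₃ • p.1.1 + p.2.1 + halfTop x₃ U)

/-- The functional `(A, M) ↦ ∫ Q₂(x₃, 1(x₃ > 0) ½ G - (x₃ A + M))` on pairs of symmetric
matrices. -/
def corrector (Q : ℝ → QuadraticForm ℝ M3) (G : M2) (p : Sym2x2 × Sym2x2) : ℝ :=
  ∫ x₃ in Ioo (-1 / 2 : ℝ) (1 / 2), Q2 Q x₃ (halfTop x₃ G - (x₃ • p.1.1 + p.2.1))

instance : Nonempty (Sym2x2 × Sym2x2) :=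
  ⟨(⟨0, Matrix.isSymm_zero⟩, ⟨0, Matrix.isSymm_zero⟩)⟩

/-- The (unique) minimizer of `corrector Q G`. -/
def correctorMin (Q : ℝ → QuadraticForm ℝ M3) (G : M2) : Sym2x2 × Sym2x2 :=
  Classical.epsilon fun p => ∀ p', corrector Q G p ≤ corrector Q G p'

/-- The orthonormal basis `G₁, G₂, G₃` of the symmetric `2 × 2` matrices. -/
def basisG : Fin 3 → M2 :=
  ![!![1, 0; 0, 0], !![0, 0; 0, 1], !![0, 1 / Real.sqrt 2; 1 / Real.sqrt 2, 0]]

/-- The linear map `𝔹(U) = ∑ᵢ (U · Gᵢ) Aᵢ`. -/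
def BB (Q : ℝ → QuadraticForm ℝ M3) (U : M2) : M2 :=
  ∑ i, (U.transpose * basisG i).trace • (correctorMin Q (basisG i)).1.1

/-! ### The limiting energy -/

/-- `b_y = ∂₁y ∧ ∂₂y`. -/
def normal {S : Set E2} (y : H2 S) (x : E2) : E3 :=
  WithLp.toLp 2 (crossProduct (y.grad 0 x).ofLp (y.grad 1 x).ofLp)

/-- `II_y = (∇y)ᵀ ∇b_y`. -/
def II {S : Set E2} (y : H2 S) (x : E2) : M2 :=
  Matrix.of fun i j => inner ℝ (y.grad i x) (weakPartial S j (normal y) x)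

/-- `(∇y)ᵀ n`. -/
def localDirector {S : Set E2} (y : H2 S) (n : H1 S) (x : E2) : Fin 2 → ℝ :=
  fun i => inner ℝ (y.grad i x) (n.fn x)

/-- `⅓ I - (∇y)ᵀ n ⊗ (∇y)ᵀ n`. -/
def eigenstrain {S : Set E2} (y : H2 S) (n : H1 S) (x : E2) : M2 :=
  (1 / 3 : ℝ) • (1 : M2) - Matrix.vecMulVec (localDirector y n x) (localDirector y n x)

/-- The density of the elastic energy. -/
def elDensity (Q : ℝ → QuadraticForm ℝ M3) (rbar : ℝ) {S : Set E2} (y : H2 S) (n : H1 S)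
    (x : E2) : ℝ :=
  Qel Q (II y x + rbar • BB Q (eigenstrain y n x)) + rbar ^ 2 * Eres Q (eigenstrain y n x)

/-- The elastic energy. -/
def Eel (Q : ℝ → QuadraticForm ℝ M3) (rbar : ℝ) {S : Set E2} (y : H2 S) (n : H1 S) : ℝ :=
  ∫ x in S, elDensity Q rbar y n x

/-- The surface Oseen-Frank energy. -/
def EOF {S : Set E2} (n : H1 S) : ℝ :=
  1 / 2 * ∫ x in S, ∑ i, ‖n.grad i x‖ ^ 2

open Classical in
/-- The limiting energy as a functional on `L² × L²`, extended by `+∞` outside of the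
admissible set. -/
def energy (Q : ℝ → QuadraticForm ℝ M3) (rbar epsbar : ℝ) {S : Set E2} (p : L2 S × L2 S) :
    EReal :=
  if h : ∃ q ∈ A2 S, toL2 q = p then
    ((Eel Q rbar h.choose.1 h.choose.2 + epsbar ^ 2 * EOF h.choose.2 : ℝ) : EReal)
  else ⊤

/-- The sublevel `{(y, n) ∈ A₂ : E(y, n) ≤ C and ‖y‖_{L²} ≤ C}`. -/
def sublevel (Q : ℝ → QuadraticForm ℝ M3) (rbar epsbar : ℝ) (S : Set E2) (C : ℝ) :
    Set (H2 S × H1 S) :=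
  {q | q ∈ A2 S ∧ energy Q rbar epsbar (toL2 q) ≤ (C : EReal) ∧ ‖q.1.fn‖ ≤ C}

end LCEPlate

end

/-!
The elastic energy of an admissible pair is the integral of a fixed nonnegative quadratic form `P`
in six scalar fields: the entries of the second fundamental form and of the eigenstrain
(`IsStoredEnergy.exists_density`). Indeed, the expansion of the stored energy at the identity and
its two-sided bounds near `SO(3)` make `Q(x₃, ·)` comparable to the squared norm on symmetric
matrices, with constants depending only on `C_W`. Minimizing a coercive quadratic form over a
subspace gives a quadratic form and a linear minimizer (`QuadraticForm.exists_marginal`), and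
integrating quadratic forms gives a quadratic form. So `Q_el` and `E_res` are quadratic forms, `𝔹`
is linear, and all bounds depend only on `C_W` (`IsStoredEnergy.exists_effective`).

The geometric input is that the second derivatives of an `H²` isometry are normal to the surface
(`inner_hess_grad`). Hence `II` and `∇∇y` have the same norm and `II = -∇∇y · b` almost everywhere
(`II_ae`), where `b` has length one. As the eigenstrain is bounded, coercivity of `P` in the second
fundamental form gives the a priori estimate (`IsStoredEnergy.apriori`). The product rule for weak
derivatives that this requires is proved by mollification (`HasWeakPartial.coord_smul`).

For compactness and lower semicontinuity, energy bounds yield weakly convergent subsequences in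
`H²` and `H¹`. The functions `∇y` and `n` have pointwise constant norm, so a local form of Rellich's
theorem together with dominated convergence turns weak into strong `L²` convergence
(`tendsto_lintegral_of_weak`, `H1.tendsto_fn_of_weak`), without extension operators. The regularity
of the boundary is used only to bound `y` itself: from every point of a Lipschitz domain one sees a
ball of fixed radius (`IsLipschitzDomain.exists_ball`), so that a function with bounded gradient is
bounded in terms of its `L²`-norm (`IsLipschitzDomain.exists_bound`). Along a further subsequence
`∇y` and `n` converge almost everywhere; then the constraints pass to the limit, the eigenstrain
converges strongly, and `II`, a product of a weakly and of a boundedly almost everywhere convergent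
factor, converges weakly (`StrainConverges.II_weak`). Integrals of nonnegative quadratic forms are
weakly lower semicontinuous (`integral_quadratic_le_of_weak`), and continuous under strong
convergence. Finally, on sublevels, which are bounded, the inverse of the embedding into `L² × L²`
is continuous for the weak topology of `H² × H¹`, so that weak compactness follows from strong
compactness in `L²`.
-/

noncomputable section

namespace LCEPlate

/-! ### Weak sequential compactness in Hilbert spaces -/

/-- Bounded sequences in a Hilbert space have weakly convergent subsequences. The sequence lives in
a separable closed subspace, where the sequential Banach–Alaoglu theorem applies. -/
theorem exists_subseq_weak_tendsto {H : Type*} [NormedAddCommGroup H] [InnerProductSpace ℝ H]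
    [CompleteSpace H] (u : ℕ → H) (M : ℝ) (hu : ∀ k, ‖u k‖ ≤ M) :
    ∃ (v : H) (φ : ℕ → ℕ), StrictMono φ ∧
      ∀ ℓ : StrongDual ℝ H, Tendsto (fun k => ℓ (u (φ k))) atTop (𝓝 (ℓ v)) := by
  set K : Submodule ℝ H := (Submodule.span ℝ (range u)).topologicalClosure with hK
  have hKc : IsClosed (K : Set H) := Submodule.isClosed_topologicalClosure _
  have : CompleteSpace K := hKc.completeSpace_coe
  have hsep : TopologicalSpace.IsSeparable (K : Set H) := by
    rw [hK, Submodule.topologicalClosure_coe]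
    exact ((countable_range u).isSeparable.span (R := ℝ)).closure
  have : TopologicalSpace.SeparableSpace K := hsep.separableSpace
  have huK : ∀ k, u k ∈ K := fun k =>
    Submodule.le_topologicalClosure _ (Submodule.subset_span (mem_range_self k))
  let w : ℕ → WeakDual ℝ K := fun k =>
    StrongDual.toWeakDual (InnerProductSpace.toDual ℝ K ⟨u k, huK k⟩)
  have hw : ∀ k, w k ∈ WeakDual.toStrongDual ⁻¹' Metric.closedBall (0 : StrongDual ℝ K) M := by
    intro k
    refine (mem_closedBall_zero_iff (E := StrongDual ℝ K)).2 ?_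
    change ‖InnerProductSpace.toDual ℝ K ⟨u k, huK k⟩‖ ≤ M
    rw [LinearIsometryEquiv.norm_map]
    exact hu k
  obtain ⟨a, -, φ, hφ, ha⟩ := WeakDual.isSeqCompact_closedBall ℝ K 0 M hw
  set v : K := (InnerProductSpace.toDual ℝ K).symm (WeakDual.toStrongDual a)
  refine ⟨v, φ, hφ, fun ℓ => ?_⟩
  set h : K := (InnerProductSpace.toDual ℝ K).symm (ℓ.comp K.subtypeL)
  have hh : ∀ x : K, ℓ x = inner ℝ h x := by
    intro x
    rw [InnerProductSpace.toDual_symm_apply]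
    rfl
  have h1 : Tendsto (fun k => (w (φ k)) h) atTop (𝓝 (a h)) :=
    ((WeakDual.eval_continuous h).tendsto a).comp ha
  have h2 : ℓ v = a h := by
    rw [hh, real_inner_comm, InnerProductSpace.toDual_symm_apply]
    rfl
  rw [h2]
  refine h1.congr fun k => ?_
  have := hh ⟨u (φ k), huK _⟩
  rw [real_inner_comm] at this
  rw [this]
  rfl

/-! ### Weak derivatives -/

/-- The element `x ↦ ψ(x) e` of `L²(S; ℝ³)`. -/
def testL2 (S : Set E2) (ψ : E2 → ℝ) (hc : Continuous ψ) (hs : HasCompactSupport ψ) (e : E3) :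
    L2 S :=
  MemLp.toLp (fun x => ψ x • e)
    (((hc.smul continuous_const).memLp_of_hasCompactSupport (hs.smul_right)).restrict S)

theorem inner_testL2 {S : Set E2} (ψ : E2 → ℝ) (hc : Continuous ψ) (hs : HasCompactSupport ψ)
    (e : E3) (u : L2 S) :
    inner ℝ (testL2 S ψ hc hs e) u = inner ℝ e (∫ x in S, ψ x • u x) := by
  rw [MeasureTheory.L2.inner_def, ← integral_inner (L2.integrable_smul u hc hs)]
  apply integral_congr_ae
  have hm : MemLp (fun x => ψ x • e) 2 (volume.restrict S) :=
    ((hc.smul continuous_const).memLp_of_hasCompactSupport (hs.smul_right)).restrict S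
  filter_upwards [hm.coeFn_toLp] with x hx
  rw [testL2, hx, real_inner_smul_left, real_inner_smul_right]

theorem hasWeakPartial_iff {S : Set E2} {i : Fin 2} {u g : L2 S} :
    HasWeakPartial S i u g ↔ ∀ (φ : E2 → ℝ) (hφ : ContDiff ℝ ∞ φ) (hc : HasCompactSupport φ),
      tsupport φ ⊆ S → ∀ e : E3,
      inner ℝ (testL2 S (fun x => fderiv ℝ φ x (EuclideanSpace.single i 1))
        ((hφ.continuous_fderiv (by simp)).clm_apply continuous_const)
        (hc.fderiv_apply (𝕜 := ℝ) _) e) u = - inner ℝ (testL2 S φ hφ.continuous hc e) g := by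
  constructor
  · intro h φ hφ hc hs e
    rw [inner_testL2, inner_testL2, h.2.2 φ hφ hc hs, inner_neg_right]
  · intro h
    refine ⟨L2.locallyIntegrableOn u, L2.locallyIntegrableOn g, fun φ hφ hc hs => ?_⟩
    refine ext_inner_left ℝ fun e => ?_
    have := h φ hφ hc hs e
    rw [inner_testL2, inner_testL2] at this
    rw [this, inner_neg_right]

theorem isClosed_setOf_hasWeakPartial {S : Set E2} {X : Type*} [TopologicalSpace X]
    {f g : X → L2 S} (hf : Continuous f) (hg : Continuous g) (i : Fin 2) :
    IsClosed {x | HasWeakPartial S i (f x) (g x)} := by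
  simp only [hasWeakPartial_iff, ofPred_forall]
  refine isClosed_iInter fun φ => isClosed_iInter fun hφ => isClosed_iInter fun hc =>
    isClosed_iInter fun hs => isClosed_iInter fun e => ?_
  exact isClosed_eq (continuous_const.inner hf) (continuous_const.inner hg).neg

theorem isClosed_H1Space (S : Set E2) :
    IsClosed (H1Space S : Set (PiLp 2 fun _ : Unit ⊕ Fin 2 => L2 S)) := by
  have : (H1Space S : Set (PiLp 2 fun _ : Unit ⊕ Fin 2 => L2 S)) =
      ⋂ i : Fin 2, {u | HasWeakPartial S i (u (.inl ())) (u (.inr i))} := by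
    ext u; simp [H1Space]
  rw [this]
  exact isClosed_iInter fun i => isClosed_setOf_hasWeakPartial
    (PiLp.continuous_apply 2 (fun _ => L2 S) _) (PiLp.continuous_apply 2 (fun _ => L2 S) _) i

theorem isClosed_H2Space (S : Set E2) :
    IsClosed (H2Space S : Set (PiLp 2 fun _ : Unit ⊕ Fin 2 ⊕ Fin 2 × Fin 2 => L2 S)) := by
  have : (H2Space S : Set (PiLp 2 fun _ : Unit ⊕ Fin 2 ⊕ Fin 2 × Fin 2 => L2 S)) =
      (⋂ i : Fin 2, {u | HasWeakPartial S i (u (.inl ())) (u (.inr (.inl i)))}) ∩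
      ⋂ i : Fin 2, ⋂ j : Fin 2,
        {u | HasWeakPartial S j (u (.inr (.inl i))) (u (.inr (.inr (i, j))))} := by
    ext u; simp [H2Space]
  rw [this]
  exact (isClosed_iInter fun i => isClosed_setOf_hasWeakPartial
    (PiLp.continuous_apply 2 (fun _ => L2 S) _) (PiLp.continuous_apply 2 (fun _ => L2 S) _) i).inter
    (isClosed_iInter fun i => isClosed_iInter fun j => isClosed_setOf_hasWeakPartial
    (PiLp.continuous_apply 2 (fun _ => L2 S) _) (PiLp.continuous_apply 2 (fun _ => L2 S) _) j)

instance (S : Set E2) : CompleteSpace (H1 S) := (isClosed_H1Space S).completeSpace_coe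

instance (S : Set E2) : CompleteSpace (H2 S) := (isClosed_H2Space S).completeSpace_coe

theorem H1.hasWeakPartial {S : Set E2} (n : H1 S) (i : Fin 2) :
    HasWeakPartial S i n.fn (n.grad i) := n.2 i

theorem H2.hasWeakPartial {S : Set E2} (y : H2 S) (i : Fin 2) :
    HasWeakPartial S i y.fn (y.grad i) := y.2.1 i

theorem H2.hasWeakPartial_grad {S : Set E2} (y : H2 S) (i j : Fin 2) :
    HasWeakPartial S j (y.grad i) (y.hess i j) := y.2.2 i j

/-- The map `n ↦ n` from `H¹` to `L²`, as a bounded operator. -/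
def H1.fnL (S : Set E2) : H1 S →L[ℝ] L2 S :=
  (PiLp.proj (𝕜 := ℝ) 2 (fun _ : Unit ⊕ Fin 2 => L2 S) (.inl ())).comp (H1Space S).subtypeL

/-- The map `n ↦ ∂ᵢ n` from `H¹` to `L²`, as a bounded operator. -/
def H1.gradL (S : Set E2) (i : Fin 2) : H1 S →L[ℝ] L2 S :=
  (PiLp.proj (𝕜 := ℝ) 2 (fun _ : Unit ⊕ Fin 2 => L2 S) (.inr i)).comp (H1Space S).subtypeL

/-- The map `y ↦ y` from `H²` to `L²`, as a bounded operator. -/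
def H2.fnL (S : Set E2) : H2 S →L[ℝ] L2 S :=
  (PiLp.proj (𝕜 := ℝ) 2 (fun _ : Unit ⊕ Fin 2 ⊕ Fin 2 × Fin 2 => L2 S) (.inl ())).comp
    (H2Space S).subtypeL

/-- The map `y ↦ ∂ᵢ y` from `H²` to `L²`, as a bounded operator. -/
def H2.gradL (S : Set E2) (i : Fin 2) : H2 S →L[ℝ] L2 S :=
  (PiLp.proj (𝕜 := ℝ) 2 (fun _ : Unit ⊕ Fin 2 ⊕ Fin 2 × Fin 2 => L2 S) (.inr (.inl i))).comp
    (H2Space S).subtypeL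

/-- The map `y ↦ ∂ⱼ ∂ᵢ y` from `H²` to `L²`, as a bounded operator. -/
def H2.hessL (S : Set E2) (i j : Fin 2) : H2 S →L[ℝ] L2 S :=
  (PiLp.proj (𝕜 := ℝ) 2 (fun _ : Unit ⊕ Fin 2 ⊕ Fin 2 × Fin 2 => L2 S) (.inr (.inr (i, j)))).comp
    (H2Space S).subtypeL

@[simp] theorem H1.fnL_apply {S : Set E2} (n : H1 S) : H1.fnL S n = n.fn := rfl
@[simp] theorem H1.gradL_apply {S : Set E2} (n : H1 S) (i : Fin 2) :
    H1.gradL S i n = n.grad i := rfl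

theorem H1.norm_sq {S : Set E2} (n : H1 S) :
    ‖n‖ ^ 2 = ‖n.fn‖ ^ 2 + ∑ i, ‖n.grad i‖ ^ 2 := by
  rw [Submodule.coe_norm, PiLp.norm_sq_eq_of_L2, Fintype.sum_sum_type]
  simp [H1.fn, H1.grad]

theorem H2.norm_sq {S : Set E2} (y : H2 S) :
    ‖y‖ ^ 2 = ‖y.fn‖ ^ 2 + ∑ i, ‖y.grad i‖ ^ 2 + ∑ i, ∑ j, ‖y.hess i j‖ ^ 2 := by
  rw [Submodule.coe_norm, PiLp.norm_sq_eq_of_L2, Fintype.sum_sum_type, Fintype.sum_sum_type,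
    Fintype.sum_prod_type]
  simp [H2.fn, H2.grad, H2.hess, add_assoc]

/-- The derivative `∂ᵢ y` of `y ∈ H²` as an element of `H¹`. -/
def H2.gradH1 {S : Set E2} (y : H2 S) (i : Fin 2) : H1 S :=
  ⟨WithLp.toLp 2 (Sum.elim (fun _ => y.grad i) (fun j => y.hess i j)), fun j => y.2.2 i j⟩

@[simp] theorem H2.gradH1_fn {S : Set E2} (y : H2 S) (i : Fin 2) : (y.gradH1 i).fn = y.grad i := rfl
@[simp] theorem H2.gradH1_grad {S : Set E2} (y : H2 S) (i j : Fin 2) :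
    (y.gradH1 i).grad j = y.hess i j := rfl

/-- An element of `H²` read as an element of `H¹`. -/
def H2.toH1 {S : Set E2} (y : H2 S) : H1 S :=
  ⟨WithLp.toLp 2 (Sum.elim (fun _ => y.fn) (fun i => y.grad i)), fun i => y.2.1 i⟩

/-- Weak partial derivatives are unique almost everywhere. -/
theorem HasWeakPartial.ae_eq {S : Set E2} (hS : IsOpen S) {i : Fin 2} {u v g k : E2 → E3}
    (huv : u =ᵐ[volume.restrict S] v)
    (h₁ : HasWeakPartial S i u g) (h₂ : HasWeakPartial S i v k) : g =ᵐ[volume.restrict S] k := by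
  have hloc : LocallyIntegrableOn (fun x => g x - k x) S := h₁.2.1.sub h₂.2.1
  have := hS.ae_eq_zero_of_integral_contDiff_smul_eq_zero hloc (fun φ hφ hc hs => ?_)
  · rw [Filter.EventuallyEq, ae_restrict_iff' hS.measurableSet]
    filter_upwards [this] with x hx hxS
    exact sub_eq_zero.1 (hx hxS)
  · have e : ∫ x, φ x • (g x - k x) = ∫ x in S, φ x • (g x - k x) := by
      rw [setIntegral_eq_integral_of_forall_compl_eq_zero]
      intro x hx
      rw [image_eq_zero_of_notMem_tsupport fun h => hx (hs h), zero_smul]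
    have hi : ∀ w : E2 → E3, LocallyIntegrableOn w S →
        Integrable (fun x => φ x • w x) (volume.restrict S) := by
      intro w hw
      have h1 : IntegrableOn w (tsupport φ) := hw.integrableOn_compact_subset hs hc
      have h2 : IntegrableOn (fun x => φ x • w x) (tsupport φ) :=
        h1.continuousOn_smul hφ.continuous.continuousOn hc
      have h3 : Integrable (fun x => φ x • w x) := by
        refine (integrableOn_iff_integrable_of_support_subset ?_).1 h2
        exact (Function.support_smul_subset_left φ w).trans (subset_tsupport φ)
      exact h3.restrict
    have h1 := h₁.2.2 φ hφ hc hs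
    have h2 := h₂.2.2 φ hφ hc hs
    have h3 : ∫ x in S, fderiv ℝ φ x (EuclideanSpace.single i 1) • u x =
        ∫ x in S, fderiv ℝ φ x (EuclideanSpace.single i 1) • v x := by
      apply integral_congr_ae
      filter_upwards [huv] with x hx
      rw [hx]
    rw [e]
    simp only [smul_sub]
    rw [integral_sub (hi g h₁.2.1) (hi k h₂.2.1), sub_eq_zero]
    rw [h1, h2, neg_inj] at h3
    exact h3

theorem weakPartial_ae_eq {S : Set E2} (hS : IsOpen S) {i : Fin 2} {u g : E2 → E3}
    (h : HasWeakPartial S i u g) : weakPartial S i u =ᵐ[volume.restrict S] g := by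
  have hex : ∃ g, HasWeakPartial S i u g := ⟨g, h⟩
  rw [weakPartial, dif_pos hex]
  exact hex.choose_spec.ae_eq hS (EventuallyEq.refl _ _) h

theorem H1.ext_fn {S : Set E2} (hS : IsOpen S) {n m : H1 S} (h : n.fn = m.fn) : n = m := by
  have hg : ∀ i, n.grad i = m.grad i := fun i =>
    Lp.ext ((n.hasWeakPartial i).ae_eq hS (by rw [h]) (m.hasWeakPartial i))
  apply Subtype.ext
  ext1 a
  rcases a with a | i
  · exact h
  · exact hg i

theorem H2.ext_fn {S : Set E2} (hS : IsOpen S) {y z : H2 S} (h : y.fn = z.fn) : y = z := by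
  have hg : ∀ i, y.grad i = z.grad i := fun i =>
    Lp.ext ((y.hasWeakPartial i).ae_eq hS (by rw [h]) (z.hasWeakPartial i))
  have hh : ∀ i j, y.hess i j = z.hess i j := fun i j =>
    Lp.ext ((y.hasWeakPartial_grad i j).ae_eq hS (by rw [hg]) (z.hasWeakPartial_grad i j))
  apply Subtype.ext
  ext1 a
  rcases a with a | i | ⟨i, j⟩
  · exact h
  · exact hg i
  · exact hh i j

theorem toL2_injective {S : Set E2} (hS : IsOpen S) : Function.Injective (toL2 (S := S)) := by
  rintro ⟨y, n⟩ ⟨z, m⟩ h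
  simp only [toL2, Prod.mk.injEq] at h
  rw [H2.ext_fn hS h.1, H1.ext_fn hS h.2]

theorem two_le_smooth : (1 + 1 : WithTop ℕ∞) ≤ ((⊤ : ℕ∞) : WithTop ℕ∞) := by
  rw [one_add_one_eq_two]
  exact WithTop.coe_le_coe.2 (le_top : (2 : ℕ∞) ≤ ⊤)

/-- Weak second derivatives commute. -/
theorem H2.hess_symm {S : Set E2} (hS : IsOpen S) (y : H2 S) (i j : Fin 2) :
    y.hess i j = y.hess j i := by
  have key : ∀ (i j : Fin 2) (φ : E2 → ℝ), ContDiff ℝ ∞ φ → HasCompactSupport φ →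
      tsupport φ ⊆ S → ∫ x in S, fderiv ℝ (fun x => fderiv ℝ φ x (EuclideanSpace.single j 1)) x
        (EuclideanSpace.single i 1) • y.fn x = ∫ x in S, φ x • y.hess i j x := by
    intro i j φ hφ hc hs
    have hd : ContDiff ℝ ∞ (fun x => fderiv ℝ φ x (EuclideanSpace.single j 1)) :=
      (hφ.fderiv_right (by simp)).clm_apply contDiff_const
    have hts : tsupport (fun x => fderiv ℝ φ x (EuclideanSpace.single j 1)) ⊆ tsupport φ :=
      tsupport_fderiv_apply_subset ℝ _
    rw [(y.hasWeakPartial i).2.2 _ hd (hc.fderiv_apply (𝕜 := ℝ) _) (hts.trans hs),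
      (y.hasWeakPartial_grad i j).2.2 φ hφ hc hs, neg_neg]
  have hw : HasWeakPartial S i (y.grad j) (y.hess i j) := by
    refine ⟨L2.locallyIntegrableOn _, L2.locallyIntegrableOn _, fun φ hφ hc hs => ?_⟩
    rw [(y.hasWeakPartial_grad j i).2.2 φ hφ hc hs, ← key i j φ hφ hc hs, ← key j i φ hφ hc hs]
    congr 1
    apply integral_congr_ae
    refine Eventually.of_forall fun x => ?_
    simp only
    congr 1
    have hsym : IsSymmSndFDerivAt ℝ φ x := hφ.contDiffAt.isSymmSndFDerivAt (by
      simpa [one_add_one_eq_two] using two_le_smooth)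
    have hdiff : DifferentiableAt ℝ (fderiv ℝ φ) x :=
      ((hφ.fderiv_right (m := 1) two_le_smooth).differentiable one_ne_zero) x
    have hcalc : ∀ a b : E2, fderiv ℝ (fun x => fderiv ℝ φ x a) x b =
        fderiv ℝ (fderiv ℝ φ) x b a := by
      intro a b
      rw [fderiv_clm_apply hdiff (differentiableAt_const _)]
      simp
    rw [hcalc, hcalc, hsym.eq]
  exact Lp.ext (hw.ae_eq hS (EventuallyEq.refl _ _) (y.hasWeakPartial_grad j i))

/-! ### Mollification -/

/-- A bump function at the origin with support of radius `1 / (k + 1)`. -/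
def bump (k : ℕ) : ContDiffBump (0 : E2) where
  rIn := 1 / (2 * ((k : ℝ) + 1))
  rOut := 1 / ((k : ℝ) + 1)
  rIn_pos := by positivity
  rIn_lt_rOut := by
    apply one_div_lt_one_div_of_lt <;> linarith [(Nat.cast_nonneg k : (0 : ℝ) ≤ k)]

/-- The mollification kernel `ρ_k`. -/
def kernel (k : ℕ) : E2 → ℝ := (bump k).normed volume

/-- The mollification `ρ_k ⋆ f`. -/
def mollify (k : ℕ) (f : E2 → E3) : E2 → E3 :=
  convolution (kernel k) f (ContinuousLinearMap.lsmul ℝ ℝ) volume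

theorem mollify_apply (k : ℕ) (f : E2 → E3) (x : E2) :
    mollify k f x = ∫ t, kernel k t • f (x - t) := rfl

theorem kernel_nonneg (k : ℕ) (t : E2) : 0 ≤ kernel k t := (bump k).nonneg_normed t

theorem kernel_contDiff (k : ℕ) : ContDiff ℝ ∞ (kernel k) := (bump k).contDiff_normed

theorem kernel_continuous (k : ℕ) : Continuous (kernel k) := (kernel_contDiff k).continuous

theorem kernel_hasCompactSupport (k : ℕ) : HasCompactSupport (kernel k) :=
  (bump k).hasCompactSupport_normed

theorem kernel_integral (k : ℕ) : ∫ t, kernel k t = 1 := (bump k).integral_normed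

theorem kernel_eq_zero (k : ℕ) {t : E2} (ht : 1 / ((k : ℝ) + 1) ≤ ‖t‖) : kernel k t = 0 := by
  have h : t ∉ Function.support (kernel k) := by
    rw [kernel, (bump k).support_normed_eq]
    simpa [bump] using ht
  simpa using h

theorem kernel_lintegral (k : ℕ) : ∫⁻ t, ENNReal.ofReal (kernel k t) = 1 := by
  have hi : Integrable (kernel k) := (bump k).integrable_normed
  rw [← ofReal_integral_eq_lintegral_ofReal hi
    (Eventually.of_forall (kernel_nonneg k)), kernel_integral, ENNReal.ofReal_one]

theorem eLpNorm_two_sq {X : Type*} [MeasurableSpace X] (μ : Measure X) {F : Type*}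
    [NormedAddCommGroup F] (f : X → F) :
    eLpNorm f 2 μ ^ 2 = ∫⁻ x, ‖f x‖ₑ ^ 2 ∂μ := by
  have := eLpNorm_nnreal_pow_eq_lintegral (f := f) (μ := μ) (p := 2) (by norm_num)
  simpa only [NNReal.coe_ofNat, ENNReal.coe_ofNat, ENNReal.rpow_ofNat] using this

/-- Jensen's inequality for the square and the probability density `ρ_k`. -/
theorem enorm_integral_kernel_sq_le (k : ℕ) {f : E2 → E3} (hf : StronglyMeasurable f) :
    ‖∫ t, kernel k t • f t‖ₑ ^ 2 ≤ ∫⁻ t, ENNReal.ofReal (kernel k t) * ‖f t‖ₑ ^ 2 := by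
  have hkm : Measurable fun t => ENNReal.ofReal (kernel k t) :=
    (kernel_continuous k).measurable.ennreal_ofReal
  set ν : Measure E2 := volume.withDensity fun t => ENNReal.ofReal (kernel k t)
  have hν : IsProbabilityMeasure ν := ⟨by
    rw [withDensity_apply _ MeasurableSet.univ, setLIntegral_univ, kernel_lintegral]⟩
  have h1 : ‖∫ t, kernel k t • f t‖ₑ ≤ eLpNorm f 1 ν := by
    rw [eLpNorm_one_eq_lintegral_enorm, lintegral_withDensity_eq_lintegral_mul _ hkm
      hf.enorm]
    refine (enorm_integral_le_lintegral_enorm _).trans (le_of_eq (lintegral_congr fun t => ?_))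
    rw [enorm_smul, Pi.mul_apply, Real.enorm_eq_ofReal (kernel_nonneg k t)]
  have h2 : eLpNorm f 1 ν ≤ eLpNorm f 2 ν :=
    eLpNorm_le_eLpNorm_of_exponent_le (by norm_num) hf.aestronglyMeasurable
  have h3 : eLpNorm f 2 ν ^ 2 = ∫⁻ t, ENNReal.ofReal (kernel k t) * ‖f t‖ₑ ^ 2 := by
    rw [eLpNorm_two_sq, lintegral_withDensity_eq_lintegral_mul _ hkm (hf.enorm.pow_const 2)]
    rfl
  calc _ ≤ eLpNorm f 2 ν ^ 2 := by gcongr; exact h1.trans h2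
    _ = _ := h3

theorem integrable_kernel_smul (k : ℕ) {f : E2 → E3} (hf : LocallyIntegrable f) (x : E2) :
    Integrable fun t => kernel k t • f (x - t) :=
  (kernel_hasCompactSupport k).convolutionExists_left (ContinuousLinearMap.lsmul ℝ ℝ)
    (kernel_continuous k) hf x

theorem mollify_sub_self (k : ℕ) {f : E2 → E3} (hf : LocallyIntegrable f) (x : E2) :
    mollify k f x - f x = ∫ t, kernel k t • (f (x - t) - f x) := by
  have h1 : f x = ∫ t, kernel k t • f x := by
    rw [integral_smul_const, kernel_integral, one_smul]
  have hi : Integrable (kernel k) := (bump k).integrable_normed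
  conv_lhs => rw [h1]
  rw [mollify_apply, ← integral_sub (integrable_kernel_smul k hf x) (hi.smul_const _)]
  simp only [smul_sub]

/-- The `L²`-distance of a function to its mollification is controlled by the `L²`-distance to its
translates. -/
theorem lintegral_mollify_sub_le (k : ℕ) {f : E2 → E3} (hfm : StronglyMeasurable f)
    (hf : LocallyIntegrable f) (K : Set E2) (c : ℝ≥0∞)
    (hc : ∀ t : E2, ‖t‖ < 1 / ((k : ℝ) + 1) → ∫⁻ x in K, ‖f (x - t) - f x‖ₑ ^ 2 ≤ c) :
    ∫⁻ x in K, ‖mollify k f x - f x‖ₑ ^ 2 ≤ c := by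
  have hm : Measurable fun p : E2 × E2 => ENNReal.ofReal (kernel k p.2) *
      ‖f (p.1 - p.2) - f p.1‖ₑ ^ 2 := by
    refine ((kernel_continuous k).measurable.comp measurable_snd).ennreal_ofReal.mul ?_
    refine Measurable.pow_const ?_ 2
    exact ((hfm.comp_measurable (measurable_fst.sub measurable_snd)).sub
      (hfm.comp_measurable measurable_fst)).enorm
  calc ∫⁻ x in K, ‖mollify k f x - f x‖ₑ ^ 2
      ≤ ∫⁻ x in K, ∫⁻ t, ENNReal.ofReal (kernel k t) * ‖f (x - t) - f x‖ₑ ^ 2 := by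
        refine lintegral_mono fun x => ?_
        rw [mollify_sub_self k hf x]
        exact enorm_integral_kernel_sq_le k
          ((hfm.comp_measurable (measurable_const.sub measurable_id)).sub stronglyMeasurable_const)
    _ = ∫⁻ t, ∫⁻ x in K, ENNReal.ofReal (kernel k t) * ‖f (x - t) - f x‖ₑ ^ 2 :=
        lintegral_lintegral_swap hm.aemeasurable
    _ ≤ ∫⁻ t, ENNReal.ofReal (kernel k t) * c := by
        refine lintegral_mono fun t => ?_
        rw [lintegral_const_mul' _ _ ENNReal.ofReal_ne_top]
        by_cases ht : ‖t‖ < 1 / ((k : ℝ) + 1)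
        · gcongr
          exact hc t ht
        · rw [kernel_eq_zero k (not_lt.1 ht)]
          simp
    _ = c := by
        rw [lintegral_mul_const _ (kernel_continuous k).measurable.ennreal_ofReal,
          kernel_lintegral, one_mul]

/-- Mollification does not increase the `L²`-norm. -/
theorem lintegral_mollify_sq_le (k : ℕ) {f : E2 → E3} (hfm : StronglyMeasurable f) :
    ∫⁻ x, ‖mollify k f x‖ₑ ^ 2 ≤ ∫⁻ x, ‖f x‖ₑ ^ 2 := by
  have hm : Measurable fun p : E2 × E2 => ENNReal.ofReal (kernel k p.2) *
      ‖f (p.1 - p.2)‖ₑ ^ 2 := by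
    refine ((kernel_continuous k).measurable.comp measurable_snd).ennreal_ofReal.mul ?_
    refine Measurable.pow_const ?_ 2
    exact (hfm.comp_measurable (measurable_fst.sub measurable_snd)).enorm
  calc ∫⁻ x, ‖mollify k f x‖ₑ ^ 2
      ≤ ∫⁻ x, ∫⁻ t, ENNReal.ofReal (kernel k t) * ‖f (x - t)‖ₑ ^ 2 := by
        refine lintegral_mono fun x => ?_
        exact enorm_integral_kernel_sq_le k
          (hfm.comp_measurable (measurable_const.sub measurable_id))
    _ = ∫⁻ t, ∫⁻ x, ENNReal.ofReal (kernel k t) * ‖f (x - t)‖ₑ ^ 2 :=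
        lintegral_lintegral_swap hm.aemeasurable
    _ = ∫⁻ t, ENNReal.ofReal (kernel k t) * ∫⁻ x, ‖f x‖ₑ ^ 2 := by
        refine lintegral_congr fun t => ?_
        rw [lintegral_const_mul' _ _ ENNReal.ofReal_ne_top,
          lintegral_sub_right_eq_self (fun x => ‖f x‖ₑ ^ 2) t]
    _ = _ := by
        rw [lintegral_mul_const _ (kernel_continuous k).measurable.ennreal_ofReal,
          kernel_lintegral, one_mul]

theorem tendsto_zero_of_sq {f : ℕ → ℝ≥0∞} (h : Tendsto (fun k => f k ^ 2) atTop (𝓝 0)) :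
    Tendsto f atTop (𝓝 0) := by
  have h2 := (ENNReal.continuous_rpow_const (y := 1 / 2)).tendsto 0 |>.comp h
  rw [ENNReal.zero_rpow_of_pos (by norm_num)] at h2
  refine h2.congr fun k => ?_
  rw [Function.comp_apply, ← ENNReal.rpow_natCast, ← ENNReal.rpow_mul]
  norm_num

/-- Translations act continuously on `L²`. -/
theorem tendsto_lintegral_translate {f : E2 → E3} (hf : MemLp f 2 volume) :
    Tendsto (fun t : E2 => ∫⁻ x, ‖f (x - t) - f x‖ₑ ^ 2) (𝓝 0) (𝓝 0) := by
  let g : E2 → C(E2, E2) := fun t => ⟨fun x => x - t, by fun_prop⟩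
  have hg : Continuous g :=
    ContinuousMap.continuous_of_continuous_uncurry _ (by
      change Continuous fun p : E2 × E2 => p.2 - p.1
      fun_prop)
  have hgm : ∀ t, MeasurePreserving (g t) volume volume := fun t => measurePreserving_sub_right _ t
  have h := Filter.Tendsto.compMeasurePreservingLp (p := 2) (l := 𝓝 (0 : E2))
    (f := fun _ => hf.toLp f) tendsto_const_nhds (hg.tendsto 0) hgm (hgm 0) (by norm_num)
  rw [tendsto_iff_edist_tendsto_0] at h
  have h2 := (ENNReal.continuous_pow 2).tendsto 0 |>.comp h
  rw [zero_pow two_ne_zero] at h2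
  refine h2.congr fun t => ?_
  simp only [Function.comp]
  rw [Lp.edist_def, eLpNorm_two_sq]
  refine lintegral_congr_ae ?_
  have e0 : hf.toLp f =ᵐ[volume] f := hf.coeFn_toLp
  have e : ∀ t : E2, (Lp.compMeasurePreserving (g t) (hgm t) (hf.toLp f) : E2 → E3) =ᵐ[volume]
      fun x => f (x - t) := fun t =>
    (Lp.coeFn_compMeasurePreserving _ (hgm t)).trans
      ((hgm t).quasiMeasurePreserving.ae_eq_comp e0)
  filter_upwards [e t, e 0] with x h1 h2
  rw [Pi.sub_apply, h1, h2, sub_zero]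

theorem tendsto_lintegral_mollify {f : E2 → E3} (hfm : StronglyMeasurable f)
    (hf : MemLp f 2 volume) :
    Tendsto (fun k => ∫⁻ x, ‖mollify k f x - f x‖ₑ ^ 2) atTop (𝓝 0) := by
  rw [ENNReal.tendsto_nhds_zero]
  intro ε hε
  have h := ENNReal.tendsto_nhds_zero.1 (tendsto_lintegral_translate hf) ε hε
  obtain ⟨δ, hδ, hball⟩ := Metric.eventually_nhds_iff.1 h
  have hk : ∀ᶠ k : ℕ in atTop, 1 / ((k : ℝ) + 1) < δ :=
    tendsto_one_div_add_atTop_nhds_zero_nat.eventually_lt_const hδ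
  filter_upwards [hk] with k hk
  have := lintegral_mollify_sub_le k hfm (hf.locallyIntegrable (by norm_num)) univ ε (fun t ht => by
    rw [setLIntegral_univ]
    exact hball (by simpa using ht.trans hk))
  rwa [setLIntegral_univ] at this

theorem ae_tendsto_mollify {f : E2 → E3} (hf : LocallyIntegrable f) :
    ∀ᵐ x, Tendsto (fun k => mollify k f x) atTop (𝓝 (f x)) := by
  refine ContDiffBump.ae_convolution_tendsto_right_of_locallyIntegrable (φ := bump) (K := 2) ?_ ?_ hf
  · exact tendsto_one_div_add_atTop_nhds_zero_nat
  · refine Eventually.of_forall fun k => le_of_eq ?_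
    simp only [bump]
    field_simp

theorem mollify_contDiff (k : ℕ) {f : E2 → E3} (hf : LocallyIntegrable f) :
    ContDiff ℝ ∞ (mollify k f) :=
  (kernel_hasCompactSupport k).contDiff_convolution_left _ (kernel_contDiff k) hf

/-- The extension by zero of a function on `S`. -/
def extend (S : Set E2) (u : L2 S) : E2 → E3 := S.indicator u

theorem extend_stronglyMeasurable {S : Set E2} (hS : IsOpen S) (u : L2 S) :
    StronglyMeasurable (extend S u) :=
  (Lp.stronglyMeasurable u).indicator hS.measurableSet

theorem extend_memLp {S : Set E2} (hS : IsOpen S) (u : L2 S) : MemLp (extend S u) 2 volume :=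
  (memLp_indicator_iff_restrict hS.measurableSet).2 (Lp.memLp u)

theorem extend_locallyIntegrable {S : Set E2} (hS : IsOpen S) (u : L2 S) :
    LocallyIntegrable (extend S u) volume :=
  (extend_memLp hS u).locallyIntegrable (by norm_num)

theorem setIntegral_extend {S : Set E2} (hS : IsOpen S) (u : L2 S) (ψ : E2 → ℝ) :
    ∫ x, ψ x • extend S u x = ∫ x in S, ψ x • u x := by
  rw [← integral_indicator hS.measurableSet]
  congr 1
  ext1 x
  by_cases hx : x ∈ S <;> simp [extend, hx]

theorem mollify_extend_apply {S : Set E2} (hS : IsOpen S) (k : ℕ) (u : L2 S) (x : E2) :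
    mollify k (extend S u) x = ∫ t in S, kernel k (x - t) • u t := by
  rw [← setIntegral_extend hS, mollify_apply,
    ← integral_sub_left_eq_self (fun t => kernel k (x - t) • extend S u t) volume x]
  simp only [sub_sub_cancel]

/-- At points of distance at least `1 / (k + 1)` to the complement of `S`, the derivatives of
the mollification are the mollifications of the weak derivatives. -/
theorem fderiv_mollify {S : Set E2} (hS : IsOpen S) {i : Fin 2} {u g : L2 S}
    (h : HasWeakPartial S i u g) (k : ℕ) {x : E2}
    (hx : Metric.closedBall x (1 / ((k : ℝ) + 1)) ⊆ S) :
    fderiv ℝ (mollify k (extend S u)) x (EuclideanSpace.single i 1) =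
      mollify k (extend S g) x := by
  have hd := (kernel_hasCompactSupport k).hasFDerivAt_convolution_left
    (ContinuousLinearMap.lsmul ℝ ℝ) ((kernel_contDiff k).of_le (by simp))
    (extend_locallyIntegrable hS u) x
  have hcd : ContDiff ℝ ∞ fun t => kernel k (x - t) :=
    (kernel_contDiff k).comp (contDiff_const.sub contDiff_id)
  have hsupp : ∀ t, t ∉ Metric.closedBall x (1 / ((k : ℝ) + 1)) → kernel k (x - t) = 0 := by
    intro t ht
    apply kernel_eq_zero
    rw [Metric.mem_closedBall, not_le, dist_comm, dist_eq_norm] at ht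
    exact ht.le
  have hts : tsupport (fun t => kernel k (x - t)) ⊆ Metric.closedBall x (1 / ((k : ℝ) + 1)) :=
    closure_minimal (fun t ht => by_contra fun h => ht (hsupp t h)) Metric.isClosed_closedBall
  have hcs : HasCompactSupport fun t => kernel k (x - t) :=
    HasCompactSupport.of_support_subset_isCompact (isCompact_closedBall x _)
      (subset_closure.trans hts)
  have hw := h.2.2 _ hcd hcs (hts.trans hx)
  rw [mollify_extend_apply hS, ← neg_neg (∫ t in S, kernel k (x - t) • g t), ← hw]
  change fderiv ℝ (convolution (kernel k) (extend S u) (ContinuousLinearMap.lsmul ℝ ℝ) volume) x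
    (EuclideanSpace.single i 1) = _
  have hi : Integrable fun t => ContinuousLinearMap.precompL E2
      (ContinuousLinearMap.lsmul ℝ ℝ) (fderiv ℝ (kernel k) t) (extend S u (x - t)) :=
    ((kernel_hasCompactSupport k).fderiv (𝕜 := ℝ)).convolutionExists_left _
      ((kernel_contDiff k).continuous_fderiv (by simp)) (extend_locallyIntegrable hS u) x
  rw [hd.fderiv, convolution_def, ContinuousLinearMap.integral_apply hi]
  simp only [ContinuousLinearMap.precompL_apply, ContinuousLinearMap.lsmul_apply]
  rw [← integral_neg, ← integral_indicator hS.measurableSet,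
    ← integral_sub_left_eq_self (fun t => fderiv ℝ (kernel k) t (EuclideanSpace.single i 1) •
      extend S u (x - t)) volume x]
  congr 1
  ext1 t
  have hdt : fderiv ℝ (fun t => kernel k (x - t)) t (EuclideanSpace.single i 1) =
      - fderiv ℝ (kernel k) (x - t) (EuclideanSpace.single i 1) := by
    have h1 : HasFDerivAt (kernel k) (fderiv ℝ (kernel k) (x - t)) (x - t) :=
      ((kernel_contDiff k).differentiable (by simp) _).hasFDerivAt
    have h2 : HasFDerivAt (fun t : E2 => x - t) (-(ContinuousLinearMap.id ℝ E2)) t :=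
      (hasFDerivAt_id t).const_sub x
    have h3 := h1.comp t h2
    rw [show (fun t => kernel k (x - t)) = kernel k ∘ fun t => x - t from rfl, h3.fderiv]
    simp
  by_cases ht : t ∈ S <;> simp [extend, ht, hdt]

/-! ### Products of Sobolev functions -/

theorem memLp_coord {S : Set E2} (u : L2 S) (a : Fin 3) :
    MemLp (fun x => u x a) 2 (volume.restrict S) := by
  refine (Lp.memLp u).mono
    ((EuclideanSpace.proj (𝕜 := ℝ) a).continuous.comp_aestronglyMeasurable
      (Lp.memLp u).aestronglyMeasurable) (Eventually.of_forall fun x => ?_)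
  exact PiLp.norm_apply_le (u x) a

theorem integrable_coord_mul {S : Set E2} (u v : L2 S) (a c : Fin 3) :
    Integrable (fun x => u x a * v x c) (volume.restrict S) :=
  (memLp_coord u a).integrable_mul (memLp_coord v c)

theorem tendsto_integral_coord_smul {S : Set E2} (w : L2 S) (a : Fin 3) {ψ : E2 → ℝ}
    (hψ : Continuous ψ) (hψc : HasCompactSupport ψ) {F : ℕ → E2 → E3} {f : E2 → E3}
    (hF : ∀ m, StronglyMeasurable (F m)) (hf : StronglyMeasurable f) (hf2 : MemLp f 2 volume)
    (h : Tendsto (fun m => ∫⁻ x, ‖F m x - f x‖ₑ ^ 2) atTop (𝓝 0)) :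
    Tendsto (fun m => ∫ x in S, (ψ x * F m x a) • w x) atTop
      (𝓝 (∫ x in S, (ψ x * f x a) • w x)) := by
  obtain ⟨C, hC⟩ := hψ.bounded_above_of_compact_support hψc
  have hC0 : 0 ≤ C := (norm_nonneg _).trans (hC 0)
  have hcm : ∀ g : E2 → E3, StronglyMeasurable g →
      AEStronglyMeasurable (fun x => ψ x * g x a) (volume.restrict S) := fun g hg =>
    (hψ.stronglyMeasurable.mul ((EuclideanSpace.proj (𝕜 := ℝ) a).continuous.comp_stronglyMeasurable
      hg)).aestronglyMeasurable
  have hbd : ∀ g : E2 → E3, eLpNorm (fun x => ψ x * g x a) 2 (volume.restrict S) ≤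
      ENNReal.ofReal C * eLpNorm g 2 volume := by
    intro g
    refine (eLpNorm_le_mul_eLpNorm_of_ae_le_mul (g := g) (Eventually.of_forall fun x => ?_) 2).trans
      (by gcongr; exact Measure.restrict_le_self)
    rw [norm_mul]
    exact mul_le_mul (hC x) (PiLp.norm_apply_le (g x) a) (norm_nonneg _) hC0
  have hw : eLpNorm w 2 (volume.restrict S) ≠ ⊤ := (Lp.memLp w).eLpNorm_ne_top
  have hL1 : ∀ g : E2 → E3, StronglyMeasurable g →
      eLpNorm (fun x => (ψ x * g x a) • w x) 1 (volume.restrict S) ≤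
      ENNReal.ofReal C * eLpNorm g 2 volume * eLpNorm w 2 (volume.restrict S) := by
    intro g hg
    have h1 := eLpNorm_smul_le_mul_eLpNorm (p := 2) (q := 2) (r := 1)
      (Lp.memLp w).aestronglyMeasurable (hcm g hg)
    exact h1.trans (mul_le_mul_left (hbd g) _)
  have hsq : Tendsto (fun m => eLpNorm (F m - f) 2 volume) atTop (𝓝 0) :=
    tendsto_zero_of_sq (by simpa only [eLpNorm_two_sq, Pi.sub_apply] using h)
  have hmem : ∀ g : E2 → E3, StronglyMeasurable g → eLpNorm g 2 volume ≠ ⊤ →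
      Integrable (fun x => (ψ x * g x a) • w x) (volume.restrict S) := by
    intro g hg hg2
    rw [← memLp_one_iff_integrable]
    exact ⟨(hcm g hg).smul (Lp.memLp w).aestronglyMeasurable,
      (hL1 g hg).trans_lt (ENNReal.mul_lt_top (ENNReal.mul_lt_top ENNReal.ofReal_lt_top
        hg2.lt_top) hw.lt_top)⟩
  have hfin : ∀ᶠ m in atTop, eLpNorm (F m - f) 2 volume < ⊤ :=
    hsq.eventually_lt_const ENNReal.zero_lt_top
  refine tendsto_integral_of_L1' _ (hmem f hf hf2.eLpNorm_ne_top).aestronglyMeasurable ?_ ?_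
  · filter_upwards [hfin] with m hm
    refine hmem _ (hF m) ?_
    have hd : MemLp (F m - f) 2 volume := ⟨((hF m).sub hf).aestronglyMeasurable, hm⟩
    have : F m = (F m - f) + f := by simp
    rw [this]
    exact (hd.add hf2).eLpNorm_ne_top
  · have hz : Tendsto (fun m => ENNReal.ofReal C * eLpNorm (F m - f) 2 volume *
        eLpNorm w 2 (volume.restrict S)) atTop (𝓝 0) := by
      have := ENNReal.Tendsto.mul_const (ENNReal.Tendsto.const_mul hsq
        (Or.inr (ENNReal.ofReal_ne_top (r := C)))) (Or.inr hw)
      simpa using this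
    refine tendsto_of_tendsto_of_tendsto_of_le_of_le tendsto_const_nhds hz
      (fun _ => zero_le) fun m => ?_
    refine le_trans (le_of_eq ?_) (hL1 _ ((hF m).sub hf))
    congr 1
    ext1 x
    simp [mul_sub, sub_smul]

/-- If the support of `φ` is contained in the open set `S`, then it has positive distance to the
complement of `S`. -/
theorem eventually_closedBall_subset {S K : Set E2} (hS : IsOpen S) (hK : IsCompact K)
    (hKS : K ⊆ S) :
    ∀ᶠ m : ℕ in atTop, ∀ x ∈ K, Metric.closedBall x (1 / ((m : ℝ) + 1)) ⊆ S := by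
  obtain ⟨δ, hδ, hsub⟩ := hK.exists_cthickening_subset_open hS hKS
  have : ∀ᶠ m : ℕ in atTop, 1 / ((m : ℝ) + 1) < δ :=
    tendsto_one_div_add_atTop_nhds_zero_nat.eventually_lt_const hδ
  filter_upwards [this] with m hm x hx
  exact ((Metric.closedBall_subset_closedBall hm.le).trans
    (Metric.closedBall_subset_cthickening hx δ)).trans hsub

/-- The product rule for weak derivatives: the products of `φ` with the components of the
mollifications of `u` are admissible test functions for `v`. -/
theorem HasWeakPartial.coord_smul {S : Set E2} (hS : IsOpen S) {i : Fin 2} {u g v k : L2 S}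
    (hu : HasWeakPartial S i u g) (hv : HasWeakPartial S i v k) (a : Fin 3)
    {φ : E2 → ℝ} (hφ : ContDiff ℝ ∞ φ) (hc : HasCompactSupport φ) (hs : tsupport φ ⊆ S) :
    ∫ x in S, (fderiv ℝ φ x (EuclideanSpace.single i 1) * u x a) • v x =
      - (∫ x in S, (φ x * g x a) • v x) - ∫ x in S, (φ x * u x a) • k x := by
  have hdφ : Continuous fun x => fderiv ℝ φ x (EuclideanSpace.single i 1) :=
    (hφ.continuous_fderiv (by simp)).clm_apply continuous_const
  have hext : ∀ (ψ : E2 → ℝ) (f w : L2 S), ∫ x in S, (ψ x * extend S f x a) • w x =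
      ∫ x in S, (ψ x * f x a) • w x := by
    intro ψ f w
    refine setIntegral_congr_fun hS.measurableSet fun x hx => ?_
    simp [extend, hx]
  have hlim : ∀ (ψ : E2 → ℝ), Continuous ψ → HasCompactSupport ψ → ∀ f w : L2 S,
      Tendsto (fun m => ∫ x in S, (ψ x * mollify m (extend S f) x a) • w x) atTop
      (𝓝 (∫ x in S, (ψ x * f x a) • w x)) := by
    intro ψ hψ hψc f w
    rw [← hext]
    exact tendsto_integral_coord_smul w a hψ hψc
      (fun m => (mollify_contDiff m
        (extend_locallyIntegrable hS f)).continuous.stronglyMeasurable)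
      (extend_stronglyMeasurable hS f) (extend_memLp hS f)
      (tendsto_lintegral_mollify (extend_stronglyMeasurable hS f) (extend_memLp hS f))
  have h1 := hlim _ hdφ (hc.fderiv_apply (𝕜 := ℝ) _) u v
  have h2 := hlim φ hφ.continuous hc g v
  have h3 := hlim φ hφ.continuous hc u k
  refine tendsto_nhds_unique h1 ((h2.neg.sub h3).congr' ?_)
  filter_upwards [eventually_closedBall_subset hS hc hs] with m hm
  have hU : ContDiff ℝ ∞ fun x => mollify m (extend S u) x a :=
    (EuclideanSpace.proj (𝕜 := ℝ) a).contDiff.comp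
      (mollify_contDiff m (extend_locallyIntegrable hS u))
  have hG : Continuous fun x => mollify m (extend S g) x a :=
    (EuclideanSpace.proj (𝕜 := ℝ) a).continuous.comp
      (mollify_contDiff m (extend_locallyIntegrable hS g)).continuous
  have ht := hv.2.2 (fun x => φ x * mollify m (extend S u) x a) (hφ.mul hU) (hc.mul_right)
    ((tsupport_mul_subset_left).trans hs)
  have hder : ∀ x, fderiv ℝ (fun x => φ x * mollify m (extend S u) x a) x
      (EuclideanSpace.single i 1) = φ x * mollify m (extend S g) x a +
      fderiv ℝ φ x (EuclideanSpace.single i 1) * mollify m (extend S u) x a := by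
    intro x
    rw [fderiv_fun_mul (hφ.differentiable (by simp) x) (hU.differentiable (by simp) x)]
    by_cases hx : x ∈ tsupport φ
    · have e : fderiv ℝ (fun x => mollify m (extend S u) x a) x (EuclideanSpace.single i 1) =
          mollify m (extend S g) x a := by
        rw [← fderiv_mollify hS hu m (hm x hx)]
        have h1 : HasFDerivAt (mollify m (extend S u)) _ x :=
          ((mollify_contDiff m (extend_locallyIntegrable hS u)).differentiable
            (by simp) x).hasFDerivAt
        have h2 := ((EuclideanSpace.proj (𝕜 := ℝ) a).hasFDerivAt).comp x h1
        rw [show (fun x => mollify m (extend S u) x a) =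
          (EuclideanSpace.proj (𝕜 := ℝ) a) ∘ mollify m (extend S u) from rfl, h2.fderiv]
        rfl
      simp [e, mul_comm]
    · simp [image_eq_zero_of_notMem_tsupport hx, mul_comm]
  simp only [hder, add_smul] at ht
  have hi1 : Integrable (fun x => (φ x * mollify m (extend S g) x a) • v x)
      (volume.restrict S) :=
    L2.integrable_smul v (hφ.continuous.mul hG) hc.mul_right
  have hi2 : Integrable (fun x => (fderiv ℝ φ x (EuclideanSpace.single i 1) *
      mollify m (extend S u) x a) • v x) (volume.restrict S) :=
    L2.integrable_smul v (hdφ.mul hU.continuous) (hc.fderiv_apply (𝕜 := ℝ) _).mul_right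
  rw [integral_add hi1 hi2] at ht
  rw [eq_comm, ← sub_eq_zero, ← sub_eq_zero.2 ht]
  abel

/-- The product rule in components: `∂ᵢ(uₐ v_c) = gₐ v_c + uₐ k_c` in the sense of
distributions. -/
theorem HasWeakPartial.coord_mul {S : Set E2} (hS : IsOpen S) {i : Fin 2} {u g v k : L2 S}
    (hu : HasWeakPartial S i u g) (hv : HasWeakPartial S i v k) (a c : Fin 3)
    {φ : E2 → ℝ} (hφ : ContDiff ℝ ∞ φ) (hc : HasCompactSupport φ) (hs : tsupport φ ⊆ S) :
    ∫ x in S, fderiv ℝ φ x (EuclideanSpace.single i 1) * (u x a * v x c) =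
      - ∫ x in S, φ x * (g x a * v x c + u x a * k x c) := by
  have hdφ : Continuous fun x => fderiv ℝ φ x (EuclideanSpace.single i 1) :=
    (hφ.continuous_fderiv (by simp)).clm_apply continuous_const
  have hint : ∀ (ψ : E2 → ℝ), Continuous ψ → HasCompactSupport ψ → ∀ f w : L2 S,
      Integrable (fun x => (ψ x * f x a) • w x) (volume.restrict S) := by
    intro ψ hψ hψc f w
    obtain ⟨C, hC⟩ := hψ.bounded_above_of_compact_support hψc
    have : Integrable (fun x => f x a • w x) (volume.restrict S) :=
      memLp_one_iff_integrable.1 ((Lp.memLp w).smul (memLp_coord f a) (p := 2) (q := 2))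
    refine (this.bdd_smul (φ := ψ) C hψ.aestronglyMeasurable
      (Eventually.of_forall hC)).congr (Eventually.of_forall fun x => ?_)
    simp [mul_smul]
  have hco : ∀ (ψ : E2 → ℝ), Continuous ψ → HasCompactSupport ψ → ∀ f w : L2 S,
      (∫ x in S, (ψ x * f x a) • w x) c = ∫ x in S, ψ x * (f x a * w x c) := by
    intro ψ hψ hψc f w
    have := (EuclideanSpace.proj c : E3 →L[ℝ] ℝ).integral_comp_comm
      (hint ψ hψ hψc f w)
    change _ = (∫ x in S, (ψ x * f x a) • w x) c at this
    rw [← this]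
    simp [mul_assoc]
  have hintc : ∀ f w : L2 S,
      Integrable (fun x => φ x * (f x a * w x c)) (volume.restrict S) := by
    intro f w
    refine ((EuclideanSpace.proj c : E3 →L[ℝ] ℝ).integrable_comp
      (hint φ hφ.continuous hc f w)).congr (Eventually.of_forall fun x => ?_)
    simp [mul_assoc]
  have := congrArg (fun z : E3 => z c) (hu.coord_smul hS hv a hφ hc hs)
  simp only [PiLp.sub_apply, PiLp.neg_apply] at this
  rw [hco _ hdφ (hc.fderiv_apply (𝕜 := ℝ) _), hco φ hφ.continuous hc, hco φ hφ.continuous hc]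
    at this
  rw [this]
  simp only [mul_add]
  rw [integral_add (hintc g v) (hintc u k)]
  ring

/-! ### The geometry of isometries of class `H²` -/

theorem inner_E3 (u v : E3) : inner ℝ u v = u 0 * v 0 + u 1 * v 1 + u 2 * v 2 := by
  simp [PiLp.inner_apply, Fin.sum_univ_three, mul_comm]

theorem integral_fderiv_eq_zero {φ : E2 → ℝ} (hφ : ContDiff ℝ ∞ φ) (hc : HasCompactSupport φ)
    (v : E2) : ∫ x, fderiv ℝ φ x v = 0 := by
  have hd : Continuous fun x => fderiv ℝ φ x v :=
    (hφ.continuous_fderiv (by simp)).clm_apply continuous_const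
  have := integral_mul_fderiv_eq_neg_fderiv_mul_of_integrable (μ := volume) (v := v)
    (f := fun _ : E2 => (1 : ℝ)) (g := φ) (by simp)
    (by simpa using hd.integrable_of_hasCompactSupport (hc.fderiv_apply (𝕜 := ℝ) _))
    (by simpa using hφ.continuous.integrable_of_hasCompactSupport hc)
    (by simp) (fun x _ => hφ.differentiable (by simp) x)
  simpa using this

theorem integrable_coord_mul_add {S : Set E2} (u v g k : L2 S) (a c : Fin 3) :
    Integrable (fun x => g x a * v x c + u x a * k x c) (volume.restrict S) :=
  (integrable_coord_mul g v a c).add (integrable_coord_mul u k a c)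

/-- Differentiating a constant inner product. -/
theorem HasWeakPartial.inner_eq_zero_of_const {S : Set E2} (hS : IsOpen S) {i : Fin 2}
    {u g v k : L2 S} (hu : HasWeakPartial S i u g) (hv : HasWeakPartial S i v k) {c : ℝ}
    (hcst : ∀ᵐ x ∂(volume.restrict S), inner ℝ (u x) (v x) = c) :
    ∀ᵐ x ∂(volume.restrict S), inner ℝ (g x) (v x) + inner ℝ (u x) (k x) = 0 := by
  set r : E2 → ℝ := fun x => inner ℝ (g x) (v x) + inner ℝ (u x) (k x) with hr
  have hri : Integrable r (volume.restrict S) := by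
    simp only [hr, inner_E3]
    exact (((integrable_coord_mul g v 0 0).add (integrable_coord_mul g v 1 1)).add
      (integrable_coord_mul g v 2 2)).add (((integrable_coord_mul u k 0 0).add
      (integrable_coord_mul u k 1 1)).add (integrable_coord_mul u k 2 2))
  have := hS.ae_eq_zero_of_integral_contDiff_smul_eq_zero
    (μ := volume) (f := r) (IntegrableOn.locallyIntegrableOn hri) (fun φ hφ hc hs => ?_)
  · rw [ae_restrict_iff' hS.measurableSet]
    exact this
  · obtain ⟨C, hC⟩ := hφ.continuous.bounded_above_of_compact_support hc
    have hdφ : Continuous fun x => fderiv ℝ φ x (EuclideanSpace.single i 1) :=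
      (hφ.continuous_fderiv (by simp)).clm_apply continuous_const
    obtain ⟨D, hD⟩ := hdφ.bounded_above_of_compact_support (hc.fderiv_apply (𝕜 := ℝ) _)
    have hm : ∀ {f : E2 → ℝ}, Integrable f (volume.restrict S) →
        Integrable (fun x => φ x * f x) (volume.restrict S) := fun hf =>
      hf.bdd_mul (c := C) hφ.continuous.aestronglyMeasurable (Eventually.of_forall hC)
    have hmd : ∀ {f : E2 → ℝ}, Integrable f (volume.restrict S) → Integrable (fun x =>
        fderiv ℝ φ x (EuclideanSpace.single i 1) * f x) (volume.restrict S) := fun hf =>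
      hf.bdd_mul (c := D) hdφ.aestronglyMeasurable (Eventually.of_forall hD)
    have e1 : ∫ x, φ x • r x = ∫ x in S, φ x * r x := by
      rw [setIntegral_eq_integral_of_forall_compl_eq_zero]
      · rfl
      · intro x hx
        rw [image_eq_zero_of_notMem_tsupport fun h => hx (hs h), zero_mul]
    have e2 : ∫ x in S, φ x * r x =
        ∑ a : Fin 3, ∫ x in S, φ x * (g x a * v x a + u x a * k x a) := by
      rw [← integral_finsetSum _ fun a _ =>
        hm (integrable_coord_mul_add u v g k a a)]
      refine integral_congr_ae (Eventually.of_forall fun x => ?_)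
      simp only [hr, inner_E3, Fin.sum_univ_three]
      ring
    have e3 : ∑ a : Fin 3, ∫ x in S, fderiv ℝ φ x (EuclideanSpace.single i 1) *
        (u x a * v x a) = 0 := by
      rw [← integral_finsetSum _ fun a _ => hmd (integrable_coord_mul u v a a)]
      have : ∫ x in S, ∑ a : Fin 3, fderiv ℝ φ x (EuclideanSpace.single i 1) * (u x a * v x a) =
          ∫ x in S, fderiv ℝ φ x (EuclideanSpace.single i 1) * c := by
        apply integral_congr_ae
        filter_upwards [hcst] with x hx
        rw [← hx, inner_E3, Fin.sum_univ_three]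
        ring
      rw [this, integral_mul_const, setIntegral_eq_integral_of_forall_compl_eq_zero,
        integral_fderiv_eq_zero hφ hc, zero_mul]
      intro x hx
      exact image_eq_zero_of_notMem_tsupport (f := fun x => fderiv ℝ φ x (EuclideanSpace.single i 1))
        fun h => hx (hs (tsupport_fderiv_apply_subset ℝ _ h))
    rw [e1, e2, ← neg_eq_zero, ← Finset.sum_neg_distrib, ← e3]
    exact Finset.sum_congr rfl fun a _ => (hu.coord_mul hS hv a a hφ hc hs).symm

/-- The cross product on `ℝ³`. -/
def cross (u v : E3) : E3 := WithLp.toLp 2 (crossProduct u.ofLp v.ofLp)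

theorem cross_0 (u v : E3) : cross u v 0 = u 1 * v 2 - u 2 * v 1 := by
  simp [cross, cross_apply]

theorem cross_1 (u v : E3) : cross u v 1 = u 2 * v 0 - u 0 * v 2 := by
  simp [cross, cross_apply]

theorem cross_2 (u v : E3) : cross u v 2 = u 0 * v 1 - u 1 * v 0 := by
  simp [cross, cross_apply]

theorem normal_eq {S : Set E2} (y : H2 S) (x : E2) :
    normal y x = cross (y.grad 0 x) (y.grad 1 x) := rfl

theorem integrable_of_coord {μ : Measure E2} {f : E2 → E3}
    (h : ∀ a, Integrable (fun x => f x a) μ) : Integrable f μ := by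
  have h2 : Integrable (fun x => (EuclideanSpace.equiv (Fin 3) ℝ) (f x)) μ :=
    Integrable.of_eval h
  refine ((EuclideanSpace.equiv (Fin 3) ℝ).symm.toContinuousLinearMap.integrable_comp h2).congr
    (Eventually.of_forall fun x => ?_)
  simp

theorem integrable_cross {S : Set E2} (u v : L2 S) :
    Integrable (fun x => cross (u x) (v x)) (volume.restrict S) := by
  refine integrable_of_coord fun a => ?_
  fin_cases a
  · simp only [Fin.zero_eta, cross_0]
    exact (integrable_coord_mul u v 1 2).sub (integrable_coord_mul u v 2 1)
  · simp only [Fin.mk_one, cross_1]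
    exact (integrable_coord_mul u v 2 0).sub (integrable_coord_mul u v 0 2)
  · simp only [Fin.reduceFinMk, cross_2]
    exact (integrable_coord_mul u v 0 1).sub (integrable_coord_mul u v 1 0)

/-- The product rule for the cross product of Sobolev functions; the product of two `L²` functions
is merely integrable. -/
theorem HasWeakPartial.cross {S : Set E2} (hS : IsOpen S) {i : Fin 2}
    {u g v k : L2 S} (hu : HasWeakPartial S i u g) (hv : HasWeakPartial S i v k) :
    HasWeakPartial S i (fun x => cross (u x) (v x))
      (fun x => LCEPlate.cross (g x) (v x) + LCEPlate.cross (u x) (k x)) := by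
  have hi1 := integrable_cross u v
  have hi2 := (integrable_cross g v).add (integrable_cross u k)
  refine ⟨IntegrableOn.locallyIntegrableOn hi1, IntegrableOn.locallyIntegrableOn hi2,
    fun φ hφ hc hs => ?_⟩
  obtain ⟨C, hC⟩ := hφ.continuous.bounded_above_of_compact_support hc
  have hdφ : Continuous fun x => fderiv ℝ φ x (EuclideanSpace.single i 1) :=
    (hφ.continuous_fderiv (by simp)).clm_apply continuous_const
  obtain ⟨D, hD⟩ := hdφ.bounded_above_of_compact_support (hc.fderiv_apply (𝕜 := ℝ) _)
  have hm : ∀ {f : E2 → ℝ}, Integrable f (volume.restrict S) →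
      Integrable (fun x => φ x * f x) (volume.restrict S) := fun hf =>
    hf.bdd_mul (c := C) hφ.continuous.aestronglyMeasurable (Eventually.of_forall hC)
  have hmd : ∀ {f : E2 → ℝ}, Integrable f (volume.restrict S) → Integrable (fun x =>
      fderiv ℝ φ x (EuclideanSpace.single i 1) * f x) (volume.restrict S) := fun hf =>
    hf.bdd_mul (c := D) hdφ.aestronglyMeasurable (Eventually.of_forall hD)
  have hI1 : Integrable (fun x => fderiv ℝ φ x (EuclideanSpace.single i 1) •
      LCEPlate.cross (u x) (v x)) (volume.restrict S) :=
    hi1.bdd_smul D hdφ.aestronglyMeasurable (Eventually.of_forall hD)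
  have hI2 : Integrable (fun x => φ x • (LCEPlate.cross (g x) (v x) + LCEPlate.cross (u x) (k x)))
      (volume.restrict S) :=
    hi2.bdd_smul C hφ.continuous.aestronglyMeasurable (Eventually.of_forall hC)
  have hcoord : ∀ (f : E2 → E3), Integrable f (volume.restrict S) → ∀ a,
      (∫ x in S, f x) a = ∫ x in S, f x a := fun f hf a =>
    ((EuclideanSpace.proj a : E3 →L[ℝ] ℝ).integral_comp_comm hf).symm
  have key : ∀ a b : Fin 3,
      ∫ x in S, fderiv ℝ φ x (EuclideanSpace.single i 1) * (u x a * v x b - u x b * v x a) =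
      - ∫ x in S, φ x * ((g x a * v x b - g x b * v x a) + (u x a * k x b - u x b * k x a)) := by
    intro a b
    have h1 := hu.coord_mul hS hv a b hφ hc hs
    have h2 := hu.coord_mul hS hv b a hφ hc hs
    have e1 : ∫ x in S, fderiv ℝ φ x (EuclideanSpace.single i 1) *
        (u x a * v x b - u x b * v x a) =
        (∫ x in S, fderiv ℝ φ x (EuclideanSpace.single i 1) * (u x a * v x b)) -
        ∫ x in S, fderiv ℝ φ x (EuclideanSpace.single i 1) * (u x b * v x a) := by
      rw [← integral_sub (hmd (integrable_coord_mul u v a b)) (hmd (integrable_coord_mul u v b a))]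
      simp only [mul_sub]
    have e2 : ∫ x in S, φ x *
        ((g x a * v x b - g x b * v x a) + (u x a * k x b - u x b * k x a)) =
        (∫ x in S, φ x * (g x a * v x b + u x a * k x b)) -
        ∫ x in S, φ x * (g x b * v x a + u x b * k x a) := by
      rw [← integral_sub (hm (integrable_coord_mul_add u v g k a b))
        (hm (integrable_coord_mul_add u v g k b a))]
      congr 1
      ext1 x
      ring
    rw [e1, e2, h1, h2]
    ring
  ext a
  rw [PiLp.neg_apply, hcoord _ hI1, hcoord _ hI2]
  simp only [PiLp.smul_apply, PiLp.add_apply, smul_eq_mul]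
  fin_cases a
  · simpa only [Fin.zero_eta, cross_0] using key 1 2
  · simpa only [Fin.mk_one, cross_1] using key 2 0
  · simpa only [Fin.reduceFinMk, cross_2] using key 0 1

/-- In an orthonormal frame `p, q, p ∧ q`, a vector orthogonal to `p` and `q` is a multiple of
`p ∧ q`. -/
theorem norm_sq_eq_inner_cross_sq {h p q : E3} (hp : inner ℝ p p = (1 : ℝ))
    (hq : inner ℝ q q = (1 : ℝ)) (hpq : inner ℝ p q = (0 : ℝ)) (h1 : inner ℝ h p = (0 : ℝ))
    (h2 : inner ℝ h q = (0 : ℝ)) : ‖h‖ ^ 2 = inner ℝ h (cross p q) ^ 2 := by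
  have hg : (inner ℝ h (cross p q) : ℝ) ^ 2 =
      inner ℝ h h * (inner ℝ p p * inner ℝ q q - inner ℝ p q ^ 2) -
      inner ℝ h p ^ 2 * inner ℝ q q + 2 * inner ℝ h p * inner ℝ h q * inner ℝ p q -
      inner ℝ h q ^ 2 * inner ℝ p p := by
    simp only [inner_E3, cross_0, cross_1, cross_2]
    ring
  rw [hg, hp, hq, hpq, h1, h2, real_inner_self_eq_norm_sq]
  ring

theorem norm_cross_of_orthonormal {p q : E3} (hp : inner ℝ p p = (1 : ℝ))
    (hq : inner ℝ q q = (1 : ℝ)) (hpq : inner ℝ p q = (0 : ℝ)) : ‖cross p q‖ = 1 := by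
  have hg : (inner ℝ (cross p q) (cross p q) : ℝ) =
      inner ℝ p p * inner ℝ q q - inner ℝ p q ^ 2 := by
    simp only [inner_E3, cross_0, cross_1, cross_2]
    ring
  rw [hp, hq, hpq, real_inner_self_eq_norm_sq] at hg
  have : ‖cross p q‖ ^ 2 = 1 := by rw [hg]; norm_num
  exact (pow_eq_one_iff_of_nonneg (norm_nonneg _) two_ne_zero).1 this

theorem H2.norm_grad {S : Set E2} {q : H2 S × H1 S} (hq : q ∈ A2 S) (i : Fin 2) :
    ∀ᵐ x ∂(volume.restrict S), ‖q.1.grad i x‖ = 1 := by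
  filter_upwards [hq.1 i i] with x hx
  rw [real_inner_self_eq_norm_sq, if_pos rfl] at hx
  exact (pow_eq_one_iff_of_nonneg (norm_nonneg _) two_ne_zero).1 hx

theorem norm_normal {S : Set E2} {q : H2 S × H1 S} (hq : q ∈ A2 S) :
    ∀ᵐ x ∂(volume.restrict S), ‖normal q.1 x‖ = 1 := by
  filter_upwards [hq.1 0 0, hq.1 1 1, hq.1 0 1] with x h0 h1 h2
  exact norm_cross_of_orthonormal (by simpa using h0) (by simpa using h1) (by simpa using h2)

/-- The second derivatives of an isometry are normal to the surface: the coefficients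
`∂ⱼ∂ᵢy · ∂ₖy` are symmetric in `i, j` and antisymmetric in `i, k`. -/
theorem inner_hess_grad {S : Set E2} (hS : IsOpen S) {q : H2 S × H1 S} (hq : q ∈ A2 S) :
    ∀ᵐ x ∂(volume.restrict S), ∀ i j k : Fin 2,
      inner ℝ (q.1.hess i j x) (q.1.grad k x) = (0 : ℝ) := by
  have h : ∀ i j k : Fin 2, ∀ᵐ x ∂(volume.restrict S),
      inner ℝ (q.1.hess i j x) (q.1.grad k x) + inner ℝ (q.1.grad i x) (q.1.hess k j x) =
        (0 : ℝ) := fun i j k =>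
    (q.1.hasWeakPartial_grad i j).inner_eq_zero_of_const hS (q.1.hasWeakPartial_grad k j)
      (hq.1 i k)
  simp only [← ae_all_iff] at h
  filter_upwards [h] with x hx
  have anti : ∀ i j k : Fin 2, inner ℝ (q.1.hess i j x) (q.1.grad k x) =
      - inner ℝ (q.1.hess k j x) (q.1.grad i x) := by
    intro i j k
    have := hx i j k
    rw [real_inner_comm (q.1.hess k j x)] at this
    linarith
  intro i j k
  have s : ∀ i j k : Fin 2, inner ℝ (q.1.hess i j x) (q.1.grad k x) =
      inner ℝ (q.1.hess j i x) (q.1.grad k x) := by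
    intro i j k
    rw [q.1.hess_symm hS i j]
  linarith [anti i j k, s k j i, anti j k i, s i k j, anti k i j, s j i k]

/-- The second fundamental form of an isometry in terms of its second derivatives. -/
theorem II_ae {S : Set E2} (hS : IsOpen S) {q : H2 S × H1 S} (hq : q ∈ A2 S) :
    ∀ᵐ x ∂(volume.restrict S), ∀ i j : Fin 2,
      II q.1 x i j = - inner ℝ (q.1.hess i j x) (normal q.1 x) ∧
      ‖q.1.hess i j x‖ ^ 2 = II q.1 x i j ^ 2 ∧ II q.1 x i j = II q.1 x j i := by
  have hw : ∀ j, weakPartial S j (normal q.1) =ᵐ[volume.restrict S] _ := fun j =>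
    weakPartial_ae_eq hS ((q.1.hasWeakPartial_grad 0 j).cross hS (q.1.hasWeakPartial_grad 1 j))
  filter_upwards [inner_hess_grad hS hq, hw 0, hw 1, hq.1 0 0, hq.1 1 1, hq.1 0 1]
    with x hx hw0 hw1 h00 h11 h01
  have hwj : ∀ j, weakPartial S j (normal q.1) x =
      cross (q.1.hess 0 j x) (q.1.grad 1 x) + cross (q.1.grad 0 x) (q.1.hess 1 j x) := by
    intro j
    fin_cases j
    · exact hw0
    · exact hw1
  have hII : ∀ i j, II q.1 x i j = - inner ℝ (q.1.hess i j x) (normal q.1 x) := by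
    intro i j
    simp only [II, Matrix.of_apply]
    rw [hwj, normal_eq]
    fin_cases i <;>
    · simp only [inner_E3, cross_0, cross_1, cross_2, PiLp.add_apply, Fin.zero_eta, Fin.mk_one]
      ring
  intro i j
  refine ⟨hII i j, ?_, ?_⟩
  · rw [hII, neg_sq, normal_eq]
    exact norm_sq_eq_inner_cross_sq (by simpa using h00) (by simpa using h11)
      (by simpa using h01) (hx i j 0) (hx i j 1)
  · rw [hII, hII, q.1.hess_symm hS i j]

/-! ### Compactness in `L²` -/

/-- Jensen's inequality for the square. -/
theorem enorm_integral_sq_le {X : Type*} [MeasurableSpace X] {ν : Measure X}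
    [IsProbabilityMeasure ν] {f : X → E3} (hf : AEStronglyMeasurable f ν) :
    ‖∫ t, f t ∂ν‖ₑ ^ 2 ≤ ∫⁻ t, ‖f t‖ₑ ^ 2 ∂ν := by
  rw [← eLpNorm_two_sq]
  have h1 : ‖∫ t, f t ∂ν‖ₑ ≤ eLpNorm f 1 ν := by
    rw [eLpNorm_one_eq_lintegral_enorm]
    exact enorm_integral_le_lintegral_enorm _
  have h2 : eLpNorm f 1 ν ≤ eLpNorm f 2 ν :=
    eLpNorm_le_eLpNorm_of_exponent_le (by norm_num) hf
  exact pow_le_pow_left₀ zero_le (h1.trans h2) 2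

/-- The derivative of `u` in direction `t`, extended by zero. -/
def dirDeriv {S : Set E2} (g : Fin 2 → L2 S) (t : E2) : E2 → E3 :=
  fun x => ∑ i, t i • extend S (g i) x

theorem dirDeriv_stronglyMeasurable {S : Set E2} (hS : IsOpen S) (g : Fin 2 → L2 S) (t : E2) :
    StronglyMeasurable (dirDeriv g t) :=
  Finset.stronglyMeasurable_fun_sum _ fun i _ => (extend_stronglyMeasurable hS (g i)).const_smul (t i)

theorem mollify_dirDeriv {S : Set E2} (hS : IsOpen S) (g : Fin 2 → L2 S) (t : E2) (m : ℕ)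
    (x : E2) : mollify m (dirDeriv g t) x = ∑ i, t i • mollify m (extend S (g i)) x := by
  simp only [mollify_apply, dirDeriv, Finset.smul_sum]
  rw [integral_finsetSum]
  · refine Finset.sum_congr rfl fun i _ => ?_
    rw [← integral_smul]
    simp only [smul_comm (t i)]
  · intro i _
    have := (integrable_kernel_smul m (extend_locallyIntegrable hS (g i)) x).smul (t i)
    refine this.congr (Eventually.of_forall fun s => ?_)
    simp only [Pi.smul_apply, smul_comm (t i)]

theorem fderiv_mollify_apply {S : Set E2} (hS : IsOpen S) {u : L2 S} {g : Fin 2 → L2 S}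
    (h : ∀ i, HasWeakPartial S i u (g i)) (m : ℕ) {x : E2}
    (hx : Metric.closedBall x (1 / ((m : ℝ) + 1)) ⊆ S) (t : E2) :
    fderiv ℝ (mollify m (extend S u)) x t = mollify m (dirDeriv g t) x := by
  have ht : t = ∑ i, t i • (EuclideanSpace.single i (1 : ℝ) : E2) := by
    ext j
    fin_cases j <;> simp [Fin.sum_univ_two]
  conv_lhs => rw [ht]
  rw [map_sum, mollify_dirDeriv hS]
  refine Finset.sum_congr rfl fun i _ => ?_
  rw [map_smul, fderiv_mollify hS (h i) m hx]

/-- Translation estimate for Sobolev functions, obtained from the fundamental theorem of calculus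
for mollifications and Fatou's lemma. -/
theorem lintegral_translate_le {S K : Set E2} (hS : IsOpen S) {u : L2 S} {g : Fin 2 → L2 S}
    (h : ∀ i, HasWeakPartial S i u (g i)) {r : ℝ} (hK : ∀ x ∈ K, Metric.closedBall x r ⊆ S)
    (hKm : MeasurableSet K) {t : E2} (ht : ‖t‖ < r) :
    ∫⁻ x in K, ‖extend S u (x - t) - extend S u x‖ₑ ^ 2 ≤ ∫⁻ x, ‖dirDeriv g t x‖ₑ ^ 2 := by
  set f := extend S u with hf
  have hfl : LocallyIntegrable f := extend_locallyIntegrable hS u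
  have hG := dirDeriv_stronglyMeasurable hS g t
  have hGl : LocallyIntegrable (dirDeriv g t) :=
    locallyIntegrable_finsetSum _ fun i _ =>
      (extend_locallyIntegrable hS (g i)).smul (t i)
  have hGc : ∀ m, Continuous (mollify m (dirDeriv g t)) := fun m =>
    (mollify_contDiff m hGl).continuous
  have hvc : ∀ m, ContDiff ℝ ∞ (mollify m f) := fun m => mollify_contDiff m hfl
  have hlarge : ∀ᶠ m : ℕ in atTop,
      ∫⁻ x in K, ‖mollify m f (x - t) - mollify m f x‖ₑ ^ 2 ≤ ∫⁻ x, ‖dirDeriv g t x‖ₑ ^ 2 := by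
    have hm : ∀ᶠ m : ℕ in atTop, 1 / ((m : ℝ) + 1) < r - ‖t‖ :=
      tendsto_one_div_add_atTop_nhds_zero_nat.eventually_lt_const (sub_pos.2 ht)
    filter_upwards [hm] with m hm
    have hptw : ∀ x ∈ K, ‖mollify m f (x - t) - mollify m f x‖ₑ ^ 2 ≤
        ∫⁻ s in Ioc (0 : ℝ) 1, ‖mollify m (dirDeriv g t) (x - s • t)‖ₑ ^ 2 := by
      intro x hx
      have hline : ∀ s ∈ uIcc (0 : ℝ) 1, HasDerivAt (fun s : ℝ => mollify m f (x - s • t))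
          (- mollify m (dirDeriv g t) (x - s • t)) s := by
        intro s hs
        rw [uIcc_of_le zero_le_one] at hs
        have hball : Metric.closedBall (x - s • t) (1 / ((m : ℝ) + 1)) ⊆ S := by
          refine (Metric.closedBall_subset_closedBall' ?_).trans (hK x hx)
          have h1 : ‖s • t‖ ≤ ‖t‖ := by
            rw [norm_smul, Real.norm_of_nonneg hs.1]
            exact mul_le_of_le_one_left (norm_nonneg _) hs.2
          have h2 : dist (x - s • t) x = ‖s • t‖ := by
            rw [dist_eq_norm]
            simp
          rw [h2]
          linarith
        rw [← fderiv_mollify_apply hS h m hball t]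
        have h1 : HasFDerivAt (mollify m f) (fderiv ℝ (mollify m f) (x - s • t)) (x - s • t) :=
          ((hvc m).differentiable (by simp) _).hasFDerivAt
        have h2 : HasDerivAt (fun s : ℝ => x - s • t) (-t) s := by
          simpa using ((hasDerivAt_id s).smul_const t).const_sub x
        have h3 := h1.comp_hasDerivAt s h2
        rw [map_neg] at h3
        exact h3
      have hcont : Continuous fun s : ℝ => - mollify m (dirDeriv g t) (x - s • t) := by
        have := hGc m
        fun_prop
      have hftc := intervalIntegral.integral_eq_sub_of_hasDerivAt hline
        (hcont.intervalIntegrable 0 1)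
      simp only [one_smul, zero_smul, sub_zero] at hftc
      rw [← hftc, intervalIntegral.integral_of_le zero_le_one]
      have : IsProbabilityMeasure (volume.restrict (Ioc (0 : ℝ) 1)) := ⟨by simp⟩
      refine (enorm_integral_sq_le hcont.aestronglyMeasurable).trans (le_of_eq ?_)
      simp only [enorm_neg]
    have hmeas : Measurable fun p : E2 × ℝ => ‖mollify m (dirDeriv g t) (p.1 - p.2 • t)‖ₑ ^ 2 := by
      refine Measurable.pow_const (Measurable.enorm ?_) 2
      exact ((hGc m).comp (by fun_prop)).measurable
    calc ∫⁻ x in K, ‖mollify m f (x - t) - mollify m f x‖ₑ ^ 2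
        ≤ ∫⁻ x in K, ∫⁻ s in Ioc (0 : ℝ) 1, ‖mollify m (dirDeriv g t) (x - s • t)‖ₑ ^ 2 :=
          setLIntegral_mono' hKm hptw
      _ ≤ ∫⁻ x, ∫⁻ s in Ioc (0 : ℝ) 1, ‖mollify m (dirDeriv g t) (x - s • t)‖ₑ ^ 2 :=
          setLIntegral_le_lintegral _ _
      _ = ∫⁻ s in Ioc (0 : ℝ) 1, ∫⁻ x, ‖mollify m (dirDeriv g t) (x - s • t)‖ₑ ^ 2 :=
          lintegral_lintegral_swap hmeas.aemeasurable
      _ = ∫⁻ s in Ioc (0 : ℝ) 1, ∫⁻ x, ‖mollify m (dirDeriv g t) x‖ₑ ^ 2 := by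
          refine lintegral_congr fun s => ?_
          exact lintegral_sub_right_eq_self (fun x => ‖mollify m (dirDeriv g t) x‖ₑ ^ 2) (s • t)
      _ = ∫⁻ x, ‖mollify m (dirDeriv g t) x‖ₑ ^ 2 := by simp
      _ ≤ _ := lintegral_mollify_sq_le m hG
  have hconv : ∀ᵐ x, Tendsto (fun m => ‖mollify m f (x - t) - mollify m f x‖ₑ ^ 2) atTop
      (𝓝 (‖f (x - t) - f x‖ₑ ^ 2)) := by
    have h1 := ae_tendsto_mollify hfl
    have h2 := (measurePreserving_sub_right volume t).quasiMeasurePreserving.ae h1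
    filter_upwards [h1, h2] with x h1 h2
    exact ((ENNReal.continuous_pow 2).tendsto _).comp
      ((continuous_enorm.tendsto _).comp (h2.sub h1))
  have hmeas : ∀ m, Measurable fun x => ‖mollify m f (x - t) - mollify m f x‖ₑ ^ 2 := by
    intro m
    have := (hvc m).continuous
    refine Measurable.pow_const (Measurable.enorm ?_) 2
    exact Continuous.measurable (by fun_prop)
  calc ∫⁻ x in K, ‖f (x - t) - f x‖ₑ ^ 2
      = ∫⁻ x in K, liminf (fun m => ‖mollify m f (x - t) - mollify m f x‖ₑ ^ 2) atTop := by
        refine lintegral_congr_ae ?_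
        filter_upwards [ae_restrict_of_ae hconv] with x hx
        exact hx.liminf_eq.symm
    _ ≤ liminf (fun m => ∫⁻ x in K, ‖mollify m f (x - t) - mollify m f x‖ₑ ^ 2) atTop :=
        lintegral_liminf_le hmeas
    _ ≤ _ := liminf_le_of_frequently_le' hlarge.frequently

theorem enorm_sq_eq_lintegral {S : Set E2} (u : L2 S) : ‖u‖ₑ ^ 2 = ∫⁻ x in S, ‖u x‖ₑ ^ 2 := by
  rw [← eLpNorm_two_sq, Lp.enorm_def]

theorem enorm_add_sq_le {F : Type*} [NormedAddCommGroup F] (a b : F) :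
    ‖a + b‖ₑ ^ 2 ≤ 2 * (‖a‖ₑ ^ 2 + ‖b‖ₑ ^ 2) := by
  simp only [enorm_eq_nnnorm]
  norm_cast
  calc ‖a + b‖₊ ^ 2 ≤ (‖a‖₊ + ‖b‖₊) ^ 2 := by gcongr; exact nnnorm_add_le a b
    _ ≤ 2 ^ (2 - 1) * (‖a‖₊ ^ 2 + ‖b‖₊ ^ 2) := add_pow_le zero_le zero_le 2
    _ = _ := by norm_num

theorem extend_lintegral {S : Set E2} (hS : IsOpen S) (u : L2 S) :
    ∫⁻ x, ‖extend S u x‖ₑ ^ 2 = ‖u‖ₑ ^ 2 := by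
  rw [enorm_sq_eq_lintegral, ← lintegral_indicator hS.measurableSet]
  congr 1
  ext1 x
  by_cases hx : x ∈ S <;> simp [extend, hx]

theorem lintegral_dirDeriv_le {S : Set E2} (hS : IsOpen S) (g : Fin 2 → L2 S) (t : E2) :
    ∫⁻ x, ‖dirDeriv g t x‖ₑ ^ 2 ≤ 2 * ‖t‖ₑ ^ 2 * ∑ i, ‖g i‖ₑ ^ 2 := by
  have hti : ∀ i, ‖t i‖ₑ ≤ ‖t‖ₑ := by
    intro i
    rw [enorm_le_iff_norm_le]
    exact PiLp.norm_apply_le t i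
  calc ∫⁻ x, ‖dirDeriv g t x‖ₑ ^ 2
      ≤ ∫⁻ x, 2 * ‖t‖ₑ ^ 2 * (‖extend S (g 0) x‖ₑ ^ 2 + ‖extend S (g 1) x‖ₑ ^ 2) := by
        refine lintegral_mono fun x => ?_
        simp only [dirDeriv, Fin.sum_univ_two]
        refine (enorm_add_sq_le _ _).trans ?_
        rw [enorm_smul, enorm_smul, mul_pow, mul_pow, mul_assoc, mul_add (‖t‖ₑ ^ 2)]
        gcongr <;> exact hti _
    _ = _ := by
        have hm : ∀ i, Measurable fun x => ‖extend S (g i) x‖ₑ ^ 2 := fun i =>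
          (extend_stronglyMeasurable hS (g i)).enorm.pow_const 2
        rw [lintegral_const_mul _ (by exact (hm 0).add (hm 1)), lintegral_add_left (hm 0),
          extend_lintegral hS, extend_lintegral hS, Fin.sum_univ_two]

theorem kernel_bounded (m : ℕ) : ∃ C : ℝ, ∀ t, kernel m t ≤ C := by
  obtain ⟨C, hC⟩ := (kernel_continuous m).bounded_above_of_compact_support
    (kernel_hasCompactSupport m)
  exact ⟨C, fun t => (le_abs_self _).trans (hC t)⟩

/-- Mollifications of weak null sequences converge to zero in `L²_loc`: they converge pointwise,
being integrals against a fixed kernel, and are uniformly bounded. -/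
theorem tendsto_lintegral_mollify_of_weak {S : Set E2} (hS : IsOpen S) {w : ℕ → L2 S} {M : ℝ≥0}
    (hM : ∀ k, ‖w k‖ₑ ≤ M)
    (hweak : ∀ a : L2 S, Tendsto (fun k => inner ℝ a (w k)) atTop (𝓝 0)) (m : ℕ)
    {K : Set E2} (hK : IsCompact K) :
    Tendsto (fun k => ∫⁻ x in K, ‖mollify m (extend S (w k)) x‖ₑ ^ 2) atTop (𝓝 0) := by
  obtain ⟨C, hC⟩ := kernel_bounded m
  have hptw : ∀ x, Tendsto (fun k => ‖mollify m (extend S (w k)) x‖ₑ ^ 2) atTop (𝓝 0) := by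
    intro x
    have hc : Continuous fun t => kernel m (x - t) := (kernel_continuous m).comp (by fun_prop)
    have hcs : HasCompactSupport fun t => kernel m (x - t) :=
      (kernel_hasCompactSupport m).comp_homeomorph (Homeomorph.subLeft x)
    have h1 : Tendsto (fun k => mollify m (extend S (w k)) x) atTop (𝓝 0) := by
      have h2 : ∀ a : Fin 3, Tendsto (fun k => mollify m (extend S (w k)) x a) atTop (𝓝 0) := by
        intro a
        refine (hweak (testL2 S _ hc hcs (EuclideanSpace.single a 1))).congr fun k => ?_
        rw [inner_testL2, mollify_extend_apply hS, EuclideanSpace.inner_single_left]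
        simp
      have h3 : Tendsto (fun k => (mollify m (extend S (w k)) x).ofLp) atTop (𝓝 (0 : E3).ofLp) :=
        tendsto_pi_nhds.2 fun a => by simpa using h2 a
      exact ((PiLp.continuous_toLp 2 _).tendsto _).comp h3
    have h4 := ((ENNReal.continuous_pow 2).tendsto _).comp ((continuous_enorm.tendsto _).comp h1)
    simpa [Function.comp_def] using h4
  have hdom : ∀ k x, ‖mollify m (extend S (w k)) x‖ₑ ^ 2 ≤ ENNReal.ofReal C * (M : ℝ≥0∞) ^ 2 := by
    intro k x
    have hsm := extend_stronglyMeasurable hS (w k)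
    rw [mollify_apply]
    refine (enorm_integral_kernel_sq_le m
      (hsm.comp_measurable (measurable_const.sub measurable_id))).trans ?_
    calc ∫⁻ t, ENNReal.ofReal (kernel m t) * ‖extend S (w k) (x - t)‖ₑ ^ 2
        ≤ ∫⁻ t, ENNReal.ofReal C * ‖extend S (w k) (x - t)‖ₑ ^ 2 := by
          refine lintegral_mono fun t => ?_
          gcongr
          exact hC t
      _ = ENNReal.ofReal C * ∫⁻ t, ‖extend S (w k) t‖ₑ ^ 2 := by
          rw [lintegral_const_mul' _ _ ENNReal.ofReal_ne_top,
            lintegral_sub_left_eq_self (fun t => ‖extend S (w k) t‖ₑ ^ 2) x]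
      _ ≤ _ := by
          rw [extend_lintegral hS]
          gcongr
          exact hM k
  have := tendsto_lintegral_of_dominated_convergence (μ := volume.restrict K)
    (F := fun k x => ‖mollify m (extend S (w k)) x‖ₑ ^ 2) (f := fun _ => 0)
    (fun _ => ENNReal.ofReal C * (M : ℝ≥0∞) ^ 2)
    (fun k => ((mollify_contDiff m
      (extend_locallyIntegrable hS (w k))).continuous.measurable.enorm.pow_const 2))
    (fun k => Eventually.of_forall (hdom k)) (by
      rw [lintegral_const, Measure.restrict_apply_univ]
      exact ENNReal.mul_ne_top (ENNReal.mul_ne_top ENNReal.ofReal_ne_top (by simp))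
        hK.measure_lt_top.ne) (Eventually.of_forall hptw)
  simpa using this

/-- A local Rellich theorem: a bounded sequence in `H¹(S)` which converges to zero weakly in `L²`
and whose squares are dominated by an integrable function converges to zero strongly. No
regularity of the boundary of `S` is needed because of the domination. -/
theorem tendsto_lintegral_of_weak {S : Set E2} (hS : IsOpen S) {w : ℕ → L2 S}
    {g : ℕ → Fin 2 → L2 S} (h : ∀ k i, HasWeakPartial S i (w k) (g k i)) {M : ℝ≥0}
    (hM : ∀ k, ‖w k‖ₑ ≤ M) (hMg : ∀ k i, ‖g k i‖ₑ ≤ M)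
    (hweak : ∀ a : L2 S, Tendsto (fun k => inner ℝ a (w k)) atTop (𝓝 0))
    {d : E2 → ℝ≥0∞} (hd : ∫⁻ x in S, d x ≠ ⊤)
    (hdom : ∀ k, ∀ᵐ x ∂(volume.restrict S), ‖w k x‖ₑ ^ 2 ≤ d x) :
    Tendsto (fun k => ∫⁻ x in S, ‖w k x‖ₑ ^ 2) atTop (𝓝 0) := by
  rw [ENNReal.tendsto_nhds_zero]
  intro ε hε
  -- a compact subset carrying all but a small part of the squared norms
  obtain ⟨ε', hε', hε3⟩ : ∃ ε' : ℝ≥0∞, 0 < ε' ∧ ε' + (2 * ε' + 2 * ε') ≤ ε := by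
    refine ⟨ε / 5, ENNReal.div_pos hε.ne' (by norm_num), le_of_eq ?_⟩
    rw [← add_mul, ← one_add_mul, show (1 + (2 + 2) : ℝ≥0∞) = 5 by norm_num]
    exact ENNReal.mul_div_cancel (by norm_num) (by norm_num)
  set ν : Measure E2 := (volume.restrict S).withDensity d with hν
  have hνf : IsFiniteMeasure ν := isFiniteMeasure_withDensity hd
  obtain ⟨K, hKS, hKc, hKν⟩ := hS.measurableSet.exists_isCompact_sdiff_lt (μ := ν)
    (measure_ne_top _ _) hε'.ne'
  have hKm : MeasurableSet K := hKc.measurableSet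
  have hout : ∀ k, ∫⁻ x in S \ K, ‖w k x‖ₑ ^ 2 ≤ ε' := by
    intro k
    refine le_trans ?_ hKν.le
    rw [hν, withDensity_apply _ (hS.measurableSet.diff hKm),
      Measure.restrict_restrict (hS.measurableSet.diff hKm),
      inter_eq_self_of_subset_left sdiff_subset]
    exact lintegral_mono_ae (ae_restrict_of_ae_restrict_of_subset sdiff_subset (hdom k))
  -- mollification with a fixed small radius
  obtain ⟨r, hr, hKr⟩ := hKc.exists_cthickening_subset_open hS hKS
  have hball : ∀ x ∈ K, Metric.closedBall x r ⊆ S := fun x hx =>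
    (Metric.closedBall_subset_cthickening hx r).trans hKr
  have hsmall : Tendsto (fun m : ℕ => 2 * ENNReal.ofReal (1 / ((m : ℝ) + 1)) ^ 2 *
      (2 * (M : ℝ≥0∞) ^ 2)) atTop (𝓝 0) := by
    have h1 := ENNReal.tendsto_ofReal tendsto_one_div_add_atTop_nhds_zero_nat
    have h2 := ((ENNReal.continuous_pow 2).tendsto _).comp h1
    have h3 := ENNReal.Tendsto.mul_const (ENNReal.Tendsto.const_mul h2
      (Or.inr (by norm_num : (2 : ℝ≥0∞) ≠ ⊤)))
      (Or.inr (by finiteness : 2 * (M : ℝ≥0∞) ^ 2 ≠ ⊤))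
    simpa using h3
  obtain ⟨m, hm1, hm2⟩ := ((ENNReal.tendsto_nhds_zero.1 hsmall ε' hε').and
    (tendsto_one_div_add_atTop_nhds_zero_nat.eventually_lt_const hr)).exists
  have hmoll : ∀ k, ∫⁻ x in K, ‖mollify m (extend S (w k)) x - extend S (w k) x‖ₑ ^ 2 ≤ ε' := by
    intro k
    refine (lintegral_mollify_sub_le m (extend_stronglyMeasurable hS (w k))
      (extend_locallyIntegrable hS (w k)) K _ fun t ht => ?_).trans hm1
    refine (lintegral_translate_le hS (h k) hball hKm (ht.trans hm2)).trans ?_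
    refine (lintegral_dirDeriv_le hS (g k) t).trans ?_
    have h1 : ‖t‖ₑ ≤ ENNReal.ofReal (1 / ((m : ℝ) + 1)) := by
      rw [← ofReal_norm]
      exact ENNReal.ofReal_le_ofReal ht.le
    rw [Fin.sum_univ_two, two_mul ((M : ℝ≥0∞) ^ 2)]
    gcongr <;> exact hMg k _
  filter_upwards [ENNReal.tendsto_nhds_zero.1
    (tendsto_lintegral_mollify_of_weak hS hM hweak m hKc) ε' hε'] with k hk
  have hin : ∫⁻ x in K, ‖w k x‖ₑ ^ 2 ≤ 2 * ε' + 2 * ε' := by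
    have hm : Measurable fun x => ‖mollify m (extend S (w k)) x‖ₑ ^ 2 :=
      (mollify_contDiff m (extend_locallyIntegrable hS (w k))).continuous.measurable.enorm.pow_const 2
    calc ∫⁻ x in K, ‖w k x‖ₑ ^ 2
        ≤ ∫⁻ x in K, 2 * (‖mollify m (extend S (w k)) x‖ₑ ^ 2 +
            ‖mollify m (extend S (w k)) x - extend S (w k) x‖ₑ ^ 2) := by
          refine setLIntegral_mono' hKm fun x hx => ?_
          have e : w k x = mollify m (extend S (w k)) x +
              -(mollify m (extend S (w k)) x - extend S (w k) x) := by
            simp [extend, hKS hx]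
          conv_lhs => rw [e]
          refine (enorm_add_sq_le _ _).trans ?_
          rw [enorm_neg]
      _ = 2 * ((∫⁻ x in K, ‖mollify m (extend S (w k)) x‖ₑ ^ 2) +
            ∫⁻ x in K, ‖mollify m (extend S (w k)) x - extend S (w k) x‖ₑ ^ 2) := by
          rw [lintegral_const_mul' _ _ (by norm_num), lintegral_add_left hm]
      _ ≤ 2 * (ε' + ε') := by gcongr; exact hmoll k
      _ = _ := mul_add _ _ _
  calc ∫⁻ x in S, ‖w k x‖ₑ ^ 2
      ≤ (∫⁻ x in S \ K, ‖w k x‖ₑ ^ 2) + ∫⁻ x in K, ‖w k x‖ₑ ^ 2 := by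
        rw [← lintegral_union hKm disjoint_sdiff_left, sdiff_union_of_subset hKS]
    _ ≤ ε' + (2 * ε' + 2 * ε') := add_le_add (hout k) hin
    _ ≤ ε := hε3

/-- Weak `H¹`-convergence of a uniformly bounded sequence implies strong `L²`-convergence. -/
theorem H1.tendsto_fn_of_weak {S : Set E2} (hS : IsOpen S) (hfin : volume S ≠ ⊤) {u : ℕ → H1 S}
    {v : H1 S} (hweak : ∀ ℓ : StrongDual ℝ (H1 S), Tendsto (fun k => ℓ (u k)) atTop (𝓝 (ℓ v)))
    {M B : ℝ} (hM : ∀ k, ‖u k‖ ≤ M) (hB : ∀ k, ∀ᵐ x ∂(volume.restrict S), ‖(u k).fn x‖ ≤ B) :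
    Tendsto (fun k => (u k).fn) atTop (𝓝 v.fn) := by
  set w : ℕ → H1 S := fun k => u k - v with hw
  have hwfn : ∀ k, (w k).fn = (u k).fn - v.fn := fun _ => rfl
  have hn1 : ∀ z : H1 S, ‖z.fn‖ ≤ ‖z‖ := fun z => by
    refine le_of_sq_le_sq ?_ (norm_nonneg _)
    rw [H1.norm_sq]
    exact le_add_of_nonneg_right (by positivity)
  have hn2 : ∀ (z : H1 S) i, ‖z.grad i‖ ≤ ‖z‖ := fun z i => by
    refine le_of_sq_le_sq ?_ (norm_nonneg _)
    rw [H1.norm_sq]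
    have := Finset.single_le_sum (f := fun i => ‖z.grad i‖ ^ 2) (fun i _ => by positivity)
      (Finset.mem_univ i)
    have h2 : 0 ≤ ‖z.fn‖ ^ 2 := by positivity
    linarith
  have hwM : ∀ k, ‖w k‖ ≤ M + ‖v‖ := fun k => (norm_sub_le _ _).trans (by linarith [hM k])
  have hconv : ∀ {a : ℝ}, a ≤ M + ‖v‖ → a ≤ ((M + ‖v‖).toNNReal : ℝ) := fun h =>
    h.trans (Real.le_coe_toNNReal _)
  have hmain := tendsto_lintegral_of_weak hS (w := fun k => (w k).fn) (g := fun k => (w k).grad)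
    (fun k i => (w k).hasWeakPartial i) (M := (M + ‖v‖).toNNReal)
    (fun k => enorm_le_coe.2 (NNReal.coe_le_coe.1 (hconv ((hn1 _).trans (hwM k)))))
    (fun k i => enorm_le_coe.2 (NNReal.coe_le_coe.1 (hconv ((hn2 _ i).trans (hwM k)))))
    (fun a => by
      have h1 := hweak ((innerSL ℝ a).comp (H1.fnL S))
      simp only [ContinuousLinearMap.comp_apply, H1.fnL_apply, innerSL_apply_apply] at h1
      have h2 := h1.sub_const (inner ℝ a v.fn)
      rw [sub_self] at h2
      refine h2.congr fun k => ?_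
      rw [hwfn, inner_sub_right])
    (d := fun x => 2 * (ENNReal.ofReal B ^ 2 + ‖v.fn x‖ₑ ^ 2)) (by
      rw [lintegral_const_mul' _ _ (by norm_num), lintegral_add_left measurable_const,
        ← enorm_sq_eq_lintegral, setLIntegral_const]
      finiteness)
    (fun k => by
      filter_upwards [hB k, Lp.coeFn_sub (u k).fn v.fn] with x hx h1
      rw [hwfn, h1, Pi.sub_apply, sub_eq_add_neg]
      refine (enorm_add_sq_le _ _).trans ?_
      rw [enorm_neg, ← ofReal_norm ((u k).fn x)]
      gcongr)
  rw [tendsto_iff_edist_tendsto_0]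
  refine tendsto_zero_of_sq (hmain.congr fun k => ?_)
  rw [← enorm_sq_eq_lintegral, hwfn, edist_eq_enorm_sub]

/-! ### Bounds up to the boundary of a Lipschitz domain -/

theorem norm_mollify_le {S : Set E2} (hS : IsOpen S) {g : L2 S}
    (hg : ∀ᵐ x ∂(volume.restrict S), ‖g x‖ ≤ 1) (m : ℕ) (x : E2) :
    ‖mollify m (extend S g) x‖ ≤ 1 := by
  have h1 : ∀ᵐ t, ‖extend S g t‖ ≤ 1 := by
    filter_upwards [(ae_restrict_iff' hS.measurableSet).1 hg] with t ht
    by_cases h : t ∈ S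
    · simpa [extend, h] using ht h
    · simp [extend, h]
  have h2 : ∀ᵐ t, ‖extend S g (x - t)‖ ≤ 1 :=
    (Measure.measurePreserving_sub_left volume x).quasiMeasurePreserving.ae h1
  have hi : Integrable (kernel m) := (bump m).integrable_normed
  rw [mollify_apply, ← kernel_integral m]
  refine norm_integral_le_of_norm_le hi ?_
  filter_upwards [h2] with t ht
  rw [norm_smul, Real.norm_of_nonneg (kernel_nonneg m t)]
  exact mul_le_of_le_one_right (kernel_nonneg m t) ht

/-- A function with bounded weak derivatives is, off a null set, Lipschitz along segments in `S`. -/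
theorem exists_null_lipschitz {S : Set E2} (hS : IsOpen S) {u : L2 S} {g : Fin 2 → L2 S}
    (h : ∀ i, HasWeakPartial S i u (g i))
    (hg : ∀ i, ∀ᵐ x ∂(volume.restrict S), ‖g i x‖ ≤ 1) :
    ∃ G : Set E2, (∀ᵐ x, x ∈ G) ∧ ∀ x ∈ G, ∀ z ∈ G, segment ℝ x z ⊆ S →
      ‖u x - u z‖ ≤ 2 * ‖x - z‖ := by
  have hl := extend_locallyIntegrable hS u
  refine ⟨{x | Tendsto (fun k => mollify k (extend S u) x) atTop (𝓝 (extend S u x))},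
    ae_tendsto_mollify hl, fun x hx z hz hseg => ?_⟩
  have hxS : x ∈ S := hseg (left_mem_segment ℝ x z)
  have hzS : z ∈ S := hseg (right_mem_segment ℝ x z)
  have hlim := (Tendsto.sub (mem_ofPred_eq ▸ hx) (mem_ofPred_eq ▸ hz)).norm
  have hcomp : IsCompact (segment ℝ x z) := by
    rw [segment_eq_image_lineMap]
    exact isCompact_Icc.image (by fun_prop)
  have e : ∀ t ∈ S, extend S u t = u t := fun t ht => by simp [extend, ht]
  rw [e x hxS, e z hzS] at hlim
  refine le_of_tendsto hlim ?_
  filter_upwards [eventually_closedBall_subset hS hcomp hseg] with m hm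
  have hcd := (mollify_contDiff m hl).differentiable (by simp)
  refine (convex_segment x z).norm_image_sub_le_of_norm_fderiv_le (𝕜 := ℝ)
    (fun t _ => hcd t) (fun t ht => ?_) (right_mem_segment ℝ x z) (left_mem_segment ℝ x z)
  refine ContinuousLinearMap.opNorm_le_bound _ (by norm_num) fun v => ?_
  rw [fderiv_mollify_apply hS h m (hm t ht), mollify_dirDeriv hS, Fin.sum_univ_two]
  refine (norm_add_le _ _).trans ?_
  have hb : ∀ i, ‖v i • mollify m (extend S (g i)) t‖ ≤ ‖v‖ := fun i => by
    rw [norm_smul]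
    calc ‖v i‖ * ‖mollify m (extend S (g i)) t‖ ≤ ‖v‖ * 1 :=
          mul_le_mul (PiLp.norm_apply_le v i) (norm_mollify_le hS (hg i) m t) (norm_nonneg _)
            (norm_nonneg _)
      _ = ‖v‖ := mul_one _
  linarith [hb 0, hb 1]

/-- A uniform interior cone condition: from every point of a Lipschitz domain one sees a ball of
fixed radius at bounded distance. -/
theorem IsLipschitzDomain.exists_ball {S : Set E2} (hS : IsLipschitzDomain S) :
    ∃ ρ > 0, ∃ T : ℝ, ∀ x ∈ S, ∃ z, ‖z - x‖ ≤ T ∧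
      ∀ w ∈ Metric.closedBall z ρ, segment ℝ x w ⊆ S := by
  obtain ⟨hSo, -, hSb, hfr⟩ := hS
  have hcomp : IsCompact (closure S) := hSb.isCompact_closure
  have main : ∃ ρ > 0, ∃ T : ℝ, ∀ x ∈ closure S, x ∈ S → ∃ z, ‖z - x‖ ≤ T ∧
      ∀ w ∈ Metric.closedBall z ρ, segment ℝ x w ⊆ S := by
    refine hcomp.induction_on (p := fun s => ∃ ρ > 0, ∃ T : ℝ, ∀ x ∈ s, x ∈ S →
      ∃ z, ‖z - x‖ ≤ T ∧ ∀ w ∈ Metric.closedBall z ρ, segment ℝ x w ⊆ S) ?_ ?_ ?_ ?_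
    · exact ⟨1, one_pos, 0, by simp⟩
    · rintro s t hst ⟨ρ, hρ, T, h⟩
      exact ⟨ρ, hρ, T, fun x hx => h x (hst hx)⟩
    · rintro s t ⟨ρ, hρ, T, h⟩ ⟨ρ', hρ', T', h'⟩
      refine ⟨min ρ ρ', lt_min hρ hρ', max T T', fun x hx hxS => ?_⟩
      rcases hx with hx | hx
      · obtain ⟨z, hz, hw⟩ := h x hx hxS
        exact ⟨z, hz.trans (le_max_left _ _), fun w hwz =>
          hw w (Metric.closedBall_subset_closedBall (min_le_left _ _) hwz)⟩
      · obtain ⟨z, hz, hw⟩ := h' x hx hxS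
        exact ⟨z, hz.trans (le_max_right _ _), fun w hwz =>
          hw w (Metric.closedBall_subset_closedBall (min_le_right _ _) hwz)⟩
    · intro p hp
      by_cases hpS : p ∈ S
      · obtain ⟨r, hr, hball⟩ := Metric.isOpen_iff.1 hSo p hpS
        refine ⟨Metric.ball p (r / 2), mem_nhdsWithin_of_mem_nhds
          (Metric.ball_mem_nhds p (by positivity)), r / 4, by positivity, 0,
          fun x hx _ => ⟨x, by simp, fun w hw => ?_⟩⟩
        refine ((convex_ball p r).segment_subset ?_ ?_).trans hball
        · exact Metric.ball_subset_ball (by linarith) hx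
        · rw [Metric.mem_ball] at hx ⊢
          rw [Metric.mem_closedBall] at hw
          linarith [dist_triangle w x p]
      · have hpf : p ∈ frontier S := ⟨hp, fun h => hpS (interior_subset h)⟩
        obtain ⟨U, e, γ, K, hU, hpU, hγ, hgraph⟩ := hfr p hpf
        obtain ⟨r, hr, hball⟩ := Metric.isOpen_iff.1 hU p hpU
        set R := r / 4 with hR
        have hRpos : 0 < R := by positivity
        -- the ball is reached by moving upwards in the coordinates of the graph
        set v : E2 := e.symm (EuclideanSpace.single 1 R) with hv
        have hvn : ‖v‖ = R := by
          rw [hv, LinearIsometryEquiv.norm_map, PiLp.norm_single,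
            Real.norm_of_nonneg hRpos.le]
        have hev : e v = EuclideanSpace.single 1 R := by simp [hv]
        have hK0 : (0 : ℝ) ≤ K := K.2
        refine ⟨Metric.ball p R, mem_nhdsWithin_of_mem_nhds (Metric.ball_mem_nhds p hRpos),
          R / (1 + K), by positivity, R, fun x hx hxS => ⟨x + v, by simp [hvn], fun w hw => ?_⟩⟩
        rw [segment_eq_image']
        rintro _ ⟨s, hs, rfl⟩
        change x + s • (w - x) ∈ S
        set d := w - (x + v) with hd
        have hdn : ‖d‖ ≤ R / (1 + K) := by
          rwa [Metric.mem_closedBall, dist_eq_norm] at hw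
        have hdK : ‖d‖ * (1 + K) ≤ R := (le_div_iff₀ (by positivity)).1 hdn
        have hdR : ‖d‖ ≤ R := by nlinarith [norm_nonneg d]
        have hwx : w - x = v + d := by rw [hd]; abel
        have hxU : x ∈ U := hball (Metric.ball_subset_ball (by linarith) hx)
        have hmem : x + s • (w - x) ∈ U := by
          refine hball ?_
          rw [Metric.mem_ball, dist_eq_norm] at hx ⊢
          have h1 : ‖s • (w - x)‖ ≤ 2 * R := by
            rw [norm_smul, Real.norm_of_nonneg hs.1, hwx]
            have := norm_add_le v d
            nlinarith [hs.2, hs.1, norm_nonneg (v + d)]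
          calc ‖x + s • (w - x) - p‖ = ‖(x - p) + s • (w - x)‖ := by congr 1; abel
            _ ≤ ‖x - p‖ + ‖s • (w - x)‖ := norm_add_le _ _
            _ < r := by linarith
        rw [hgraph _ hmem]
        have hx1 := (hgraph x hxU).1 hxS
        have h0 : e (x + s • (w - x)) 0 = e x 0 + s * e d 0 := by
          rw [hwx, map_add, map_smul, map_add, hev]
          simp
        have h1 : e (x + s • (w - x)) 1 = e x 1 + s * (R + e d 1) := by
          rw [hwx, map_add, map_smul, map_add, hev]
          simp [mul_add]
        rw [h0, h1]
        have hb : ∀ i, |e d i| ≤ ‖d‖ := fun i => by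
          rw [← LinearIsometryEquiv.norm_map e d, ← Real.norm_eq_abs]
          exact PiLp.norm_apply_le (e d) i
        have hlip : γ (e x 0 + s * e d 0) - γ (e x 0) ≤ K * (s * ‖d‖) := by
          have h2 := hγ.dist_le_mul (e x 0 + s * e d 0) (e x 0)
          rw [Real.dist_eq, Real.dist_eq, add_sub_cancel_left, abs_mul, abs_of_nonneg hs.1] at h2
          refine (le_abs_self _).trans (h2.trans ?_)
          gcongr
          · exact hs.1
          · exact hb 0
        have h3 : -‖d‖ ≤ e d 1 := (abs_le.1 (hb 1)).1
        have h4 : 0 ≤ s * (R - ‖d‖ * (1 + K)) := mul_nonneg hs.1 (by linarith)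
        have h5 : 0 ≤ s * (e d 1 + ‖d‖) := mul_nonneg hs.1 (by linarith)
        nlinarith
  obtain ⟨ρ, hρ, T, h⟩ := main
  exact ⟨ρ, hρ, T, fun x hx => h x (subset_closure hx) hx⟩

/-- On a Lipschitz domain, functions with derivatives bounded by one are bounded in terms of their
`L²`-norm. -/
theorem IsLipschitzDomain.exists_bound {S : Set E2} (hS : IsLipschitzDomain S) (C : ℝ) :
    ∃ B : ℝ, ∀ (u : L2 S) (g : Fin 2 → L2 S), (∀ i, HasWeakPartial S i u (g i)) →
      (∀ i, ∀ᵐ x ∂(volume.restrict S), ‖g i x‖ ≤ 1) → ‖u‖ ≤ C →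
      ∀ᵐ x ∂(volume.restrict S), ‖u x‖ ≤ B := by
  obtain ⟨ρ, hρ, T, hball⟩ := hS.exists_ball
  have hSo := hS.1
  set c : ℝ≥0∞ := volume (Metric.closedBall (0 : E2) ρ) with hc
  have hc0 : c ≠ 0 := (Metric.measure_closedBall_pos volume 0 hρ).ne'
  have hct : c ≠ ⊤ := measure_closedBall_lt_top.ne
  set D : ℝ≥0∞ := (2 * (ENNReal.ofReal (2 * (T + ρ)) ^ 2 * c + ENNReal.ofReal C ^ 2)) / c with hD
  have hDt : D ≠ ⊤ := ENNReal.div_ne_top (by finiteness) hc0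
  refine ⟨Real.sqrt D.toReal, fun u g h hg hu => ?_⟩
  obtain ⟨G, hG, hlip⟩ := exists_null_lipschitz hSo h hg
  rw [ae_restrict_iff' hSo.measurableSet]
  filter_upwards [hG] with x hxG hxS
  obtain ⟨z, hz, hseg⟩ := hball x hxS
  have hsub : Metric.closedBall z ρ ⊆ S := fun w hw => hseg w hw (right_mem_segment ℝ x w)
  have hcz : volume (Metric.closedBall z ρ) = c := Measure.addHaar_closedBall_center _ _ _
  have hpt : ∀ᵐ w ∂(volume.restrict (Metric.closedBall z ρ)), ‖u x‖ₑ ^ 2 ≤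
      2 * (ENNReal.ofReal (2 * (T + ρ)) ^ 2 + ‖u w‖ₑ ^ 2) := by
    rw [ae_restrict_iff' Metric.isClosed_closedBall.measurableSet]
    filter_upwards [hG] with w hwG hw
    have h1 := hlip x hxG w hwG (hseg w hw)
    have h2 : ‖x - w‖ ≤ T + ρ := by
      rw [Metric.mem_closedBall, dist_eq_norm] at hw
      calc ‖x - w‖ = ‖-(z - x) - (w - z)‖ := by congr 1; abel
        _ ≤ ‖z - x‖ + ‖w - z‖ := by
            refine (norm_sub_le _ _).trans ?_
            rw [norm_neg]
        _ ≤ T + ρ := add_le_add hz hw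
    have e : u x = (u x - u w) + u w := by abel
    conv_lhs => rw [e]
    refine (enorm_add_sq_le _ _).trans ?_
    rw [← ofReal_norm (u x - u w)]
    gcongr
    linarith
  have hint : ‖u x‖ₑ ^ 2 * c ≤
      2 * (ENNReal.ofReal (2 * (T + ρ)) ^ 2 * c + ENNReal.ofReal C ^ 2) := by
    calc ‖u x‖ₑ ^ 2 * c = ∫⁻ w in Metric.closedBall z ρ, ‖u x‖ₑ ^ 2 := by
          rw [setLIntegral_const, hcz]
      _ ≤ ∫⁻ w in Metric.closedBall z ρ, 2 * (ENNReal.ofReal (2 * (T + ρ)) ^ 2 + ‖u w‖ₑ ^ 2) :=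
          lintegral_mono_ae hpt
      _ = 2 * (ENNReal.ofReal (2 * (T + ρ)) ^ 2 * c +
            ∫⁻ w in Metric.closedBall z ρ, ‖u w‖ₑ ^ 2) := by
          rw [lintegral_const_mul' _ _ (by norm_num), lintegral_add_left measurable_const,
            setLIntegral_const, hcz]
      _ ≤ _ := by
          gcongr
          refine (lintegral_mono_set hsub).trans ?_
          rw [← enorm_sq_eq_lintegral, ← ofReal_norm u]
          gcongr
  have hfinal : ‖u x‖ₑ ^ 2 ≤ D := (ENNReal.le_div_iff_mul_le (Or.inl hc0) (Or.inl hct)).2 hint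
  refine Real.le_sqrt_of_sq_le ?_
  have := ENNReal.toReal_mono hDt hfinal
  simpa using this

/-! ### Quadratic forms -/

theorem QuadraticForm.expand {ι : Type*} [Fintype ι] [DecidableEq ι]
    (q : QuadraticForm ℝ (ι → ℝ)) (v : ι → ℝ) :
    q v = ∑ i, ∑ j, (QuadraticMap.polar q (Pi.single i 1) (Pi.single j 1) / 2) * (v i * v j) := by
  have h1 : QuadraticMap.polar q v v = 2 * q v := by
    rw [QuadraticMap.polar_self]; simp
  have h2 : QuadraticMap.polarBilin q v v = ∑ i, ∑ j,
      (v i * v j) * QuadraticMap.polar q (Pi.single i 1) (Pi.single j 1) := by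
    have hv : v = ∑ i, v i • (Pi.single i 1 : ι → ℝ) := by
      conv_lhs => rw [← Finset.univ_sum_single v]
      refine Finset.sum_congr rfl fun i _ => ?_
      rw [← Pi.single_smul, smul_eq_mul, mul_one]
    conv_lhs => rw [hv]
    rw [LinearMap.map_sum₂]
    refine Finset.sum_congr rfl fun i _ => ?_
    rw [LinearMap.map_smul₂, map_sum, Finset.smul_sum]
    refine Finset.sum_congr rfl fun j _ => ?_
    rw [map_smul, smul_eq_mul, smul_eq_mul, mul_assoc]
    rfl
  rw [QuadraticMap.polarBilin_apply_apply, h1] at h2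
  have h3 : q v = (∑ i, ∑ j,
      (v i * v j) * QuadraticMap.polar q (Pi.single i 1) (Pi.single j 1)) / 2 := by linarith
  rw [h3, Finset.sum_div]
  refine Finset.sum_congr rfl fun i _ => ?_
  rw [Finset.sum_div]
  exact Finset.sum_congr rfl fun j _ => by ring

theorem QuadraticForm.continuous {E : Type*} [NormedAddCommGroup E] [NormedSpace ℝ E]
    [FiniteDimensional ℝ E] (q : QuadraticForm ℝ E) : Continuous q := by
  set e := (Module.finBasis ℝ E).equivFun
  have h : ∀ v, q v = (q.comp e.symm.toLinearMap) (e v) := fun v => by simp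
  have he : Continuous e := LinearMap.continuous_of_finiteDimensional e.toLinearMap
  have hq : (q : E → ℝ) = fun v => ∑ i, ∑ j, (QuadraticMap.polar (q.comp e.symm.toLinearMap)
      (Pi.single i 1) (Pi.single j 1) / 2) * (e v i * e v j) := by
    ext1 v
    rw [h, QuadraticForm.expand]
  rw [hq]
  fun_prop

/-- Partial minimization: minimizing a quadratic form over a subspace on which it is positive
definite yields a quadratic form, and the minimizer depends linearly on the other variable. -/
theorem QuadraticForm.exists_marginal {V D : Type*} [AddCommGroup V] [Module ℝ V]
    [AddCommGroup D] [Module ℝ D] [FiniteDimensional ℝ D] (q : QuadraticForm ℝ (V × D))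
    (hpos : ∀ d : D, d ≠ 0 → 0 < q (0, d)) :
    ∃ (q' : QuadraticForm ℝ V) (L : V →ₗ[ℝ] D), ∀ v, q' v = q (v, L v) ∧ ∀ d, q' v ≤ q (v, d) := by
  -- the Euler-Lagrange equation `polar q (v, L v) (0, d) = 0` is solved by inverting `β`
  set β : D →ₗ[ℝ] Module.Dual ℝ D :=
    q.polarBilin.compl₁₂ (LinearMap.inr ℝ V D) (LinearMap.inr ℝ V D) with hβ
  set α : V →ₗ[ℝ] Module.Dual ℝ D :=
    q.polarBilin.compl₁₂ (LinearMap.inl ℝ V D) (LinearMap.inr ℝ V D) with hα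
  have hnn : ∀ d : D, 0 ≤ q (0, d) := fun d => by
    rcases eq_or_ne d 0 with rfl | hd
    · exact (QuadraticMap.map_zero q).ge
    · exact (hpos d hd).le
  have hinj : Function.Injective β := by
    rw [← LinearMap.ker_eq_bot, LinearMap.ker_eq_bot']
    intro d hd
    by_contra hne
    have h1 : β d d = 2 * q (0, d) := by
      simp [hβ]
    rw [hd, LinearMap.zero_apply] at h1
    linarith [hpos d hne]
  set E := β.linearEquivOfInjective hinj Subspace.dual_finrank_eq.symm with hE
  set L : V →ₗ[ℝ] D := -(E.symm.toLinearMap ∘ₗ α) with hL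
  have hEL : ∀ v d, QuadraticMap.polar q (v, L v) (0, d) = 0 := by
    intro v d
    have h1 : β (L v) = - α v := by
      have : E (L v) = - α v := by simp [hL]
      rwa [hE, LinearMap.linearEquivOfInjective_apply] at this
    have h2 : ((v, L v) : V × D) = (v, 0) + (0, L v) := by simp
    rw [h2, QuadraticMap.polar_add_left]
    have h3 := LinearMap.congr_fun h1 d
    simp only [hβ, hα, LinearMap.compl₁₂_apply, LinearMap.inl_apply, LinearMap.inr_apply,
      QuadraticMap.polarBilin_apply_apply, LinearMap.neg_apply] at h3
    linarith
  refine ⟨q.comp (LinearMap.prod LinearMap.id L), L, fun v => ⟨rfl, fun d => ?_⟩⟩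
  have h1 : ((v, d) : V × D) = (v, L v) + (0, d - L v) := by simp
  have h2 : q (v, d) = q (v, L v) + q (0, d - L v) := by
    rw [h1, QuadraticMap.map_add q, hEL, add_zero]
  have h3 : (q.comp (LinearMap.prod LinearMap.id L)) v = q (v, L v) := rfl
  rw [h3, h2]
  linarith [hnn (d - L v)]

/-- Integrals of quadratic forms are quadratic forms. -/
theorem QuadraticForm.exists_integral {X E : Type*} [MeasurableSpace X] [AddCommGroup E]
    [Module ℝ E] (μ : Measure X) (f : X → QuadraticForm ℝ E)
    (hf : ∀ v, Integrable (fun x => f x v) μ) :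
    ∃ q : QuadraticForm ℝ E, ∀ v, q v = ∫ x, f x v ∂μ := by
  have hp : ∀ v w, Integrable (fun x => QuadraticMap.polar (f x) v w) μ := fun v w =>
    ((hf (v + w)).sub (hf v)).sub (hf w)
  refine ⟨⟨fun v => ∫ x, f x v ∂μ, fun a v => ?_, ⟨LinearMap.mk₂ ℝ
    (fun v w => ∫ x, QuadraticMap.polar (f x) v w ∂μ) ?_ ?_ ?_ ?_, fun v w => ?_⟩⟩, fun v => rfl⟩
  · simp only [QuadraticMap.map_smul]
    rw [integral_smul]
  · intro v v' w
    simp only [QuadraticMap.polar_add_left]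
    exact integral_add (hp v w) (hp v' w)
  · intro c v w
    simp only [QuadraticMap.polar_smul_left]
    exact integral_smul c _
  · intro v w w'
    simp only [QuadraticMap.polar_add_right]
    exact integral_add (hp v w) (hp v w')
  · intro c v w
    simp only [QuadraticMap.polar_smul_right]
    exact integral_smul c _
  · rw [LinearMap.mk₂_apply]
    rw [← integral_add (hf v) (hf w), ← integral_add (by exact (hf v).add (hf w)) (hp v w)]
    refine integral_congr_ae (Eventually.of_forall fun x => ?_)
    exact QuadraticMap.map_add (f x) v w

/-- A measurable family of quadratic forms may be evaluated along a measurable map. -/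
theorem QuadraticForm.aemeasurable_apply {X : Type*} [MeasurableSpace X] {μ : Measure X}
    {ι : Type*} [Fintype ι] [DecidableEq ι] {f : X → QuadraticForm ℝ (ι → ℝ)}
    (hf : ∀ v, AEMeasurable (fun x => f x v) μ) {ψ : X → ι → ℝ} (hψ : ∀ i, Measurable fun x => ψ x i) :
    AEMeasurable (fun x => f x (ψ x)) μ := by
  simp only [QuadraticForm.expand]
  refine Finset.aemeasurable_fun_sum _ fun i _ => Finset.aemeasurable_fun_sum _ fun j _ => ?_
  refine AEMeasurable.mul ?_ ((hψ i).mul (hψ j)).aemeasurable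
  exact (((hf _).sub (hf _)).sub (hf _)).div_const 2

theorem iInf_eq_of_attained {ι : Type*} {f : ι → ℝ} {i : ι} {c : ℝ} (h1 : c = f i)
    (h2 : ∀ j, c ≤ f j) : ⨅ j, f j = c := by
  have : Nonempty ι := ⟨i⟩
  refine le_antisymm ?_ (le_ciInf h2)
  rw [h1]
  exact ciInf_le ⟨c, by rintro _ ⟨j, rfl⟩; exact h2 j⟩ i

/-! ### The quadratic form of linearized elasticity -/

theorem frob_nonneg (F : M3) : 0 ≤ frob F := Real.sqrt_nonneg _

theorem frob_sq (F : M3) : frob F ^ 2 = ∑ i, ∑ j, F i j ^ 2 :=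
  Real.sq_sqrt (Finset.sum_nonneg fun _ _ => Finset.sum_nonneg fun _ _ => sq_nonneg _)

theorem frob_smul (t : ℝ) (F : M3) : frob (t • F) = |t| * frob F := by
  have h : (∑ i, ∑ j, (t • F) i j ^ 2) = t ^ 2 * ∑ i, ∑ j, F i j ^ 2 := by
    simp only [Matrix.smul_apply, smul_eq_mul, mul_pow, Finset.mul_sum]
  rw [frob, h, Real.sqrt_mul (sq_nonneg t), Real.sqrt_sq_eq_abs, frob]

section Frobenius

open scoped Matrix.Norms.Frobenius

theorem frob_eq_norm (F : M3) : frob F = ‖F‖ := by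
  rw [Matrix.frobenius_norm_def, frob, Real.sqrt_eq_rpow]
  simp [sq_abs]

theorem eq_zero_of_frob_eq_zero {F : M3} (h : frob F = 0) : F = 0 :=
  norm_eq_zero.1 ((frob_eq_norm F).symm.trans h)

theorem frob_orthogonal {R : M3} (hR : R ∈ Matrix.specialOrthogonalGroup (Fin 3) ℝ) :
    frob R ≤ 2 := by
  have h1 : R.transpose * R = 1 := by
    have := (Matrix.mem_orthogonalGroup_iff' (Fin 3) ℝ).1
      (Matrix.mem_specialOrthogonalGroup_iff.1 hR).1
    simpa [Matrix.star_eq_conjTranspose] using this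
  have h2 : frob R ^ 2 = 3 := by
    have h3 : (R.transpose * R).trace = 3 := by rw [h1]; simp
    rw [frob_sq, ← h3]
    simp only [Matrix.trace, Matrix.diag, Matrix.mul_apply, Matrix.transpose_apply]
    rw [Finset.sum_comm]
    exact Finset.sum_congr rfl fun i _ => Finset.sum_congr rfl fun j _ => sq (R j i)
  nlinarith [frob_nonneg R]

/-- A lower bound for the distance to `SO(3)` of matrices close to the identity, obtained from
`FᵀF - I = Fᵀ(F - R) + (F - R)ᵀR`. -/
theorem le_frob_sub {G R : M3} (hG : G.IsSymm)
    (hR : R ∈ Matrix.specialOrthogonalGroup (Fin 3) ℝ) {t : ℝ} (ht : 0 ≤ t) :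
    (2 * t * frob G - t ^ 2 * frob G ^ 2) / (4 + t * frob G) ≤ frob (1 + t • G - R) := by
  have hR1 : R.transpose * R = 1 := by
    have := (Matrix.mem_orthogonalGroup_iff' (Fin 3) ℝ).1
      (Matrix.mem_specialOrthogonalGroup_iff.1 hR).1
    simpa [Matrix.star_eq_conjTranspose] using this
  have h1 : frob (1 : M3) ≤ 2 := frob_orthogonal (Submonoid.one_mem _)
  have hR2 := frob_orthogonal hR
  have hn := frob_nonneg G
  simp only [frob_eq_norm] at *
  rw [div_le_iff₀ (by positivity)]
  set F : M3 := 1 + t • G with hF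
  have hFn : ‖F‖ ≤ 2 + t * ‖G‖ := by
    refine (norm_add_le _ _).trans ?_
    rw [norm_smul, Real.norm_of_nonneg ht]
    linarith
  have e1 : F.transpose * F - 1 = (2 * t) • G + (t ^ 2) • (G * G) := by
    have : F.transpose = F := by
      rw [hF, Matrix.transpose_add, Matrix.transpose_smul, hG.eq, Matrix.transpose_one]
    rw [this, hF]
    simp only [add_mul, mul_add, mul_one, one_mul, Matrix.smul_mul, Matrix.mul_smul, smul_smul]
    module
  have e2 : F.transpose * F - 1 = F.transpose * (F - R) + (F - R).transpose * R := by
    rw [Matrix.transpose_sub, mul_sub, sub_mul, hR1]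
    abel
  have u1 : 2 * t * ‖G‖ - t ^ 2 * ‖G‖ ^ 2 ≤ ‖F.transpose * F - 1‖ := by
    rw [e1]
    have a1 : ‖(2 * t) • G‖ = 2 * t * ‖G‖ := by
      rw [norm_smul, Real.norm_of_nonneg (by positivity)]
    have a2 : ‖(t ^ 2) • (G * G)‖ ≤ t ^ 2 * ‖G‖ ^ 2 := by
      rw [norm_smul, Real.norm_of_nonneg (by positivity), sq ‖G‖]
      gcongr
      exact Matrix.frobenius_norm_mul G G
    have a3 := norm_sub_norm_le ((2 * t) • G) (-((t ^ 2) • (G * G)))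
    rw [norm_neg, sub_neg_eq_add] at a3
    linarith
  have u2 : ‖F.transpose * F - 1‖ ≤ ‖F - R‖ * (4 + t * ‖G‖) := by
    rw [e2]
    have b1 : ‖F.transpose * (F - R)‖ ≤ ‖F‖ * ‖F - R‖ := by
      refine (Matrix.frobenius_norm_mul _ _).trans ?_
      rw [Matrix.frobenius_norm_transpose]
    have b2 : ‖(F - R).transpose * R‖ ≤ ‖F - R‖ * ‖R‖ := by
      refine (Matrix.frobenius_norm_mul _ _).trans ?_
      rw [Matrix.frobenius_norm_transpose]
    have b3 := norm_add_le (F.transpose * (F - R)) ((F - R).transpose * R)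
    nlinarith [norm_nonneg (F - R)]
  exact u1.trans u2

end Frobenius

theorem distSqSO3_le (F : M3) : distSqSO3 F ≤ frob (F - 1) ^ 2 :=
  ciInf_le (f := fun R : Matrix.specialOrthogonalGroup (Fin 3) ℝ => frob (F - (R : M3)) ^ 2)
    ⟨0, by rintro _ ⟨R, rfl⟩; positivity⟩ 1

theorem le_distSqSO3 {F : M3} {c : ℝ} (hc : 0 ≤ c)
    (h : ∀ R ∈ Matrix.specialOrthogonalGroup (Fin 3) ℝ, c ≤ frob (F - R)) :
    c ^ 2 ≤ distSqSO3 F :=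
  le_ciInf fun R => pow_le_pow_left₀ hc (h R R.2) 2

/-- The interval of thickness variables. -/
abbrev thick : Set ℝ := Ioo (-1 / 2 : ℝ) (1 / 2)

/-- Close to the identity the stored energy is finite, with quadratic growth. -/
theorem IsStoredEnergy.eventually_ne_top {CW qW : ℝ} {rW : ℝ → ℝ≥0∞} {W : ℝ → M3 → ℝ≥0∞}
    {Q : ℝ → QuadraticForm ℝ M3} (h : IsStoredEnergy CW qW rW W Q) {x : ℝ} (hx : x ∈ thick)
    (G : M3) : ∀ᶠ t in 𝓝[>] (0 : ℝ), W x (1 + t • G) ≠ ⊤ ∧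
      (W x (1 + t • G)).toReal ≤ CW * (t ^ 2 * frob G ^ 2) := by
  have h1 : Tendsto (fun t : ℝ => t ^ 2 * frob G ^ 2) (𝓝[>] 0) (𝓝 0) := by
    have : Continuous fun t : ℝ => t ^ 2 * frob G ^ 2 := by fun_prop
    simpa using (this.tendsto 0).mono_left nhdsWithin_le_nhds
  have hpos : 0 < 1 / CW := one_div_pos.2 h.CW_pos
  filter_upwards [h1.eventually_lt_const hpos] with t ht
  have hd : distSqSO3 (1 + t • G) ≤ t ^ 2 * frob G ^ 2 := by
    refine (distSqSO3_le _).trans (le_of_eq ?_)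
    rw [add_sub_cancel_left, frob_smul, mul_pow, sq_abs]
  have hW := h.upper_bound x hx (1 + t • G) (hd.trans ht.le)
  refine ⟨ne_top_of_le_ne_top ENNReal.ofReal_ne_top hW, ?_⟩
  refine ENNReal.toReal_le_of_le_ofReal (by have := h.CW_pos; positivity) (hW.trans ?_)
  exact ENNReal.ofReal_le_ofReal (mul_le_mul_of_nonneg_left hd h.CW_pos.le)

/-- The quadratic form is the limit of the rescaled stored energies. -/
theorem IsStoredEnergy.tendsto_div {CW qW : ℝ} {rW : ℝ → ℝ≥0∞} {W : ℝ → M3 → ℝ≥0∞}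
    {Q : ℝ → QuadraticForm ℝ M3} (h : IsStoredEnergy CW qW rW W Q) {x : ℝ} (hx : x ∈ thick)
    (G : M3) : Tendsto (fun t : ℝ => (W x (1 + t • G)).toReal / t ^ 2) (𝓝[>] 0) (𝓝 (Q x G)) := by
  have hpos : ∀ᶠ t in 𝓝[>] (0 : ℝ), 0 < t := self_mem_nhdsWithin
  rcases eq_or_ne (frob G) 0 with h0 | h0
  · have hG := eq_zero_of_frob_eq_zero h0
    have hlim : Tendsto (fun _ : ℝ => (0 : ℝ)) (𝓝[>] 0) (𝓝 (Q x G)) := by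
      rw [hG, QuadraticMap.map_zero]
      exact tendsto_const_nhds
    refine hlim.congr' ?_
    filter_upwards [h.eventually_ne_top hx G] with t ht
    rw [h0] at ht
    have h2 : (W x (1 + t • G)).toReal = 0 :=
      le_antisymm (by simpa using ht.2) ENNReal.toReal_nonneg
    rw [h2, zero_div]
  have hf : 0 < frob G := lt_of_le_of_ne (frob_nonneg G) h0.symm
  have hr : Tendsto (fun t : ℝ => rW (t * frob G)) (𝓝[>] 0) (𝓝 0) := by
    refine h.rW_tendsto.comp (tendsto_nhdsWithin_iff.2 ⟨?_, ?_⟩)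
    · have : Continuous fun t : ℝ => t * frob G := by fun_prop
      simpa using (this.tendsto 0).mono_left nhdsWithin_le_nhds
    · filter_upwards [hpos] with t ht
      exact mul_pos ht hf
  have hr2 : Tendsto (fun t : ℝ => frob G ^ 2 * (rW (t * frob G)).toReal) (𝓝[>] 0) (𝓝 0) := by
    have := (ENNReal.tendsto_toReal ENNReal.zero_ne_top).comp hr
    simpa using this.const_mul (frob G ^ 2)
  rw [tendsto_iff_norm_sub_tendsto_zero]
  refine squeeze_zero' (Eventually.of_forall fun t => norm_nonneg _) ?_ hr2
  filter_upwards [hpos, h.eventually_ne_top hx G,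
    hr.eventually_lt_const ENNReal.zero_lt_top] with t ht hW hrt
  have hexp := h.expansion x hx (t • G)
  rw [frob_smul, abs_of_pos ht] at hexp
  obtain ⟨w, hw⟩ : ∃ w : ℝ≥0, (w : ℝ≥0∞) = W x (1 + t • G) :=
    ⟨_, ENNReal.coe_toNNReal hW.1⟩
  obtain ⟨r, hr⟩ : ∃ r : ℝ≥0, (r : ℝ≥0∞) = rW (t * frob G) :=
    ⟨_, ENNReal.coe_toNNReal hrt.ne⟩
  rw [← hw, ← hr, EReal.coe_nnreal_eq_coe_real, ← EReal.coe_sub, EReal.abs_def,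
    ← ENNReal.ofReal_coe_nnreal (p := r), ← ENNReal.ofReal_mul (by positivity),
    ENNReal.ofReal_le_ofReal_iff (by positivity), QuadraticMap.map_smul, smul_eq_mul] at hexp
  rw [← hw, ← hr, ENNReal.coe_toReal, ENNReal.coe_toReal, Real.norm_eq_abs]
  have e : (w : ℝ) / t ^ 2 - Q x G = (w - t * t * Q x G) / t ^ 2 := by
    field_simp
  rw [e, abs_div, abs_of_pos (by positivity : 0 < t ^ 2), div_le_iff₀ (by positivity)]
  refine hexp.trans (le_of_eq ?_)
  ring

theorem IsStoredEnergy.le_mul {CW qW : ℝ} {rW : ℝ → ℝ≥0∞} {W : ℝ → M3 → ℝ≥0∞}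
    {Q : ℝ → QuadraticForm ℝ M3} (h : IsStoredEnergy CW qW rW W Q) {x : ℝ} (hx : x ∈ thick)
    (G : M3) : Q x G ≤ CW * frob G ^ 2 := by
  refine le_of_tendsto (h.tendsto_div hx G) ?_
  filter_upwards [h.eventually_ne_top hx G, self_mem_nhdsWithin] with t ht ht0
  have ht0' : (0 : ℝ) < t := ht0
  rw [div_le_iff₀ (by positivity)]
  linarith [ht.2]

/-- Coercivity on symmetric matrices: the distance of `I + t G` to `SO(3)` is at least
`t |G| / 2` to first order. -/
theorem IsStoredEnergy.mul_le {CW qW : ℝ} {rW : ℝ → ℝ≥0∞} {W : ℝ → M3 → ℝ≥0∞}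
    {Q : ℝ → QuadraticForm ℝ M3} (h : IsStoredEnergy CW qW rW W Q) {x : ℝ} (hx : x ∈ thick)
    {G : M3} (hG : G.IsSymm) : 1 / (4 * CW) * frob G ^ 2 ≤ Q x G := by
  have hn := frob_nonneg G
  have hlim : Tendsto (fun t : ℝ => 1 / CW * ((2 * frob G - t * frob G ^ 2) / (4 + t * frob G)) ^ 2)
      (𝓝[>] 0) (𝓝 (1 / (4 * CW) * frob G ^ 2)) := by
    have hc : ContinuousAt (fun t : ℝ =>
        1 / CW * ((2 * frob G - t * frob G ^ 2) / (4 + t * frob G)) ^ 2) 0 := by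
      refine ContinuousAt.mul continuousAt_const (ContinuousAt.pow (ContinuousAt.div ?_ ?_ ?_) 2)
      · fun_prop
      · fun_prop
      · simp
    have h2 := hc.tendsto.mono_left (nhdsWithin_le_nhds (s := Ioi 0))
    convert h2 using 2
    field_simp
    ring
  refine le_of_tendsto_of_tendsto hlim (h.tendsto_div hx G) ?_
  have hsmall : ∀ᶠ t in 𝓝[>] (0 : ℝ), t * frob G < 2 := by
    have hc : Continuous fun t : ℝ => t * frob G := by fun_prop
    have : Tendsto (fun t : ℝ => t * frob G) (𝓝[>] 0) (𝓝 0) := by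
      simpa using (hc.tendsto 0).mono_left nhdsWithin_le_nhds
    exact this.eventually_lt_const (by norm_num)
  filter_upwards [h.eventually_ne_top hx G, self_mem_nhdsWithin, hsmall] with t ht ht0 hts
  have ht0' : (0 : ℝ) < t := ht0
  have hCW := h.CW_pos
  have hnum : 0 ≤ (2 * t * frob G - t ^ 2 * frob G ^ 2) / (4 + t * frob G) := by
    refine div_nonneg ?_ (by positivity)
    nlinarith [mul_nonneg ht0'.le hn]
  have hd := le_distSqSO3 hnum fun R hR => le_frob_sub hG hR ht0'.le
  have hW : 1 / CW * distSqSO3 (1 + t • G) ≤ (W x (1 + t • G)).toReal :=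
    (ENNReal.ofReal_le_iff_le_toReal ht.1).1 (h.lower_bound x hx (1 + t • G))
  rw [le_div_iff₀ (by positivity)]
  calc 1 / CW * ((2 * frob G - t * frob G ^ 2) / (4 + t * frob G)) ^ 2 * t ^ 2
      = 1 / CW * ((2 * t * frob G - t ^ 2 * frob G ^ 2) / (4 + t * frob G)) ^ 2 := by
        field_simp
    _ ≤ 1 / CW * distSqSO3 (1 + t • G) := by gcongr
    _ ≤ _ := hW

/-- Measurability in the thickness variable is inherited from the stored energy through the limit
of difference quotients. -/
theorem IsStoredEnergy.aemeasurable {CW qW : ℝ} {rW : ℝ → ℝ≥0∞} {W : ℝ → M3 → ℝ≥0∞}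
    {Q : ℝ → QuadraticForm ℝ M3} (h : IsStoredEnergy CW qW rW W Q) (G : M3) :
    AEMeasurable (fun x => Q x G) (volume.restrict thick) := by
  refine aemeasurable_restrict_of_measurable_subtype measurableSet_Ioo ?_
  have hseq : Tendsto (fun k : ℕ => 1 / ((k : ℝ) + 1)) atTop (𝓝[>] 0) :=
    tendsto_nhdsWithin_iff.2 ⟨tendsto_one_div_add_atTop_nhds_zero_nat,
      Eventually.of_forall fun k => by simp only [mem_Ioi]; positivity⟩
  refine measurable_of_tendsto_metrizable (f := fun (k : ℕ) (x : thick) =>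
    (W x (1 + (1 / ((k : ℝ) + 1)) • G)).toReal / (1 / ((k : ℝ) + 1)) ^ 2) (fun k => ?_) ?_
  · refine Measurable.div_const ?_ _
    have : Measurable fun x : thick => W x (Matrix.of fun i j =>
        (1 + (1 / ((k : ℝ) + 1)) • G) i j) :=
      h.borel.comp (measurable_id.prodMk measurable_const)
    exact this.ennreal_toReal
  · rw [tendsto_pi_nhds]
    exact fun x => (h.tendsto_div x.2 G).comp hseq

/-! ### The effective quadratic forms -/

/-- Coordinates of symmetric `2 × 2` matrices. -/
def symMat : (Fin 3 → ℝ) →ₗ[ℝ] M2 where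
  toFun a := !![a 0, a 2; a 2, a 1]
  map_add' a b := by ext i j; fin_cases i <;> fin_cases j <;> simp
  map_smul' c a := by ext i j; fin_cases i <;> fin_cases j <;> simp

theorem symMat_apply (a : Fin 3 → ℝ) : symMat a = !![a 0, a 2; a 2, a 1] := rfl

/-- The squared Frobenius norm in the coordinates `symMat`. -/
def nsq (a : Fin 3 → ℝ) : ℝ := a 0 ^ 2 + a 1 ^ 2 + 2 * a 2 ^ 2

theorem nsq_nonneg (a : Fin 3 → ℝ) : 0 ≤ nsq a := by unfold nsq; positivity

theorem nsq_zero : nsq 0 = 0 := by simp [nsq]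

theorem nsq_pos {a : Fin 3 → ℝ} (h : a ≠ 0) : 0 < nsq a := by
  refine lt_of_le_of_ne (nsq_nonneg a) fun h0 => h ?_
  unfold nsq at h0
  have e0 : a 0 = 0 := by nlinarith [sq_nonneg (a 0), sq_nonneg (a 1), sq_nonneg (a 2)]
  have e1 : a 1 = 0 := by nlinarith [sq_nonneg (a 0), sq_nonneg (a 1), sq_nonneg (a 2)]
  have e2 : a 2 = 0 := by nlinarith [sq_nonneg (a 0), sq_nonneg (a 1), sq_nonneg (a 2)]
  ext i
  fin_cases i <;> simp [e0, e1, e2]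

theorem nsq_smul (c : ℝ) (a : Fin 3 → ℝ) : nsq (c • a) = c ^ 2 * nsq a := by
  simp only [nsq, Pi.smul_apply, smul_eq_mul]; ring

theorem nsq_neg (a : Fin 3 → ℝ) : nsq (-a) = nsq a := by
  simp only [nsq, Pi.neg_apply]; ring

theorem nsq_add_le (a b : Fin 3 → ℝ) : nsq (a + b) ≤ 2 * nsq a + 2 * nsq b := by
  simp only [nsq, Pi.add_apply]
  nlinarith [sq_nonneg (a 0 - b 0), sq_nonneg (a 1 - b 1), sq_nonneg (a 2 - b 2)]

/-- Symmetric matrices in coordinates. -/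
def symS (a : Fin 3 → ℝ) : Sym2x2 :=
  ⟨symMat a, by ext i j; fin_cases i <;> fin_cases j <;> simp [symMat_apply]⟩

theorem symS_surjective : Function.Surjective symS := by
  rintro ⟨A, hA⟩
  refine ⟨![A 0 0, A 1 1, A 0 1], Subtype.ext ?_⟩
  have h : A 1 0 = A 0 1 := hA.apply 0 1
  ext i j
  fin_cases i <;> fin_cases j <;> simp [symS, symMat_apply, h]

/-- The linear map `(A, d) ↦ ι(A) + sym(d ⊗ e₃)`. -/
def plateStrain : (Fin 3 → ℝ) × (Fin 3 → ℝ) →ₗ[ℝ] M3 where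
  toFun p := iota (symMat p.1) + symPart (Matrix.vecMulVec p.2 (Pi.single 2 1))
  map_add' p q := by
    ext i j
    fin_cases i <;> fin_cases j <;>
      simp [iota, symPart, symMat_apply, Matrix.vecMulVec_apply] <;> ring
  map_smul' c p := by
    ext i j
    fin_cases i <;> fin_cases j <;>
      simp [iota, symPart, symMat_apply, Matrix.vecMulVec_apply] <;> ring

theorem plateStrain_apply (a d : Fin 3 → ℝ) : plateStrain (a, d) =
    iota (symMat a) + symPart (Matrix.vecMulVec d (Pi.single 2 1)) := rfl

theorem plateStrain_isSymm (a d : Fin 3 → ℝ) : (plateStrain (a, d)).IsSymm := by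
  ext i j
  rw [plateStrain_apply]
  fin_cases i <;> fin_cases j <;> simp [iota, symPart, symMat_apply, Matrix.vecMulVec_apply]

theorem frob_plateStrain_sq (a d : Fin 3 → ℝ) : frob (plateStrain (a, d)) ^ 2 =
    nsq a + (d 0 ^ 2 + d 1 ^ 2) / 2 + d 2 ^ 2 := by
  rw [frob_sq, plateStrain_apply]
  simp [Fin.sum_univ_three, iota, symPart, symMat_apply, Matrix.vecMulVec_apply, nsq]
  ring

/-- `Q₂(x₃, ·)` is a quadratic form on symmetric matrices with the bounds inherited from `Q`. -/
theorem IsStoredEnergy.exists_Q2 {CW qW : ℝ} {rW : ℝ → ℝ≥0∞} {W : ℝ → M3 → ℝ≥0∞}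
    {Q : ℝ → QuadraticForm ℝ M3} (h : IsStoredEnergy CW qW rW W Q) :
    ∃ q : ℝ → QuadraticForm ℝ (Fin 3 → ℝ), (∀ x ∈ thick, ∀ a, Q2 Q x (symMat a) = q x a ∧
      1 / (4 * CW) * nsq a ≤ q x a ∧ q x a ≤ CW * nsq a) ∧
      ∀ a, AEMeasurable (fun x => q x a) (volume.restrict thick) := by
  have hCW := h.CW_pos
  have hlow : ∀ x ∈ thick, ∀ a d : Fin 3 → ℝ,
      1 / (4 * CW) * (nsq a + (d 0 ^ 2 + d 1 ^ 2) / 2 + d 2 ^ 2) ≤ Q x (plateStrain (a, d)) := by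
    intro x hx a d
    rw [← frob_plateStrain_sq]
    exact h.mul_le hx (plateStrain_isSymm a d)
  have hex : ∀ x, ∃ q : QuadraticForm ℝ (Fin 3 → ℝ), x ∈ thick → ∀ a,
      Q2 Q x (symMat a) = q a ∧ 1 / (4 * CW) * nsq a ≤ q a ∧ q a ≤ CW * nsq a := by
    intro x
    by_cases hx : x ∈ thick
    · obtain ⟨q, L, hq⟩ := QuadraticForm.exists_marginal ((Q x).comp plateStrain) (fun d hd => by
        refine lt_of_lt_of_le ?_ (hlow x hx 0 d)
        have h1 := nsq_pos hd
        unfold nsq at h1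
        have h2 : 0 < 1 / (4 * CW) := by positivity
        rw [nsq_zero]
        nlinarith [sq_nonneg (d 0), sq_nonneg (d 1), sq_nonneg (d 2), mul_pos h2 h1])
      refine ⟨q, fun _ a => ⟨iInf_eq_of_attained (hq a).1 (hq a).2, ?_, ?_⟩⟩
      · rw [(hq a).1]
        refine le_trans ?_ (hlow x hx a (L a))
        gcongr
        nlinarith [sq_nonneg (L a 0), sq_nonneg (L a 1), sq_nonneg (L a 2)]
      · refine ((hq a).2 0).trans ((h.le_mul hx _).trans (le_of_eq ?_))
        rw [frob_plateStrain_sq]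
        simp
    · exact ⟨0, fun h => absurd h hx⟩
  choose q hq using hex
  refine ⟨q, hq, fun a => ?_⟩
  obtain ⟨D, hDc, hDd⟩ := TopologicalSpace.exists_countable_dense (Fin 3 → ℝ)
  have hcnt : Countable D := hDc.to_subtype
  have hm : AEMeasurable (fun x => ⨅ d : D, Q x (plateStrain (a, d))) (volume.restrict thick) :=
    AEMeasurable.iInf fun d => h.aemeasurable _
  refine hm.congr ?_
  filter_upwards [ae_restrict_mem measurableSet_Ioo] with x hx
  rw [← (hq x hx a).1]
  refine hDd.ciInf' (f := fun d => Q x (plateStrain (a, d))) ?_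
  exact (QuadraticForm.continuous ((Q x).comp plateStrain)).comp (by fun_prop)

theorem integrable_of_le_on_thick {f : ℝ → ℝ} {C : ℝ}
    (hf : AEMeasurable f (volume.restrict thick)) (h : ∀ x ∈ thick, |f x| ≤ C) :
    Integrable f (volume.restrict thick) := by
  refine Integrable.of_bound hf.aestronglyMeasurable C ?_
  filter_upwards [ae_restrict_mem measurableSet_Ioo] with x hx
  exact h x hx

/-- The indicator `1(x₃ > 0) / 2`. -/
def halfStep (x : ℝ) : ℝ := if 0 < x then 1 / 2 else 0

theorem halfTop_symMat (x : ℝ) (a : Fin 3 → ℝ) : halfTop x (symMat a) = symMat (halfStep x • a) := by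
  unfold halfTop halfStep
  split_ifs <;> simp

theorem halfStep_nonneg (x : ℝ) : 0 ≤ halfStep x := by
  unfold halfStep; split_ifs <;> norm_num

theorem halfStep_le (x : ℝ) : halfStep x ≤ 1 / 2 := by
  unfold halfStep; split_ifs <;> norm_num

theorem measurable_halfStep : Measurable halfStep :=
  Measurable.ite measurableSet_Ioi measurable_const measurable_const

/-- The linear map `(A, M, G) ↦ x₃ A + M + 1(x₃ > 0) ½ G`. -/
def layer (x : ℝ) : ((Fin 3 → ℝ) × (Fin 3 → ℝ)) × (Fin 3 → ℝ) →ₗ[ℝ] (Fin 3 → ℝ) where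
  toFun p := x • p.1.1 + p.1.2 + halfStep x • p.2
  map_add' p q := by simp only [Prod.fst_add, Prod.snd_add, smul_add]; abel
  map_smul' c p := by
    simp only [Prod.smul_fst, Prod.smul_snd, smul_add, RingHom.id_apply, smul_comm c]

theorem layer_apply (x : ℝ) (a m g : Fin 3 → ℝ) :
    layer x ((a, m), g) = x • a + m + halfStep x • g := rfl

theorem nsq_layer_le {x : ℝ} (hx : x ∈ thick) (a m g : Fin 3 → ℝ) :
    nsq (layer x ((a, m), g)) ≤ 4 * nsq a + 4 * nsq m + 2 * nsq g := by
  rw [layer_apply]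
  have h1 := nsq_add_le (x • a + m) (halfStep x • g)
  have h2 := nsq_add_le (x • a) m
  rw [nsq_smul] at h1 h2
  have h3 : x ^ 2 ≤ 1 := by nlinarith [hx.1, hx.2]
  have h4 : halfStep x ^ 2 ≤ 1 := by nlinarith [halfStep_nonneg x, halfStep_le x]
  nlinarith [nsq_nonneg a, nsq_nonneg m, nsq_nonneg g, mul_le_of_le_one_left (nsq_nonneg a) h3,
    mul_le_of_le_one_left (nsq_nonneg g) h4]

theorem integral_thick_eq (f : ℝ → ℝ) : ∫ x in thick, f x = ∫ x in (-1 / 2 : ℝ)..(1 / 2), f x := by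
  rw [intervalIntegral.integral_of_le (by norm_num), integral_Ioc_eq_integral_Ioo]

/-- Affine functions of the thickness variable: `∫ |x₃ A + M|² = |A|² / 12 + |M|²`. -/
theorem integral_nsq_affine (a m : Fin 3 → ℝ) :
    ∫ x in thick, nsq (x • a + m) = nsq a / 12 + nsq m := by
  have e : ∀ x : ℝ, nsq (x • a + m) = nsq a * x ^ 2 +
      (2 * (a 0 * m 0 + a 1 * m 1 + 2 * (a 2 * m 2))) * x + nsq m := by
    intro x
    simp only [nsq, Pi.add_apply, Pi.smul_apply, smul_eq_mul]
    ring
  simp only [e]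
  rw [integral_thick_eq, intervalIntegral.integral_add, intervalIntegral.integral_add,
    intervalIntegral.integral_const_mul, intervalIntegral.integral_const_mul, integral_pow,
    integral_id, intervalIntegral.integral_const]
  · simp only [smul_eq_mul]
    push_cast
    ring
  all_goals exact Continuous.intervalIntegrable (by fun_prop) _ _

/-- The functional `(A, M, G) ↦ ∫ Q₂(x₃, x₃ A + M + 1(x₃ > 0) ½ G)`, which is minimized in part of
its variables to give `Q_el`, `E_res` and the correctors, is a quadratic form, coercive in
`(A, M)`. -/
theorem IsStoredEnergy.exists_plateForm {CW qW : ℝ} {rW : ℝ → ℝ≥0∞} {W : ℝ → M3 → ℝ≥0∞}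
    {Q : ℝ → QuadraticForm ℝ M3} (h : IsStoredEnergy CW qW rW W Q) :
    ∃ J : QuadraticForm ℝ (((Fin 3 → ℝ) × (Fin 3 → ℝ)) × (Fin 3 → ℝ)),
      (∀ a m g, ∫ x in thick, Q2 Q x (symMat (layer x ((a, m), g))) = J ((a, m), g)) ∧
      (∀ a m, 1 / (4 * CW) * (nsq a / 12 + nsq m) ≤ J ((a, m), 0)) ∧
      (∀ p, 0 ≤ J p) ∧ (∀ g, J ((0, 0), g) ≤ 2 * CW * nsq g) ∧
      ∀ a m g, 1 / (4 * CW) * (nsq a / 12 + nsq m) ≤ 2 * J ((a, m), g) + 1 / CW * nsq g := by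
  have hCW := h.CW_pos
  obtain ⟨q, hq, hqm⟩ := h.exists_Q2
  have hlm : ∀ p, ∀ i, Measurable fun x => layer x p i := by
    intro p i
    change Measurable fun x => x * p.1.1 i + p.1.2 i + halfStep x * p.2 i
    have := measurable_halfStep
    fun_prop
  have hq0 : ∀ x ∈ thick, ∀ a, 0 ≤ q x a := fun x hx a =>
    (mul_nonneg (by positivity) (nsq_nonneg a)).trans (hq x hx a).2.1
  have hint : ∀ p, Integrable (fun x => q x (layer x p)) (volume.restrict thick) := by
    rintro ⟨⟨a, m⟩, g⟩
    refine integrable_of_le_on_thick (C := CW * (4 * nsq a + 4 * nsq m + 2 * nsq g))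
      (QuadraticForm.aemeasurable_apply hqm (hlm _)) fun x hx => ?_
    rw [abs_of_nonneg (hq0 x hx _)]
    exact (hq x hx _).2.2.trans (by gcongr; exact nsq_layer_le hx a m g)
  have hnint : ∀ p, Integrable (fun x => nsq (layer x p)) (volume.restrict thick) := by
    rintro ⟨⟨a, m⟩, g⟩
    refine integrable_of_le_on_thick (C := 4 * nsq a + 4 * nsq m + 2 * nsq g)
      (Measurable.aemeasurable ?_) fun x hx => ?_
    · have := hlm ((a, m), g)
      unfold nsq
      exact ((((this 0).pow_const 2).add ((this 1).pow_const 2)).add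
        (((this 2).pow_const 2).const_mul 2))
    · rw [abs_of_nonneg (nsq_nonneg _)]
      exact nsq_layer_le hx a m g
  obtain ⟨J, hJ⟩ := QuadraticForm.exists_integral (volume.restrict thick)
    (fun x => (q x).comp (layer x)) hint
  have hJ' : ∀ p, J p = ∫ x in thick, q x (layer x p) := hJ
  have hvol : (volume.restrict thick).real univ = 1 := by
    simp [Measure.real]
    norm_num
  have hJn : ∀ p, 0 ≤ J p := fun p => by
    rw [hJ']
    exact setIntegral_nonneg measurableSet_Ioo fun x hx => hq0 x hx _
  have hlow : ∀ p, 1 / (4 * CW) * ∫ x in thick, nsq (layer x p) ≤ J p := by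
    intro p
    rw [hJ', ← integral_const_mul]
    exact setIntegral_mono_on ((hnint p).const_mul _) (hint p) measurableSet_Ioo
      fun x hx => (hq x hx _).2.1
  refine ⟨J, fun a m g => ?_, fun a m => ?_, hJn, fun g => ?_, fun a m g => ?_⟩
  · rw [hJ']
    exact setIntegral_congr_fun measurableSet_Ioo fun x hx => (hq x hx _).1
  · refine le_trans (le_of_eq ?_) (hlow _)
    rw [← integral_nsq_affine]
    simp [layer_apply]
  · rw [hJ']
    calc ∫ x in thick, q x (layer x ((0, 0), g)) ≤ ∫ x in thick, 2 * CW * nsq g := by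
          refine setIntegral_mono_on (hint _) (integrable_const _) measurableSet_Ioo
            fun x hx => (hq x hx _).2.2.trans ?_
          have := nsq_layer_le hx 0 0 g
          rw [nsq_zero] at this
          nlinarith
      _ = 2 * CW * nsq g := by
          rw [integral_const, hvol, one_smul]
  · have h1 : ∫ x in thick, nsq (x • a + m) ≤
        ∫ x in thick, (2 * nsq (layer x ((a, m), g)) + nsq g) := by
      refine setIntegral_mono_on ?_ (((hnint _).const_mul 2).add (integrable_const _))
        measurableSet_Ioo fun x hx => ?_
      · refine (hnint ((a, m), 0)).congr (Eventually.of_forall fun x => ?_)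
        simp [layer_apply]
      · have e : x • a + m = layer x ((a, m), g) + (-halfStep x) • g := by
          rw [layer_apply, neg_smul]
          abel
        rw [e]
        refine (nsq_add_le _ _).trans ?_
        rw [nsq_smul, neg_sq]
        have h4 : 2 * halfStep x ^ 2 ≤ 1 := by nlinarith [halfStep_nonneg x, halfStep_le x]
        nlinarith [mul_le_of_le_one_left (nsq_nonneg g) h4]
    rw [integral_nsq_affine, integral_add ((hnint _).const_mul 2) (integrable_const _),
      integral_const_mul, integral_const, hvol, one_smul] at h1
    have h2 := hlow ((a, m), g)
    calc 1 / (4 * CW) * (nsq a / 12 + nsq m)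
        ≤ 1 / (4 * CW) * (2 * (∫ x in thick, nsq (layer x ((a, m), g))) + nsq g) := by gcongr
      _ = 2 * (1 / (4 * CW) * ∫ x in thick, nsq (layer x ((a, m), g))) + 1 / (4 * CW) * nsq g := by
          ring
      _ ≤ 2 * J ((a, m), g) + 1 / CW * nsq g := by
          have h3 : 1 / (4 * CW) ≤ 1 / CW :=
            one_div_le_one_div_of_le hCW (by linarith)
          have h4 := mul_le_mul_of_nonneg_right h3 (nsq_nonneg g)
          linarith

/-- The coordinates of the basis `G₁, G₂, G₃`. -/
def basisCoord : Fin 3 → Fin 3 → ℝ := ![![1, 0, 0], ![0, 1, 0], ![0, 0, 1 / Real.sqrt 2]]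

theorem symMat_basisCoord (i : Fin 3) : symMat (basisCoord i) = basisG i := by
  fin_cases i <;> simp [symMat_apply, basisCoord, basisG]

theorem nsq_basisCoord (i : Fin 3) : nsq (basisCoord i) = 1 := by
  fin_cases i <;> simp [nsq, basisCoord]

theorem trace_symMat_basisG (u : Fin 3 → ℝ) (i : Fin 3) :
    ((symMat u).transpose * basisG i).trace = ![u 0, u 1, Real.sqrt 2 * u 2] i := by
  have h2 : u 2 * (Real.sqrt 2)⁻¹ + u 2 * (Real.sqrt 2)⁻¹ = Real.sqrt 2 * u 2 := by
    have h3 : Real.sqrt 2 * Real.sqrt 2 = 2 := Real.mul_self_sqrt (by norm_num)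
    have h4 : Real.sqrt 2 ≠ 0 := by positivity
    field_simp
    linear_combination -u 2 * h3
  fin_cases i <;> simp [symMat_apply, basisG, Matrix.trace, Matrix.mul_apply, Fin.sum_univ_two, h2]

/-- The effective quantities in coordinates: `Q_el` and `E_res` are quadratic forms, `𝔹` is linear,
and they satisfy bounds depending only on `C_W`. The constant `48` is the product of the factor `4`
in the coercivity of `Q` and of the factor `12 = (∫ x₃²)⁻¹`. -/
theorem IsStoredEnergy.exists_effective {CW qW : ℝ} {rW : ℝ → ℝ≥0∞} {W : ℝ → M3 → ℝ≥0∞}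
    {Q : ℝ → QuadraticForm ℝ M3} (h : IsStoredEnergy CW qW rW W Q) :
    ∃ (qel qres : QuadraticForm ℝ (Fin 3 → ℝ)) (β : (Fin 3 → ℝ) →ₗ[ℝ] (Fin 3 → ℝ)),
      (∀ a, Qel Q (symMat a) = qel a) ∧ (∀ u, Eres Q (symMat u) = qres u) ∧
      (∀ u, BB Q (symMat u) = symMat (β u)) ∧ (∀ a, 1 / (48 * CW) * nsq a ≤ qel a) ∧
      (∀ u, 0 ≤ qres u) ∧ ∀ u, nsq (β u) ≤ 4 * (48 * (4 * CW ^ 2 + 1)) * nsq u := by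
  have hCW := h.CW_pos
  obtain ⟨J, hJ, hJlow, hJn, hJup, hJmix⟩ := h.exists_plateForm
  have hc0 : 0 < 1 / (4 * CW) := by positivity
  -- the bending form
  obtain ⟨qel, L1, hqel⟩ := QuadraticForm.exists_marginal
    (J.comp (LinearMap.inl ℝ ((Fin 3 → ℝ) × (Fin 3 → ℝ)) (Fin 3 → ℝ))) (fun m hm => by
      refine lt_of_lt_of_le ?_ (hJlow 0 m)
      rw [nsq_zero]
      have := nsq_pos hm
      positivity)
  have hel : ∀ a, Qel Q (symMat a) = qel a := by
    intro a
    rw [Qel, ← symS_surjective.iInf_comp]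
    refine iInf_eq_of_attained (i := L1 a) ?_ fun m => ?_
    · rw [(hqel a).1]
      refine (hJ a (L1 a) 0).symm.trans
        (integral_congr_ae (Eventually.of_forall fun x => ?_))
      simp [layer_apply, symS]
    · refine ((hqel a).2 m).trans (le_of_eq ?_)
      refine (hJ a m 0).symm.trans
        (integral_congr_ae (Eventually.of_forall fun x => ?_))
      simp [layer_apply, symS]
  -- the residual form
  obtain ⟨qres, L2, hqres⟩ := QuadraticForm.exists_marginal
    (J.comp (LinearEquiv.prodComm ℝ (Fin 3 → ℝ) ((Fin 3 → ℝ) × (Fin 3 → ℝ))).toLinearMap)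
    (fun p hp => by
      refine lt_of_lt_of_le ?_ (hJlow p.1 p.2)
      have h1 := nsq_nonneg p.1
      have h2 := nsq_nonneg p.2
      refine mul_pos hc0 ?_
      by_cases h0 : p.1 = 0
      · have : p.2 ≠ 0 := fun h3 => hp (Prod.ext h0 h3)
        linarith [nsq_pos this]
      · linarith [nsq_pos h0])
  have hsurj : Function.Surjective (Prod.map symS symS) := symS_surjective.prodMap symS_surjective
  have hres : ∀ u, Eres Q (symMat u) = qres u := by
    intro u
    rw [Eres, ← hsurj.iInf_comp]
    have key : ∀ p : (Fin 3 → ℝ) × (Fin 3 → ℝ), ∫ x in thick, Q2 Q x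
        (x • (Prod.map symS symS p).1.1 + (Prod.map symS symS p).2.1 + halfTop x (symMat u)) =
        J (p, u) := by
      intro p
      obtain ⟨a, m⟩ := p
      rw [← hJ a m u]
      refine integral_congr_ae (Eventually.of_forall fun x => ?_)
      simp [layer_apply, symS, halfTop_symMat]
    refine iInf_eq_of_attained (i := L2 u) ?_ fun p => ?_
    · rw [key, (hqres u).1]
      rfl
    · rw [key]
      exact (hqres u).2 p
  -- the correctors
  have hcorr : ∀ g a m : Fin 3 → ℝ,
      corrector Q (symMat g) (symS a, symS m) = J ((-a, -m), g) := by
    intro g a m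
    rw [← hJ]
    unfold corrector
    refine integral_congr_ae (Eventually.of_forall fun x => ?_)
    simp only [symS, halfTop_symMat, layer_apply]
    congr 1
    simp only [map_add, map_smul, map_neg, smul_neg]
    abel
  have hmin : ∀ g : Fin 3 → ℝ, ∃ a : Fin 3 → ℝ, (correctorMin Q (symMat g)).1.1 = symMat a ∧
      nsq a ≤ 48 * (4 * CW ^ 2 + 1) * nsq g := by
    intro g
    have hex : ∃ p, ∀ p', corrector Q (symMat g) p ≤ corrector Q (symMat g) p' := by
      refine ⟨(symS (-(L2 g).1), symS (-(L2 g).2)), fun p' => ?_⟩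
      obtain ⟨⟨a, m⟩, rfl⟩ := hsurj p'
      rw [Prod.map_apply, hcorr, hcorr, neg_neg, neg_neg]
      exact ((hqres g).1.symm.trans_le ((hqres g).2 (-a, -m)))
    have hspec : ∀ p', corrector Q (symMat g) (correctorMin Q (symMat g)) ≤
        corrector Q (symMat g) p' := Classical.epsilon_spec hex
    obtain ⟨⟨a, m⟩, ham⟩ := hsurj (correctorMin Q (symMat g))
    rw [Prod.map_apply] at ham
    refine ⟨a, by rw [← ham]; rfl, ?_⟩
    have h1 := hspec (symS 0, symS 0)
    rw [← ham, hcorr, hcorr, neg_zero] at h1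
    have h2 := h1.trans (hJup g)
    have h3 := hJmix (-a) (-m) g
    rw [nsq_neg, nsq_neg] at h3
    have h4 : 1 / (4 * CW) * (nsq a / 12 + nsq m) ≤ 4 * CW * nsq g + 1 / CW * nsq g := by linarith
    have h5 : nsq a / 12 + nsq m ≤ 4 * CW * (4 * CW * nsq g + 1 / CW * nsq g) := by
      rw [one_div, inv_mul_le_iff₀ (by positivity)] at h4
      exact h4
    have h6 : 4 * CW * (4 * CW * nsq g + 1 / CW * nsq g) = 4 * (4 * CW ^ 2 + 1) * nsq g := by
      field_simp
    linarith [nsq_nonneg m]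
  choose A hA1 hA2 using fun i => hmin (basisCoord i)
  set coef : (Fin 3 → ℝ) →ₗ[ℝ] (Fin 3 → ℝ) :=
    { toFun := fun u => ![u 0, u 1, Real.sqrt 2 * u 2]
      map_add' := fun u v => by ext i; fin_cases i <;> simp [mul_add]
      map_smul' := fun c u => by ext i; fin_cases i <;> simp [mul_left_comm] } with hcoef
  set β : (Fin 3 → ℝ) →ₗ[ℝ] (Fin 3 → ℝ) :=
    ∑ i, (LinearMap.toSpanSingleton ℝ (Fin 3 → ℝ) (A i)) ∘ₗ (LinearMap.proj i) ∘ₗ coef with hβ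
  have hβa : ∀ u, β u = ∑ i, ![u 0, u 1, Real.sqrt 2 * u 2] i • A i := by
    intro u
    simp [hβ, hcoef]
  refine ⟨qel, qres, β, hel, hres, fun u => ?_, fun a => ?_, fun u => ?_, fun u => ?_⟩
  · rw [BB, hβa, map_sum]
    refine Finset.sum_congr rfl fun i _ => ?_
    rw [map_smul, ← hA1, symMat_basisCoord, trace_symMat_basisG]
  · rw [(hqel a).1]
    refine le_trans ?_ (hJlow a (L1 a))
    have h1 := nsq_nonneg (L1 a)
    calc 1 / (48 * CW) * nsq a = 1 / (4 * CW) * (nsq a / 12) := by field_simp; ring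
      _ ≤ _ := by gcongr; linarith
  · rw [(hqres u).1]
    exact hJn _
  · have hK : ∀ i, nsq (A i) ≤ 48 * (4 * CW ^ 2 + 1) := fun i => by
      simpa [nsq_basisCoord] using hA2 i
    rw [hβa, Fin.sum_univ_three]
    have h1 := nsq_add_le (![u 0, u 1, Real.sqrt 2 * u 2] 0 • A 0 +
      ![u 0, u 1, Real.sqrt 2 * u 2] 1 • A 1) (![u 0, u 1, Real.sqrt 2 * u 2] 2 • A 2)
    have h2 := nsq_add_le (![u 0, u 1, Real.sqrt 2 * u 2] 0 • A 0)
      (![u 0, u 1, Real.sqrt 2 * u 2] 1 • A 1)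
    simp only [nsq_smul, Matrix.cons_val, mul_pow, Real.sq_sqrt zero_le_two] at h1 h2
    have e0 := mul_le_mul_of_nonneg_left (hK 0) (sq_nonneg (u 0))
    have e1 := mul_le_mul_of_nonneg_left (hK 1) (sq_nonneg (u 1))
    have e2 := mul_le_mul_of_nonneg_left (hK 2) (by positivity : 0 ≤ 2 * u 2 ^ 2)
    simp only [Matrix.cons_val]
    have hpos : 0 ≤ 48 * (4 * CW ^ 2 + 1) := by positivity
    have e3 := mul_nonneg hpos (sq_nonneg (u 2))
    unfold nsq at h1 h2 e0 e1 e2 ⊢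
    linarith

/-! ### The elastic energy as a quadratic form on `L²` -/

/-- The second fundamental form in coordinates. -/
def bendingCoord {S : Set E2} (y : H2 S) (x : E2) : Fin 3 → ℝ :=
  ![II y x 0 0, II y x 1 1, II y x 0 1]

/-- The eigenstrain in coordinates. -/
def eigenCoord {S : Set E2} (y : H2 S) (n : H1 S) (x : E2) : Fin 3 → ℝ :=
  ![1 / 3 - localDirector y n x 0 ^ 2, 1 / 3 - localDirector y n x 1 ^ 2,
    - (localDirector y n x 0 * localDirector y n x 1)]

/-- The second fundamental form and the eigenstrain in coordinates. -/
def strainField {S : Set E2} (y : H2 S) (n : H1 S) (x : E2) : Fin 3 ⊕ Fin 3 → ℝ :=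
  Sum.elim (bendingCoord y x) (eigenCoord y n x)

theorem eigenstrain_eq {S : Set E2} (y : H2 S) (n : H1 S) (x : E2) :
    eigenstrain y n x = symMat (eigenCoord y n x) := by
  ext i j
  fin_cases i <;> fin_cases j <;>
    simp [eigenstrain, symMat_apply, eigenCoord, Matrix.vecMulVec_apply, sq, mul_comm]

theorem II_eq {S : Set E2} (hS : IsOpen S) {q : H2 S × H1 S} (hq : q ∈ A2 S) :
    ∀ᵐ x ∂(volume.restrict S), II q.1 x = symMat (bendingCoord q.1 x) := by
  filter_upwards [II_ae hS hq] with x hx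
  have h := (hx 1 0).2.2
  ext i j
  fin_cases i <;> fin_cases j <;> simp [symMat_apply, bendingCoord, h]

theorem sum_hess_sq {S : Set E2} (hS : IsOpen S) {q : H2 S × H1 S} (hq : q ∈ A2 S) :
    ∀ᵐ x ∂(volume.restrict S), ∑ i, ∑ j, ‖q.1.hess i j x‖ ^ 2 = nsq (bendingCoord q.1 x) := by
  filter_upwards [II_ae hS hq] with x hx
  have h := (hx 1 0).2.2
  simp only [Fin.sum_univ_two, (hx _ _).2.1, nsq, bendingCoord, Matrix.cons_val, h]
  ring

theorem abs_localDirector_le {S : Set E2} {q : H2 S × H1 S} (hq : q ∈ A2 S) :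
    ∀ᵐ x ∂(volume.restrict S), ∀ i, |localDirector q.1 q.2 x i| ≤ 1 := by
  filter_upwards [ae_all_iff.2 (H2.norm_grad hq), hq.2] with x h1 h2 i
  refine (abs_real_inner_le_norm _ _).trans ?_
  rw [h1, h2, one_mul]

theorem abs_eigenCoord_le {S : Set E2} {q : H2 S × H1 S} (hq : q ∈ A2 S) :
    ∀ᵐ x ∂(volume.restrict S), ∀ i, |eigenCoord q.1 q.2 x i| ≤ 1 := by
  filter_upwards [abs_localDirector_le hq] with x hx i
  have h0 := abs_le.1 (hx 0)
  have h1 := abs_le.1 (hx 1)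
  have hsq : ∀ i, localDirector q.1 q.2 x i ^ 2 ≤ 1 := fun i => (sq_le_one_iff_abs_le_one _).2 (hx i)
  fin_cases i
  · simp only [eigenCoord, Fin.zero_eta, Matrix.cons_val]
    exact abs_le.2 ⟨by linarith [hsq 0], by linarith [sq_nonneg (localDirector q.1 q.2 x 0)]⟩
  · simp only [eigenCoord, Fin.mk_one, Matrix.cons_val]
    exact abs_le.2 ⟨by linarith [hsq 1], by linarith [sq_nonneg (localDirector q.1 q.2 x 1)]⟩
  · simp only [eigenCoord, Fin.reduceFinMk, Matrix.cons_val]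
    rw [abs_neg, abs_mul]
    exact mul_le_one₀ (hx 0) (abs_nonneg _) (hx 1)

theorem L2.aestronglyMeasurable {S : Set E2} (u : L2 S) :
    AEStronglyMeasurable (u : E2 → E3) (volume.restrict S) := (Lp.memLp u).1

theorem aestronglyMeasurable_normal {S : Set E2} (y : H2 S) :
    AEStronglyMeasurable (normal y) (volume.restrict S) :=
  (integrable_cross (y.grad 0) (y.grad 1)).1

theorem aestronglyMeasurable_localDirector {S : Set E2} (y : H2 S) (n : H1 S) (i : Fin 2) :
    AEStronglyMeasurable (fun x => localDirector y n x i) (volume.restrict S) :=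
  (L2.aestronglyMeasurable (y.grad i)).inner (L2.aestronglyMeasurable n.fn)

theorem aestronglyMeasurable_eigenCoord {S : Set E2} (y : H2 S) (n : H1 S) (i : Fin 3) :
    AEStronglyMeasurable (fun x => eigenCoord y n x i) (volume.restrict S) := by
  have h := aestronglyMeasurable_localDirector y n
  fin_cases i
  · exact aestronglyMeasurable_const.sub ((h 0).pow 2)
  · exact aestronglyMeasurable_const.sub ((h 1).pow 2)
  · exact ((h 0).mul (h 1)).neg

theorem memLp_II {S : Set E2} (hS : IsOpen S) {q : H2 S × H1 S} (hq : q ∈ A2 S) (i j : Fin 2) :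
    MemLp (fun x => II q.1 x i j) 2 (volume.restrict S) := by
  have h1 : MemLp (fun x => - inner ℝ (q.1.hess i j x) (normal q.1 x)) 2 (volume.restrict S) := by
    refine (Lp.memLp (q.1.hess i j)).mono
      ((L2.aestronglyMeasurable _).inner (aestronglyMeasurable_normal q.1)).neg ?_
    filter_upwards [norm_normal hq] with x hx
    rw [norm_neg]
    refine (norm_inner_le_norm _ _).trans ?_
    rw [hx, mul_one]
  refine h1.ae_eq ?_
  filter_upwards [II_ae hS hq] with x hx
  exact (hx i j).1.symm

theorem memLp_strainField {S : Set E2} (hS : IsOpen S) (hfin : volume S ≠ ⊤) {q : H2 S × H1 S}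
    (hq : q ∈ A2 S) (i : Fin 3 ⊕ Fin 3) :
    MemLp (fun x => strainField q.1 q.2 x i) 2 (volume.restrict S) := by
  have : IsFiniteMeasure (volume.restrict S) := ⟨by simpa using hfin.lt_top⟩
  rcases i with i | i
  · fin_cases i
    · exact memLp_II hS hq 0 0
    · exact memLp_II hS hq 1 1
    · exact memLp_II hS hq 0 1
  · refine MemLp.of_bound (aestronglyMeasurable_eigenCoord q.1 q.2 i) 1 ?_
    filter_upwards [abs_eigenCoord_le hq] with x hx
    exact hx i

/-- The elastic energy density is a nonnegative quadratic form in the second fundamental form and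
the eigenstrain, coercive in the first up to a bounded term. -/
theorem IsStoredEnergy.exists_density {CW qW : ℝ} {rW : ℝ → ℝ≥0∞} {W : ℝ → M3 → ℝ≥0∞}
    {Q : ℝ → QuadraticForm ℝ M3} (h : IsStoredEnergy CW qW rW W Q) (rbar : ℝ) :
    ∃ P : QuadraticForm ℝ (Fin 3 ⊕ Fin 3 → ℝ), (∀ w, 0 ≤ P w) ∧
      (∀ a u, nsq a ≤ 96 * CW * P (Sum.elim a u) +
        8 * rbar ^ 2 * (48 * (4 * CW ^ 2 + 1)) * nsq u) ∧
      ∀ (S : Set E2), IsOpen S → ∀ q ∈ A2 S, ∀ᵐ x ∂(volume.restrict S),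
        elDensity Q rbar q.1 q.2 x = P (strainField q.1 q.2 x) := by
  have hCW := h.CW_pos
  obtain ⟨qel, qres, β, hel, hres, hβ, hlow, hnn, hβle⟩ := h.exists_effective
  set l1 : (Fin 3 ⊕ Fin 3 → ℝ) →ₗ[ℝ] (Fin 3 → ℝ) := LinearMap.funLeft ℝ ℝ Sum.inl
  set l2 : (Fin 3 ⊕ Fin 3 → ℝ) →ₗ[ℝ] (Fin 3 → ℝ) := LinearMap.funLeft ℝ ℝ Sum.inr
  have e1 : ∀ a u : Fin 3 → ℝ, l1 (Sum.elim a u) = a := fun a u => rfl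
  have e2 : ∀ a u : Fin 3 → ℝ, l2 (Sum.elim a u) = u := fun a u => rfl
  set P : QuadraticForm ℝ (Fin 3 ⊕ Fin 3 → ℝ) :=
    qel.comp (l1 + rbar • β ∘ₗ l2) + rbar ^ 2 • qres.comp l2 with hP
  have hPe : ∀ w, P w = qel (l1 w + rbar • β (l2 w)) + rbar ^ 2 * qres (l2 w) := fun w => by
    simp [hP]
  have hqn : ∀ a, 0 ≤ qel a := fun a =>
    (mul_nonneg (by positivity) (nsq_nonneg a)).trans (hlow a)
  refine ⟨P, fun w => ?_, fun a u => ?_, fun S hS q hq => ?_⟩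
  · rw [hPe]
    exact add_nonneg (hqn _) (mul_nonneg (sq_nonneg _) (hnn _))
  · rw [hPe, e1, e2]
    have h1 : a = (a + rbar • β u) + (-rbar) • β u := by
      rw [neg_smul]; abel
    have h2 := nsq_add_le (a + rbar • β u) ((-rbar) • β u)
    rw [← h1, nsq_smul, neg_sq] at h2
    have h3 := hlow (a + rbar • β u)
    have h4 : nsq (a + rbar • β u) ≤ 48 * CW * qel (a + rbar • β u) := by
      rw [one_div, inv_mul_le_iff₀ (by positivity)] at h3
      exact h3
    have h5 := mul_le_mul_of_nonneg_left (hβle u) (sq_nonneg rbar)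
    have h6 : 0 ≤ CW * (rbar ^ 2 * qres u) :=
      mul_nonneg hCW.le (mul_nonneg (sq_nonneg _) (hnn u))
    nlinarith
  · filter_upwards [II_eq hS hq] with x hx
    rw [elDensity, eigenstrain_eq, hx, hβ, ← map_smul, ← map_add, hel, hres, hPe]
    rfl

theorem integrable_quadratic {ι : Type*} [Fintype ι] [DecidableEq ι]
    (P : QuadraticForm ℝ (ι → ℝ)) {μ : Measure E2} {z : E2 → ι → ℝ}
    (hz : ∀ i, MemLp (fun x => z x i) 2 μ) : Integrable (fun x => P (z x)) μ := by
  simp only [QuadraticForm.expand]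
  exact integrable_finsetSum _ fun i _ => integrable_finsetSum _ fun j _ =>
    ((hz i).integrable_mul (hz j)).const_mul _

theorem norm_sq_eq_integral {S : Set E2} (u : L2 S) : ‖u‖ ^ 2 = ∫ x in S, ‖u x‖ ^ 2 := by
  rw [← real_inner_self_eq_norm_sq, MeasureTheory.L2.inner_def]
  simp only [real_inner_self_eq_norm_sq]

theorem integrable_norm_sq {S : Set E2} (u : L2 S) :
    Integrable (fun x => ‖u x‖ ^ 2) (volume.restrict S) :=
  (Lp.memLp u).integrable_norm_pow two_ne_zero

theorem integral_hess_eq {S : Set E2} (y : H2 S) :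
    ∫ x in S, ∑ i, ∑ j, ‖y.hess i j x‖ ^ 2 = ∑ i, ∑ j, ‖y.hess i j‖ ^ 2 := by
  rw [integral_finsetSum _ fun i _ => integrable_finsetSum _ fun j _ =>
    integrable_norm_sq (y.hess i j)]
  refine Finset.sum_congr rfl fun i _ => ?_
  rw [integral_finsetSum _ fun j _ => integrable_norm_sq (y.hess i j)]
  exact Finset.sum_congr rfl fun j _ => (norm_sq_eq_integral _).symm

theorem EOF_eq {S : Set E2} (n : H1 S) : EOF n = 1 / 2 * ∑ i, ‖n.grad i‖ ^ 2 := by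
  rw [EOF, integral_finsetSum _ fun i _ => integrable_norm_sq (n.grad i)]
  congr 1
  exact Finset.sum_congr rfl fun i _ => (norm_sq_eq_integral _).symm

theorem EOF_nonneg {S : Set E2} (n : H1 S) : 0 ≤ EOF n := by
  rw [EOF_eq]; positivity

/-- The a priori estimate: the second derivatives of an isometry are the second fundamental form,
which is controlled by the elastic energy. -/
theorem IsStoredEnergy.apriori {CW qW : ℝ} {rW : ℝ → ℝ≥0∞} {W : ℝ → M3 → ℝ≥0∞}
    {Q : ℝ → QuadraticForm ℝ M3} (h : IsStoredEnergy CW qW rW W Q) (rbar : ℝ) {S : Set E2}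
    (hS : IsOpen S) (hfin : volume S ≠ ⊤) {q : H2 S × H1 S} (hq : q ∈ A2 S) :
    IntegrableOn (elDensity Q rbar q.1 q.2) S ∧ 0 ≤ Eel Q rbar q.1 q.2 ∧
      ∑ i, ∑ j, ‖q.1.hess i j‖ ^ 2 ≤ 96 * CW * Eel Q rbar q.1 q.2 +
        8 * rbar ^ 2 * (48 * (4 * CW ^ 2 + 1)) * 4 * (volume S).toReal := by
  obtain ⟨P, hP0, hPlow, hP⟩ := h.exists_density rbar
  have hae := hP S hS q hq
  have hint := integrable_quadratic P (memLp_strainField hS hfin hq)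
  have hE : Eel Q rbar q.1 q.2 = ∫ x in S, P (strainField q.1 q.2 x) := integral_congr_ae hae
  have : IsFiniteMeasure (volume.restrict S) := ⟨by simpa using hfin.lt_top⟩
  refine ⟨hint.congr (hae.mono fun x hx => hx.symm), ?_, ?_⟩
  · rw [hE]
    exact integral_nonneg fun x => hP0 _
  · set D := 8 * rbar ^ 2 * (48 * (4 * CW ^ 2 + 1)) * 4 with hD
    have e : D * (volume S).toReal = ∫ _ in S, D := by
      rw [setIntegral_const, smul_eq_mul, mul_comm]
      rfl
    rw [← integral_hess_eq, hE, ← integral_const_mul, e,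
      ← integral_add (hint.const_mul _) (integrable_const _)]
    refine integral_mono_ae (integrable_finsetSum _ fun i _ => integrable_finsetSum _ fun j _ =>
      integrable_norm_sq (q.1.hess i j)) ((hint.const_mul _).add (integrable_const _)) ?_
    filter_upwards [sum_hess_sq hS hq, abs_eigenCoord_le hq] with x hx hu
    rw [hx]
    refine (hPlow _ (eigenCoord q.1 q.2 x)).trans ?_
    have hu4 : nsq (eigenCoord q.1 q.2 x) ≤ 4 := by
      have h0 := (sq_le_one_iff_abs_le_one _).2 (hu 0)
      have h1 := (sq_le_one_iff_abs_le_one _).2 (hu 1)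
      have h2 := (sq_le_one_iff_abs_le_one _).2 (hu 2)
      unfold nsq
      linarith
    have hpos : 0 ≤ 8 * rbar ^ 2 * (48 * (4 * CW ^ 2 + 1)) := by positivity
    have := mul_le_mul_of_nonneg_left hu4 hpos
    simp only [strainField]
    linarith

/-! ### Convergence of the strains -/

theorem tendsto_eLpNorm_of_dominated {F : Type*} [NormedAddCommGroup F] {μ : Measure E2}
    {f : ℕ → E2 → F} {d : E2 → ℝ} (hf : ∀ k, AEStronglyMeasurable (f k) μ) (hd : MemLp d 2 μ)
    (hb : ∀ k, ∀ᵐ x ∂μ, ‖f k x‖ ≤ d x)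
    (hl : ∀ᵐ x ∂μ, Tendsto (fun k => f k x) atTop (𝓝 0)) :
    Tendsto (fun k => eLpNorm (f k) 2 μ) atTop (𝓝 0) := by
  have h : Tendsto (fun k => eLpNorm (f k) 2 μ ^ 2) atTop (𝓝 0) := by
    simp only [eLpNorm_two_sq]
    rw [← lintegral_zero (μ := μ)]
    refine tendsto_lintegral_of_dominated_convergence' (fun x => ‖d x‖ₑ ^ 2)
      (fun k => (hf k).enorm.pow_const 2) (fun k => ?_) ?_ ?_
    · filter_upwards [hb k] with x hx
      gcongr
      exact enorm_le_iff_norm_le.2 (hx.trans (le_abs_self _))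
    · rw [← eLpNorm_two_sq]
      exact ENNReal.pow_ne_top hd.2.ne
    · filter_upwards [hl] with x hx
      have := (ENNReal.continuous_pow 2).tendsto _ |>.comp hx.enorm
      simpa [Function.comp_def] using this
  exact tendsto_zero_of_sq h

theorem L2.exists_subseq_ae {S : Set E2} {u : ℕ → L2 S} {v : L2 S}
    (h : Tendsto u atTop (𝓝 v)) : ∃ φ : ℕ → ℕ, StrictMono φ ∧
      ∀ᵐ x ∂(volume.restrict S), Tendsto (fun k => u (φ k) x) atTop (𝓝 (v x)) :=
  (tendstoInMeasure_of_tendsto_Lp h).exists_seq_tendsto_ae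

/-- The integral of a nonnegative quadratic form is weakly lower semicontinuous on `L²`, because
`P z ≥ P w + polar P w (z - w)` and the last term is weakly continuous in `z`. -/
theorem integral_quadratic_le_of_weak {ι : Type*} [Fintype ι] [DecidableEq ι]
    (P : QuadraticForm ℝ (ι → ℝ)) (hP : ∀ w, 0 ≤ P w) {μ : Measure E2} {z : ℕ → E2 → ι → ℝ}
    {w : E2 → ι → ℝ} (hz : ∀ k i, MemLp (fun x => z k x i) 2 μ)
    (hw : ∀ i, MemLp (fun x => w x i) 2 μ)
    (hweak : ∀ (i : ι) (f : E2 → ℝ), MemLp f 2 μ →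
      Tendsto (fun k => ∫ x, f x * z k x i ∂μ) atTop (𝓝 (∫ x, f x * w x i ∂μ)))
    {c : ℝ} (hc : ∀ k, ∫ x, P (z k x) ∂μ ≤ c) : ∫ x, P (w x) ∂μ ≤ c := by
  set b : ι → ι → ℝ := fun i j => QuadraticMap.polar P (Pi.single j 1) (Pi.single i 1) with hb
  set f : ι → E2 → ℝ := fun i x => ∑ j, b i j * w x j with hf
  have hfm : ∀ i, MemLp (f i) 2 μ := fun i =>
    memLp_finsetSum _ fun j _ => (hw j).const_mul (b i j)
  have hpol : ∀ x (v : ι → ℝ), QuadraticMap.polarBilin P (w x) v = ∑ i, f i x * v i := fun x v => by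
    rw [LinearMap.pi_apply_eq_sum_univ]
    refine Finset.sum_congr rfl fun i _ => ?_
    rw [smul_eq_mul, mul_comm]
    congr 1
    change (QuadraticMap.polarBilin P).flip _ (w x) = _
    rw [LinearMap.pi_apply_eq_sum_univ]
    refine Finset.sum_congr rfl fun j _ => ?_
    rw [smul_eq_mul, mul_comm]
    simp only [hb, LinearMap.flip_apply, QuadraticMap.polarBilin_apply_apply]
    congr 2 <;> (ext l; simp [Pi.single_apply, eq_comm])
  have hineq : ∀ k x, P (w x) + ∑ i, (f i x * z k x i - f i x * w x i) ≤ P (z k x) := fun k x => by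
    have h1 := QuadraticMap.map_add P (w x) (z k x - w x)
    rw [add_sub_cancel, ← QuadraticMap.polarBilin_apply_apply, hpol] at h1
    have h2 := hP (z k x - w x)
    have h3 : ∑ i, f i x * (z k x - w x) i = ∑ i, (f i x * z k x i - f i x * w x i) :=
      Finset.sum_congr rfl fun i _ => by rw [Pi.sub_apply, mul_sub]
    linarith
  have hi1 : ∀ k i, Integrable (fun x => f i x * z k x i) μ := fun k i =>
    (hfm i).integrable_mul (hz k i)
  have hi2 : ∀ i, Integrable (fun x => f i x * w x i) μ := fun i => (hfm i).integrable_mul (hw i)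
  have hi3 : ∀ k i, Integrable (fun x => f i x * z k x i - f i x * w x i) μ := fun k i =>
    (hi1 k i).sub (hi2 i)
  have hPw := integrable_quadratic P hw
  have hle : ∀ k, ∫ x, P (w x) ∂μ +
      ∑ i, (∫ x, f i x * z k x i ∂μ - ∫ x, f i x * w x i ∂μ) ≤ c := fun k => by
    refine le_trans (le_of_eq ?_) ((integral_mono
      (hPw.add (integrable_finsetSum _ fun i _ => hi3 k i))
      (integrable_quadratic P (hz k)) (hineq k)).trans (hc k))
    rw [integral_add' hPw (integrable_finsetSum _ fun i _ => hi3 k i),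
      integral_finsetSum _ fun i _ => hi3 k i]
    congr 1
    exact Finset.sum_congr rfl fun i _ => (integral_sub (hi1 k i) (hi2 i)).symm
  have hlim : Tendsto (fun k => ∫ x, P (w x) ∂μ +
      ∑ i, (∫ x, f i x * z k x i ∂μ - ∫ x, f i x * w x i ∂μ)) atTop (𝓝 (∫ x, P (w x) ∂μ)) := by
    have := (tendsto_finsetSum (s := Finset.univ) fun i _ =>
      (hweak i (f i) (hfm i)).sub_const (∫ x, f i x * w x i ∂μ)).const_add (∫ x, P (w x) ∂μ)
    simpa using this
  exact le_of_tendsto' hlim hle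

theorem tendsto_integral_quadratic {ι : Type*} [Fintype ι] [DecidableEq ι]
    (P : QuadraticForm ℝ (ι → ℝ)) {μ : Measure E2} {z : ℕ → E2 → ι → ℝ}
    {w : E2 → ι → ℝ} (hz : ∀ k i, MemLp (fun x => z k x i) 2 μ)
    (hw : ∀ i, MemLp (fun x => w x i) 2 μ)
    (hs : ∀ i, Tendsto (fun k => eLpNorm (fun x => z k x i - w x i) 2 μ) atTop (𝓝 0)) :
    Tendsto (fun k => ∫ x, P (z k x) ∂μ) atTop (𝓝 (∫ x, P (w x) ∂μ)) := by
  have hZ : ∀ i, Tendsto (fun k => (hz k i).toLp) atTop (𝓝 (hw i).toLp) := fun i =>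
    (Lp.tendsto_Lp_iff_tendsto_eLpNorm'' _ _ _ _).2 (hs i)
  have key : ∀ {v : E2 → ι → ℝ} (hv : ∀ i, MemLp (fun x => v x i) 2 μ), ∫ x, P (v x) ∂μ =
      ∑ i, ∑ j, (QuadraticMap.polar P (Pi.single i 1) (Pi.single j 1) / 2) *
        inner ℝ (hv i).toLp (hv j).toLp := fun {v} hv => by
    have hi : ∀ i j, Integrable (fun x => QuadraticMap.polar P (Pi.single i 1) (Pi.single j 1) / 2 *
        (v x i * v x j)) μ := fun i j => ((hv i).integrable_mul (hv j)).const_mul _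
    simp only [QuadraticForm.expand P (v _)]
    rw [integral_finsetSum _ fun i _ => integrable_finsetSum _ fun j _ => hi i j]
    refine Finset.sum_congr rfl fun i _ => ?_
    rw [integral_finsetSum _ fun j _ => hi i j]
    refine Finset.sum_congr rfl fun j _ => ?_
    rw [integral_const_mul, MeasureTheory.L2.inner_def]
    congr 1
    refine integral_congr_ae ?_
    filter_upwards [(hv i).coeFn_toLp, (hv j).coeFn_toLp] with x h1 h2
    rw [h1, h2, real_inner_comm]
    rfl
  simp only [key hw, key (hz _)]
  exact tendsto_finsetSum _ fun i _ => tendsto_finsetSum _ fun j _ =>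
    ((hZ i).inner (hZ j)).const_mul _

/-- Almost everywhere convergence of the gradients and of the directors. -/
def StrainConverges {S : Set E2} (q : ℕ → H2 S × H1 S) (p : H2 S × H1 S) : Prop :=
  ∀ᵐ x ∂(volume.restrict S),
    (∀ i, Tendsto (fun k => (q k).1.grad i x) atTop (𝓝 (p.1.grad i x))) ∧
      Tendsto (fun k => (q k).2.fn x) atTop (𝓝 (p.2.fn x))

theorem StrainConverges.mem_A2 {S : Set E2} {q : ℕ → H2 S × H1 S} {p : H2 S × H1 S}
    (h : StrainConverges q p) (hq : ∀ k, q k ∈ A2 S) : p ∈ A2 S := by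
  refine ⟨fun i j => ?_, ?_⟩
  · filter_upwards [h, ae_all_iff.2 fun k => (hq k).1 i j] with x hx h1
    exact tendsto_nhds_unique ((hx.1 i).inner (hx.1 j)) (by simp only [h1, tendsto_const_nhds])
  · filter_upwards [h, ae_all_iff.2 fun k => (hq k).2] with x hx h1
    exact tendsto_nhds_unique hx.2.norm (by simp only [h1, tendsto_const_nhds])

theorem StrainConverges.eigenCoord {S : Set E2} {q : ℕ → H2 S × H1 S} {p : H2 S × H1 S}
    (h : StrainConverges q p) : ∀ᵐ x ∂(volume.restrict S), ∀ i,
      Tendsto (fun k => eigenCoord (q k).1 (q k).2 x i) atTop (𝓝 (eigenCoord p.1 p.2 x i)) := by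
  filter_upwards [h] with x hx i
  have ht : ∀ i, Tendsto (fun k => localDirector (q k).1 (q k).2 x i) atTop
      (𝓝 (localDirector p.1 p.2 x i)) := fun i => (hx.1 i).inner hx.2
  fin_cases i
  · exact tendsto_const_nhds.sub ((ht 0).pow 2)
  · exact tendsto_const_nhds.sub ((ht 1).pow 2)
  · exact ((ht 0).mul (ht 1)).neg

theorem StrainConverges.normal {S : Set E2} {q : ℕ → H2 S × H1 S} {p : H2 S × H1 S}
    (h : StrainConverges q p) : ∀ᵐ x ∂(volume.restrict S),
      Tendsto (fun k => normal (q k).1 x) atTop (𝓝 (normal p.1 x)) := by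
  filter_upwards [h] with x hx
  have hc : ∀ i (a : Fin 3), Tendsto (fun k => (q k).1.grad i x a) atTop
      (𝓝 (p.1.grad i x a)) := fun i a =>
    ((EuclideanSpace.proj (𝕜 := ℝ) a).continuous.tendsto _).comp (hx.1 i)
  simp only [normal_eq]
  refine (PiLp.continuous_toLp 2 _).tendsto _ |>.comp (tendsto_pi_nhds.2 fun a => ?_)
  fin_cases a
  · exact ((hc 0 1).mul (hc 1 2)).sub ((hc 0 2).mul (hc 1 1))
  · exact ((hc 0 2).mul (hc 1 0)).sub ((hc 0 0).mul (hc 1 2))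
  · exact ((hc 0 0).mul (hc 1 1)).sub ((hc 0 1).mul (hc 1 0))

/-- The inner product of a weakly and a strongly convergent sequence converges. -/
theorem tendsto_inner_of_weak {H : Type*} [NormedAddCommGroup H] [InnerProductSpace ℝ H]
    {u g : ℕ → H} {v f : H} (hu : ∀ w, Tendsto (fun k => inner ℝ (u k) w) atTop (𝓝 (inner ℝ v w)))
    {M : ℝ} (hM : ∀ k, ‖u k‖ ≤ M) (hg : Tendsto g atTop (𝓝 f)) :
    Tendsto (fun k => inner ℝ (u k) (g k)) atTop (𝓝 (inner ℝ v f)) := by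
  have h1 : Tendsto (fun k => inner ℝ (u k) (g k - f)) atTop (𝓝 0) := by
    have h0 : Tendsto (fun k => M * ‖g k - f‖) atTop (𝓝 0) := by
      simpa using (tendsto_iff_norm_sub_tendsto_zero.1 hg).const_mul M
    refine squeeze_zero_norm (fun k => ?_) h0
    exact (norm_inner_le_norm _ _).trans (mul_le_mul_of_nonneg_right (hM k) (norm_nonneg _))
  have h2 := h1.add (hu f)
  simpa [← inner_add_right] using h2

/-- The second fundamental form converges weakly if the second derivatives do and the gradients
converge almost everywhere: it is a product of a weakly and a strongly convergent factor. -/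
theorem StrainConverges.II_weak {S : Set E2} (hS : IsOpen S) {q : ℕ → H2 S × H1 S}
    {p : H2 S × H1 S} (h : StrainConverges q p) (hq : ∀ k, q k ∈ A2 S) {i j : Fin 2}
    (hu : ∀ w, Tendsto (fun k => inner ℝ ((q k).1.hess i j) w) atTop
      (𝓝 (inner ℝ (p.1.hess i j) w))) {M : ℝ} (hM : ∀ k, ‖(q k).1.hess i j‖ ≤ M)
    {f : E2 → ℝ} (hf : MemLp f 2 (volume.restrict S)) :
    Tendsto (fun k => ∫ x in S, f x * II (q k).1 x i j) atTop
      (𝓝 (∫ x in S, f x * II p.1 x i j)) := by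
  have hp := h.mem_A2 hq
  have hm : ∀ r ∈ A2 S, MemLp (fun x => f x • LCEPlate.normal r.1 x) 2 (volume.restrict S) :=
    fun r hr => by
      refine hf.mono (hf.1.smul (aestronglyMeasurable_normal r.1)) ?_
      filter_upwards [norm_normal hr] with x hx
      rw [norm_smul, hx, mul_one]
  have key : ∀ r (hr : r ∈ A2 S), ∫ x in S, f x * II r.1 x i j =
      - inner ℝ (r.1.hess i j) (hm r hr).toLp := fun r hr => by
    rw [MeasureTheory.L2.inner_def, ← integral_neg]
    refine integral_congr_ae ?_
    filter_upwards [II_ae hS hr, (hm r hr).coeFn_toLp] with x h1 h2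
    rw [(h1 i j).1, h2, inner_smul_right]
    ring
  simp only [key _ hp, fun k => key _ (hq k)]
  refine (tendsto_inner_of_weak hu hM ?_).neg
  refine (Lp.tendsto_Lp_iff_tendsto_eLpNorm'' _ _ _ _).2 ?_
  refine tendsto_eLpNorm_of_dominated (d := fun x => 2 * ‖f x‖)
    (fun k => ((hm _ (hq k)).sub (hm _ hp)).1) (hf.norm.const_mul 2) (fun k => ?_) ?_
  · filter_upwards [norm_normal (hq k), norm_normal hp] with x h1 h2
    refine (norm_sub_le _ _).trans ?_
    rw [norm_smul, norm_smul, h1, h2]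
    linarith
  · filter_upwards [h.normal] with x hx
    simpa using (hx.const_smul (f x)).sub_const (f x • LCEPlate.normal p.1 x)

/-- The second fundamental form converges in `L²` if the second derivatives do and the gradients
converge almost everywhere. -/
theorem StrainConverges.II_strong {S : Set E2} (hS : IsOpen S) {q : ℕ → H2 S × H1 S}
    {p : H2 S × H1 S} (h : StrainConverges q p) (hq : ∀ k, q k ∈ A2 S) {i j : Fin 2}
    (hu : Tendsto (fun k => (q k).1.hess i j) atTop (𝓝 (p.1.hess i j))) :
    Tendsto (fun k => eLpNorm (fun x => II (q k).1 x i j - II p.1 x i j) 2 (volume.restrict S))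
      atTop (𝓝 0) := by
  have hp := h.mem_A2 hq
  have h1 := (Lp.tendsto_Lp_iff_tendsto_eLpNorm' _ _).1 hu
  have hmeas : ∀ k, AEStronglyMeasurable (fun x => inner ℝ (p.1.hess i j x)
      (LCEPlate.normal (q k).1 x - LCEPlate.normal p.1 x)) (volume.restrict S) := fun k =>
    (L2.aestronglyMeasurable _).inner
      ((aestronglyMeasurable_normal _).sub (aestronglyMeasurable_normal _))
  have hmeas' : ∀ k, AEStronglyMeasurable (fun x => inner ℝ ((q k).1.hess i j x - p.1.hess i j x)
      (LCEPlate.normal (q k).1 x)) (volume.restrict S) := fun k =>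
    ((L2.aestronglyMeasurable _).sub (L2.aestronglyMeasurable _)).inner
      (aestronglyMeasurable_normal _)
  have h2 : Tendsto (fun k => eLpNorm (fun x => inner ℝ (p.1.hess i j x)
      (LCEPlate.normal (q k).1 x - LCEPlate.normal p.1 x)) 2 (volume.restrict S)) atTop (𝓝 0) := by
    refine tendsto_eLpNorm_of_dominated (d := fun x => ‖p.1.hess i j x‖ * 2) hmeas
      ((Lp.memLp (p.1.hess i j)).norm.mul_const 2) (fun k => ?_) ?_
    · filter_upwards [norm_normal (hq k), norm_normal hp] with x h1 h2
      refine (norm_inner_le_norm _ _).trans (mul_le_mul_of_nonneg_left ?_ (norm_nonneg _))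
      refine (norm_sub_le _ _).trans ?_
      rw [h1, h2]
      norm_num
    · filter_upwards [h.normal] with x hx
      have := (tendsto_const_nhds (x := p.1.hess i j x)).inner
        (hx.sub_const (LCEPlate.normal p.1 x)) (𝕜 := ℝ)
      simpa using this
  refine tendsto_of_tendsto_of_tendsto_of_le_of_le tendsto_const_nhds
    (by simpa using h1.add h2) (fun k => bot_le) fun k => ?_
  have h3 : eLpNorm (fun x => II (q k).1 x i j - II p.1 x i j) 2 (volume.restrict S) =
      eLpNorm (fun x => inner ℝ ((q k).1.hess i j x - p.1.hess i j x) (LCEPlate.normal (q k).1 x) +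
        inner ℝ (p.1.hess i j x) (LCEPlate.normal (q k).1 x - LCEPlate.normal p.1 x)) 2
        (volume.restrict S) := by
    rw [← eLpNorm_neg]
    refine eLpNorm_congr_ae ?_
    filter_upwards [II_ae hS (hq k), II_ae hS hp] with x h1 h2
    rw [Pi.neg_apply, (h1 i j).1, (h2 i j).1, inner_sub_left, inner_sub_right]
    ring
  change eLpNorm (fun x => II (q k).1 x i j - II p.1 x i j) 2 (volume.restrict S) ≤ _
  rw [h3]
  refine (eLpNorm_add_le (hmeas' k) (hmeas k) (by norm_num)).trans ?_
  gcongr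
  refine eLpNorm_mono_ae ?_
  filter_upwards [norm_normal (hq k)] with x hx
  refine (norm_inner_le_norm _ _).trans ?_
  rw [hx, mul_one]
  exact le_rfl

theorem StrainConverges.eigenCoord_strong {S : Set E2} (hfin : volume S ≠ ⊤)
    {q : ℕ → H2 S × H1 S} {p : H2 S × H1 S} (h : StrainConverges q p) (hq : ∀ k, q k ∈ A2 S)
    (i : Fin 3) : Tendsto (fun k => eLpNorm (fun x => LCEPlate.eigenCoord (q k).1 (q k).2 x i -
      LCEPlate.eigenCoord p.1 p.2 x i) 2 (volume.restrict S)) atTop (𝓝 0) := by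
  have : IsFiniteMeasure (volume.restrict S) := ⟨by simpa using hfin.lt_top⟩
  refine tendsto_eLpNorm_of_dominated (d := fun _ => 2) (fun k =>
    (aestronglyMeasurable_eigenCoord _ _ i).sub (aestronglyMeasurable_eigenCoord _ _ i))
    (memLp_const 2) (fun k => ?_) ?_
  · filter_upwards [abs_eigenCoord_le (hq k), abs_eigenCoord_le (h.mem_A2 hq)] with x h1 h2
    refine (norm_sub_le _ _).trans ?_
    rw [Real.norm_eq_abs, Real.norm_eq_abs]
    linarith [h1 i, h2 i]
  · filter_upwards [h.eigenCoord] with x hx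
    simpa using (hx i).sub_const (LCEPlate.eigenCoord p.1 p.2 x i)

theorem tendsto_integral_mul_of_eLpNorm {μ : Measure E2} {z : ℕ → E2 → ℝ} {w f : E2 → ℝ}
    (hf : MemLp f 2 μ) (hz : ∀ k, MemLp (z k) 2 μ) (hw : MemLp w 2 μ)
    (h : Tendsto (fun k => eLpNorm (fun x => z k x - w x) 2 μ) atTop (𝓝 0)) :
    Tendsto (fun k => ∫ x, f x * z k x ∂μ) atTop (𝓝 (∫ x, f x * w x ∂μ)) := by
  have hZ : Tendsto (fun k => (hz k).toLp) atTop (𝓝 hw.toLp) :=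
    (Lp.tendsto_Lp_iff_tendsto_eLpNorm'' _ _ _ _).2 h
  have key : ∀ {v : E2 → ℝ} (hv : MemLp v 2 μ), ∫ x, f x * v x ∂μ = inner ℝ hf.toLp hv.toLp :=
    fun {v} hv => by
    rw [MeasureTheory.L2.inner_def]
    refine integral_congr_ae ?_
    filter_upwards [hf.coeFn_toLp, hv.coeFn_toLp] with x h1 h2
    rw [h1, h2, real_inner_comm]
    rfl
  simp only [key hw, key (hz _)]
  exact tendsto_const_nhds.inner hZ

/-- Lower semicontinuity of the elastic energy under weak convergence of the second derivatives and
almost everywhere convergence of the gradients and directors. -/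
theorem StrainConverges.Eel_le {CW qW : ℝ} {rW : ℝ → ℝ≥0∞} {W : ℝ → M3 → ℝ≥0∞}
    {Q : ℝ → QuadraticForm ℝ M3} (hW : IsStoredEnergy CW qW rW W Q) {rbar : ℝ} {S : Set E2}
    (hS : IsOpen S) (hfin : volume S ≠ ⊤) {q : ℕ → H2 S × H1 S} {p : H2 S × H1 S}
    (h : StrainConverges q p) (hq : ∀ k, q k ∈ A2 S)
    (hu : ∀ i j w, Tendsto (fun k => inner ℝ ((q k).1.hess i j) w) atTop
      (𝓝 (inner ℝ (p.1.hess i j) w))) {M : ℝ} (hM : ∀ k i j, ‖(q k).1.hess i j‖ ≤ M)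
    {c : ℝ} (hc : ∀ k, Eel Q rbar (q k).1 (q k).2 ≤ c) : Eel Q rbar p.1 p.2 ≤ c := by
  obtain ⟨P, hP0, -, hP⟩ := hW.exists_density rbar
  have hE : ∀ r ∈ A2 S, Eel Q rbar r.1 r.2 = ∫ x in S, P (strainField r.1 r.2 x) := fun r hr =>
    integral_congr_ae (hP S hS r hr)
  have hp := h.mem_A2 hq
  rw [hE p hp]
  refine integral_quadratic_le_of_weak P hP0
    (z := fun k x => strainField (q k).1 (q k).2 x)
    (fun k i => memLp_strainField hS hfin (hq k) i)
    (memLp_strainField hS hfin hp) (fun i f hf => ?_) (fun k => (hE _ (hq k)).symm.trans_le (hc k))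
  rcases i with i | i
  · fin_cases i
    · exact h.II_weak hS hq (hu 0 0) (fun k => hM k 0 0) hf
    · exact h.II_weak hS hq (hu 1 1) (fun k => hM k 1 1) hf
    · exact h.II_weak hS hq (hu 0 1) (fun k => hM k 0 1) hf
  · exact tendsto_integral_mul_of_eLpNorm hf
      (fun k => memLp_strainField hS hfin (hq k) (.inr i))
      (memLp_strainField hS hfin hp (.inr i)) (h.eigenCoord_strong hfin hq i)

/-- Continuity of the elastic energy under strong convergence of the second derivatives and
almost everywhere convergence of the gradients and directors. -/
theorem StrainConverges.tendsto_Eel {CW qW : ℝ} {rW : ℝ → ℝ≥0∞} {W : ℝ → M3 → ℝ≥0∞}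
    {Q : ℝ → QuadraticForm ℝ M3} (hW : IsStoredEnergy CW qW rW W Q) {rbar : ℝ} {S : Set E2}
    (hS : IsOpen S) (hfin : volume S ≠ ⊤) {q : ℕ → H2 S × H1 S} {p : H2 S × H1 S}
    (h : StrainConverges q p) (hq : ∀ k, q k ∈ A2 S)
    (hu : ∀ i j, Tendsto (fun k => (q k).1.hess i j) atTop (𝓝 (p.1.hess i j))) :
    Tendsto (fun k => Eel Q rbar (q k).1 (q k).2) atTop (𝓝 (Eel Q rbar p.1 p.2)) := by
  obtain ⟨P, -, -, hP⟩ := hW.exists_density rbar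
  have hE : ∀ r ∈ A2 S, Eel Q rbar r.1 r.2 = ∫ x in S, P (strainField r.1 r.2 x) := fun r hr =>
    integral_congr_ae (hP S hS r hr)
  have hp := h.mem_A2 hq
  simp only [hE p hp, fun k => hE _ (hq k)]
  refine tendsto_integral_quadratic P (z := fun k x => strainField (q k).1 (q k).2 x)
    (fun k i => memLp_strainField hS hfin (hq k) i) (memLp_strainField hS hfin hp) fun i => ?_
  rcases i with i | i
  · fin_cases i
    · exact h.II_strong hS hq (hu 0 0)
    · exact h.II_strong hS hq (hu 1 1)
    · exact h.II_strong hS hq (hu 0 1)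
  · exact h.eigenCoord_strong hfin hq i

/-! ### Weak convergence in the Sobolev spaces -/

/-- Weakly convergent sequences are bounded. -/
theorem exists_norm_le_of_weak {H : Type*} [NormedAddCommGroup H] [InnerProductSpace ℝ H]
    {u : ℕ → H} {v : H} (hu : ∀ ℓ : StrongDual ℝ H, Tendsto (fun k => ℓ (u k)) atTop (𝓝 (ℓ v))) :
    ∃ M, ∀ k, ‖u k‖ ≤ M := by
  obtain ⟨M, hM⟩ := banach_steinhaus
    (g := fun k => NormedSpace.inclusionInDoubleDualLi ℝ (u k)) fun ℓ => by
    obtain ⟨C, hC⟩ := (hu ℓ).norm.bddAbove_range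
    exact ⟨C, fun k => hC ⟨k, rfl⟩⟩
  exact ⟨M, fun k =>
    ((NormedSpace.inclusionInDoubleDualLi ℝ).norm_map (u k)).symm.trans_le (hM k)⟩

theorem tendsto_inner_of_strongDual {H G : Type*} [NormedAddCommGroup H] [InnerProductSpace ℝ H]
    [NormedAddCommGroup G] [InnerProductSpace ℝ G] {u : ℕ → H} {v : H}
    (hu : ∀ ℓ : StrongDual ℝ H, Tendsto (fun k => ℓ (u k)) atTop (𝓝 (ℓ v))) (T : H →L[ℝ] G)
    (w : G) : Tendsto (fun k => inner ℝ (T (u k)) w) atTop (𝓝 (inner ℝ (T v) w)) := by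
  have h := hu ((innerSL ℝ w).comp T)
  simp only [ContinuousLinearMap.comp_apply, innerSL_apply_apply] at h
  simpa only [real_inner_comm] using h

/-- A bounded sequence converges weakly as soon as its image under an injective bounded operator
converges. -/
theorem tendsto_of_tendsto_injective {H G : Type*} [NormedAddCommGroup H] [InnerProductSpace ℝ H]
    [CompleteSpace H] [NormedAddCommGroup G] [InnerProductSpace ℝ G] {u : ℕ → H} {v : H} {M : ℝ}
    (hM : ∀ k, ‖u k‖ ≤ M) (T : H →L[ℝ] G) (hT : Function.Injective T)
    (h : Tendsto (fun k => T (u k)) atTop (𝓝 (T v))) (ℓ : StrongDual ℝ H) :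
    Tendsto (fun k => ℓ (u k)) atTop (𝓝 (ℓ v)) := by
  refine tendsto_of_subseq_tendsto fun ns hns => ?_
  obtain ⟨v', φ, hφ, hv'⟩ := exists_subseq_weak_tendsto (fun k => u (ns k)) M fun k => hM _
  refine ⟨φ, ?_⟩
  have e : v' = v := hT <| ext_inner_right ℝ fun w =>
    tendsto_nhds_unique (tendsto_inner_of_strongDual hv' T w)
      ((h.comp (hns.comp hφ.tendsto_atTop)).inner tendsto_const_nhds)
  exact e ▸ hv' ℓ

theorem H1.fnL_injective {S : Set E2} (hS : IsOpen S) : Function.Injective (H1.fnL S) :=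
  fun _ _ h => H1.ext_fn hS h

theorem H2.fnL_injective {S : Set E2} (hS : IsOpen S) : Function.Injective (H2.fnL S) :=
  fun _ _ h => H2.ext_fn hS h

theorem H2.norm_gradH1_le {S : Set E2} (y : H2 S) (i : Fin 2) : ‖y.gradH1 i‖ ≤ ‖y‖ := by
  refine le_of_sq_le_sq ?_ (norm_nonneg _)
  rw [H1.norm_sq, H2.norm_sq]
  simp only [H2.gradH1_fn, H2.gradH1_grad, Fin.sum_univ_two]
  fin_cases i <;> simp only [Fin.zero_eta, Fin.mk_one, Fin.isValue] <;>
    nlinarith [sq_nonneg ‖y.fn‖, sq_nonneg ‖y.grad 0‖, sq_nonneg ‖y.grad 1‖,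
      sq_nonneg ‖y.hess 0 0‖, sq_nonneg ‖y.hess 0 1‖, sq_nonneg ‖y.hess 1 0‖,
      sq_nonneg ‖y.hess 1 1‖]

theorem H2.norm_toH1_le {S : Set E2} (y : H2 S) : ‖y.toH1‖ ≤ ‖y‖ := by
  refine le_of_sq_le_sq ?_ (norm_nonneg _)
  rw [H1.norm_sq, H2.norm_sq]
  exact le_add_of_nonneg_right (by positivity)

/-- `H2.gradH1` as a bounded operator. -/
def H2.gradH1L (S : Set E2) (i : Fin 2) : H2 S →L[ℝ] H1 S :=
  LinearMap.mkContinuous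
    { toFun := fun y => y.gradH1 i
      map_add' := fun y z => Subtype.ext <| PiLp.ext fun a => by rcases a with _ | _ <;> rfl
      map_smul' := fun c y => Subtype.ext <| PiLp.ext fun a => by rcases a with _ | _ <;> rfl }
    1 fun y => by rw [one_mul]; exact y.norm_gradH1_le i

/-- `H2.toH1` as a bounded operator. -/
def H2.toH1L (S : Set E2) : H2 S →L[ℝ] H1 S :=
  LinearMap.mkContinuous
    { toFun := fun y => y.toH1
      map_add' := fun y z => Subtype.ext <| PiLp.ext fun a => by rcases a with _ | _ <;> rfl
      map_smul' := fun c y => Subtype.ext <| PiLp.ext fun a => by rcases a with _ | _ <;> rfl }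
    1 fun y => by rw [one_mul]; exact y.norm_toH1_le

/-- The gradients of isometries are bounded, so weak convergence in `H²` makes them converge
strongly in `L²`. -/
theorem H2.tendsto_grad_of_weak {S : Set E2} (hS : IsOpen S) (hfin : volume S ≠ ⊤)
    {q : ℕ → H2 S × H1 S} {y : H2 S} (hq : ∀ k, q k ∈ A2 S)
    (hu : ∀ ℓ : StrongDual ℝ (H2 S), Tendsto (fun k => ℓ (q k).1) atTop (𝓝 (ℓ y)))
    {M : ℝ} (hM : ∀ k, ‖(q k).1‖ ≤ M) (i : Fin 2) :
    Tendsto (fun k => (q k).1.grad i) atTop (𝓝 (y.grad i)) :=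
  H1.tendsto_fn_of_weak hS hfin (u := fun k => (q k).1.gradH1 i) (v := y.gradH1 i)
    (fun ℓ => hu (ℓ.comp (H2.gradH1L S i))) (M := M) (B := 1)
    (fun k => ((q k).1.norm_gradH1_le i).trans (hM k))
    (fun k => (H2.norm_grad (hq k) i).mono fun _ hx => hx.le)

theorem tendsto_director_of_weak {S : Set E2} (hS : IsOpen S) (hfin : volume S ≠ ⊤)
    {q : ℕ → H2 S × H1 S} {n : H1 S} (hq : ∀ k, q k ∈ A2 S)
    (hu : ∀ ℓ : StrongDual ℝ (H1 S), Tendsto (fun k => ℓ (q k).2) atTop (𝓝 (ℓ n))) :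
    Tendsto (fun k => (q k).2.fn) atTop (𝓝 n.fn) := by
  obtain ⟨M, hM⟩ := exists_norm_le_of_weak hu
  exact H1.tendsto_fn_of_weak hS hfin hu hM fun k => (hq k).2.mono fun _ hx => hx.le

theorem exists_subseq_strainConverges {S : Set E2} {q : ℕ → H2 S × H1 S} {p : H2 S × H1 S}
    (hg : ∀ i, Tendsto (fun k => (q k).1.grad i) atTop (𝓝 (p.1.grad i)))
    (hn : Tendsto (fun k => (q k).2.fn) atTop (𝓝 p.2.fn)) :
    ∃ φ : ℕ → ℕ, StrictMono φ ∧ StrainConverges (fun k => q (φ k)) p := by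
  obtain ⟨φ, hφ, h0⟩ := L2.exists_subseq_ae (hg 0)
  obtain ⟨ψ, hψ, h1⟩ := L2.exists_subseq_ae ((hg 1).comp hφ.tendsto_atTop)
  obtain ⟨χ, hχ, h2⟩ := L2.exists_subseq_ae (hn.comp (hφ.comp hψ).tendsto_atTop)
  refine ⟨fun k => φ (ψ (χ k)), hφ.comp (hψ.comp hχ), ?_⟩
  filter_upwards [h0, h1, h2] with x a b c
  refine ⟨fun i => ?_, c⟩
  fin_cases i
  · exact a.comp (hψ.comp hχ).tendsto_atTop
  · exact b.comp hχ.tendsto_atTop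

/-! ### Lower semicontinuity of the energies -/

theorem norm_sq_of_norm_eq_one {S : Set E2} {u : L2 S}
    (h : ∀ᵐ x ∂(volume.restrict S), ‖u x‖ = 1) : ‖u‖ ^ 2 = (volume S).toReal := by
  rw [norm_sq_eq_integral, integral_congr_ae (g := fun _ => (1 : ℝ))
    (h.mono fun x hx => by simp only [hx, one_pow]), setIntegral_const, smul_eq_mul, mul_one]
  rfl

/-- Isometries with bounded `L²`-norm and bounded elastic energy are bounded in `H²`. -/
theorem IsStoredEnergy.exists_norm_le {CW qW : ℝ} {rW : ℝ → ℝ≥0∞} {W : ℝ → M3 → ℝ≥0∞}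
    {Q : ℝ → QuadraticForm ℝ M3} (h : IsStoredEnergy CW qW rW W Q) (rbar : ℝ) {S : Set E2}
    (hS : IsOpen S) (hfin : volume S ≠ ⊤) (b c : ℝ) : ∃ M, ∀ q ∈ A2 S, ‖q.1.fn‖ ≤ b →
      Eel Q rbar q.1 q.2 ≤ c → ‖q.1‖ ≤ M := by
  refine ⟨Real.sqrt (b ^ 2 + ((volume S).toReal + (volume S).toReal) + (96 * CW * c +
    8 * rbar ^ 2 * (48 * (4 * CW ^ 2 + 1)) * 4 * (volume S).toReal)), fun q hq hb hc => ?_⟩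
  refine Real.le_sqrt_of_sq_le ?_
  rw [H2.norm_sq, Fin.sum_univ_two (fun i => ‖q.1.grad i‖ ^ 2),
    norm_sq_of_norm_eq_one (H2.norm_grad hq 0), norm_sq_of_norm_eq_one (H2.norm_grad hq 1)]
  have h1 := (h.apriori rbar hS hfin hq).2.2
  have h2 : 96 * CW * Eel Q rbar q.1 q.2 ≤ 96 * CW * c :=
    mul_le_mul_of_nonneg_left hc (by have := h.CW_pos; positivity)
  have h3 : ‖q.1.fn‖ ^ 2 ≤ b ^ 2 := pow_le_pow_left₀ (norm_nonneg _) hb 2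
  linarith

theorem exists_norm_le_of_tendsto {G : Type*} [NormedAddCommGroup G] {u : ℕ → G} {v : G}
    (h : Tendsto u atTop (𝓝 v)) : ∃ M, ∀ k, ‖u k‖ ≤ M := by
  obtain ⟨M, hM⟩ := h.norm.bddAbove_range
  exact ⟨M, fun k => hM ⟨k, rfl⟩⟩

/-- Bounds on the elastic energy pass to limits in `L²`. They bound the sequence in `H²`, so that it
converges weakly there. -/
theorem Eel_le_of_tendsto {CW qW : ℝ} {rW : ℝ → ℝ≥0∞} {W : ℝ → M3 → ℝ≥0∞}
    {Q : ℝ → QuadraticForm ℝ M3} (hW : IsStoredEnergy CW qW rW W Q) {rbar : ℝ} {S : Set E2}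
    (hS : IsOpen S) (hfin : volume S ≠ ⊤) {q : ℕ → H2 S × H1 S} {p : H2 S × H1 S}
    (hq : ∀ k, q k ∈ A2 S) (hy : Tendsto (fun k => (q k).1.fn) atTop (𝓝 p.1.fn))
    (hn : Tendsto (fun k => (q k).2.fn) atTop (𝓝 p.2.fn)) {c : ℝ}
    (hc : ∀ k, Eel Q rbar (q k).1 (q k).2 ≤ c) : Eel Q rbar p.1 p.2 ≤ c := by
  obtain ⟨b, hb⟩ := exists_norm_le_of_tendsto hy
  obtain ⟨M, hM⟩ := hW.exists_norm_le rbar hS hfin b c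
  have hM' : ∀ k, ‖(q k).1‖ ≤ M := fun k => hM _ (hq k) (hb k) (hc k)
  have hweak := tendsto_of_tendsto_injective hM' (H2.fnL S) (H2.fnL_injective hS) hy
  obtain ⟨φ, hφ, hφq⟩ := exists_subseq_strainConverges
    (H2.tendsto_grad_of_weak hS hfin hq hweak hM') hn
  refine hφq.Eel_le hW hS hfin (fun k => hq _) (fun i j w =>
    (tendsto_inner_of_strongDual hweak (H2.hessL S i j) w).comp hφ.tendsto_atTop)
    (M := M) (fun k i j => ?_) fun k => hc _
  refine le_trans (le_of_sq_le_sq ?_ (norm_nonneg _)) (hM' (φ k))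
  rw [H2.norm_sq]
  have h1 : ‖(q (φ k)).1.hess i j‖ ^ 2 ≤ ∑ j, ‖(q (φ k)).1.hess i j‖ ^ 2 :=
    Finset.single_le_sum (f := fun j => ‖(q (φ k)).1.hess i j‖ ^ 2)
      (fun _ _ => by positivity) (Finset.mem_univ j)
  have h2 : ∑ j, ‖(q (φ k)).1.hess i j‖ ^ 2 ≤ ∑ i, ∑ j, ‖(q (φ k)).1.hess i j‖ ^ 2 :=
    Finset.single_le_sum (f := fun i => ∑ j, ‖(q (φ k)).1.hess i j‖ ^ 2)
      (fun _ _ => by positivity) (Finset.mem_univ i)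
  have h3 : 0 ≤ ‖(q (φ k)).1.fn‖ ^ 2 + ∑ i, ‖(q (φ k)).1.grad i‖ ^ 2 := by positivity
  linarith

theorem EOF_le_of_tendsto {S : Set E2} (hS : IsOpen S) {n : ℕ → H1 S} {m : H1 S}
    (hn : Tendsto (fun k => (n k).fn) atTop (𝓝 m.fn)) {c : ℝ} (hc : ∀ k, EOF (n k) ≤ c) :
    EOF m ≤ c := by
  obtain ⟨b, hb⟩ := exists_norm_le_of_tendsto hn
  simp only [EOF_eq] at hc ⊢
  have hM : ∀ k, ‖n k‖ ≤ Real.sqrt (b ^ 2 + 2 * c) := fun k => by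
    refine Real.le_sqrt_of_sq_le ?_
    rw [H1.norm_sq]
    have h3 : ‖(n k).fn‖ ^ 2 ≤ b ^ 2 := pow_le_pow_left₀ (norm_nonneg _) (hb k) 2
    linarith [hc k]
  have hweak := tendsto_of_tendsto_injective hM (H1.fnL S) (H1.fnL_injective hS) hn
  have hlim : Tendsto (fun k => ∑ i, (2 * inner ℝ ((n k).grad i) (m.grad i) - ‖m.grad i‖ ^ 2)) atTop
      (𝓝 (∑ i, ‖m.grad i‖ ^ 2)) := by
    refine tendsto_finsetSum _ fun i _ => ?_
    have := ((tendsto_inner_of_strongDual hweak (H1.gradL S i) (m.grad i)).const_mul 2).sub_const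
      (‖m.grad i‖ ^ 2)
    simp only [H1.gradL_apply, real_inner_self_eq_norm_sq] at this
    convert this using 2
    ring
  have h2 : ∑ i, ‖m.grad i‖ ^ 2 ≤ 2 * c := le_of_tendsto' hlim fun k => by
    refine le_trans (Finset.sum_le_sum fun i _ => ?_)
      (show ∑ i, ‖(n k).grad i‖ ^ 2 ≤ 2 * c by linarith [hc k])
    have h1 := norm_sub_sq_real ((n k).grad i) (m.grad i)
    linarith [sq_nonneg ‖(n k).grad i - m.grad i‖]
  linarith

/-- A number is at most the lower limit of a sequence if it inherits all upper bounds of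
subsequences. -/
theorem coe_le_liminf_of_subseq {f : ℕ → ℝ} {X : ℝ}
    (h : ∀ φ : ℕ → ℕ, StrictMono φ → ∀ c, (∀ k, f (φ k) ≤ c) → X ≤ c) :
    (X : EReal) ≤ liminf (fun k => (f k : EReal)) atTop := by
  by_contra! hlt
  obtain ⟨c, h1, h2⟩ := EReal.lt_iff_exists_real_btwn.1 hlt
  obtain ⟨φ, hφ, hφc⟩ := extraction_of_frequently_atTop (frequently_lt_of_liminf_lt (h := h1))
  exact absurd (h φ hφ c fun k => EReal.coe_le_coe_iff.1 (hφc k).le)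
    (not_le.2 (EReal.coe_lt_coe_iff.1 h2))

theorem EOF_le_liminf {S : Set E2} (hS : IsOpen S) {n : ℕ → H1 S} {m : H1 S}
    (hn : Tendsto (fun k => (n k).fn) atTop (𝓝 m.fn)) :
    (EOF m : EReal) ≤ liminf (fun k => (EOF (n k) : EReal)) atTop :=
  coe_le_liminf_of_subseq fun _ hφ _ hc => EOF_le_of_tendsto hS (hn.comp hφ.tendsto_atTop) hc

theorem Eel_le_liminf {CW qW : ℝ} {rW : ℝ → ℝ≥0∞} {W : ℝ → M3 → ℝ≥0∞}
    {Q : ℝ → QuadraticForm ℝ M3} (hW : IsStoredEnergy CW qW rW W Q) {rbar : ℝ} {S : Set E2}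
    (hS : IsOpen S) (hfin : volume S ≠ ⊤) {q : ℕ → H2 S × H1 S} {p : H2 S × H1 S}
    (hq : ∀ k, q k ∈ A2 S) (hy : Tendsto (fun k => (q k).1.fn) atTop (𝓝 p.1.fn))
    (hn : Tendsto (fun k => (q k).2.fn) atTop (𝓝 p.2.fn)) :
    (Eel Q rbar p.1 p.2 : EReal) ≤ liminf (fun k => (Eel Q rbar (q k).1 (q k).2 : EReal)) atTop :=
  coe_le_liminf_of_subseq fun _ hφ _ hc => Eel_le_of_tendsto hW hS hfin (fun _ => hq _)
    (hy.comp hφ.tendsto_atTop) (hn.comp hφ.tendsto_atTop) hc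

/-- The embedding into `L² × L²` is injective, so the pair chosen in the definition of the energy is
the given one. -/
theorem energy_eq {Q : ℝ → QuadraticForm ℝ M3} {rbar epsbar : ℝ} {S : Set E2} (hS : IsOpen S)
    {q : H2 S × H1 S} (hq : q ∈ A2 S) : energy Q rbar epsbar (toL2 q) =
      ((Eel Q rbar q.1 q.2 + epsbar ^ 2 * EOF q.2 : ℝ) : EReal) := by
  have h : ∃ r ∈ A2 S, toL2 r = toL2 q := ⟨q, hq, rfl⟩
  rw [energy, dif_pos h, toL2_injective hS h.choose_spec.2]

theorem energy_le_liminf {CW qW : ℝ} {rW : ℝ → ℝ≥0∞} {W : ℝ → M3 → ℝ≥0∞}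
    {Q : ℝ → QuadraticForm ℝ M3} (hW : IsStoredEnergy CW qW rW W Q) {rbar epsbar : ℝ}
    (heps : 0 < epsbar) {S : Set E2} (hS : IsOpen S) (hfin : volume S ≠ ⊤)
    {q : ℕ → H2 S × H1 S} {p : H2 S × H1 S} (hq : ∀ k, q k ∈ A2 S) (hp : p ∈ A2 S)
    (hy : Tendsto (fun k => (q k).1.fn) atTop (𝓝 p.1.fn))
    (hn : Tendsto (fun k => (q k).2.fn) atTop (𝓝 p.2.fn)) :
    energy Q rbar epsbar (toL2 p) ≤
      liminf (fun k => energy Q rbar epsbar (toL2 (q k))) atTop := by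
  have e : ∀ k, energy Q rbar epsbar (toL2 (q k)) = _ := fun k => energy_eq hS (hq k)
  simp only [energy_eq hS hp, e, EReal.coe_add]
  have h1 : ((epsbar ^ 2 * EOF p.2 : ℝ) : EReal) ≤
      liminf (fun k => ((epsbar ^ 2 * EOF (q k).2 : ℝ) : EReal)) atTop := by
    refine coe_le_liminf_of_subseq fun φ hφ c hc => ?_
    rw [← le_div_iff₀' (by positivity)]
    exact EOF_le_of_tendsto hS (hn.comp hφ.tendsto_atTop) fun k =>
      (le_div_iff₀' (by positivity)).2 (hc k)
  exact (add_le_add (Eel_le_liminf hW hS hfin hq hy hn) h1).trans EReal.le_liminf_add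

/-! ### Compactness of the sublevels -/

theorem mem_sublevel_iff {Q : ℝ → QuadraticForm ℝ M3} {rbar epsbar : ℝ} {S : Set E2}
    (hS : IsOpen S) {C : ℝ} {q : H2 S × H1 S} : q ∈ sublevel Q rbar epsbar S C ↔
      q ∈ A2 S ∧ Eel Q rbar q.1 q.2 + epsbar ^ 2 * EOF q.2 ≤ C ∧ ‖q.1.fn‖ ≤ C := by
  refine and_congr_right fun hq => ?_
  rw [energy_eq hS hq, EReal.coe_le_coe_iff]

theorem exists_norm_le_of_sublevel {CW qW : ℝ} {rW : ℝ → ℝ≥0∞} {W : ℝ → M3 → ℝ≥0∞}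
    {Q : ℝ → QuadraticForm ℝ M3} (hW : IsStoredEnergy CW qW rW W Q) (rbar : ℝ) {epsbar : ℝ}
    (heps : 0 < epsbar) {S : Set E2} (hS : IsOpen S) (hfin : volume S ≠ ⊤) (C : ℝ) :
    ∃ M, ∀ q ∈ sublevel Q rbar epsbar S C, ‖q.1‖ ≤ M ∧ ‖q.2‖ ≤ M := by
  obtain ⟨M, hM⟩ := hW.exists_norm_le rbar hS hfin C C
  refine ⟨max M (Real.sqrt ((volume S).toReal + 2 * (C / epsbar ^ 2))), fun q hq => ?_⟩
  obtain ⟨h1, h2, h3⟩ := (mem_sublevel_iff hS).1 hq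
  have hE := (hW.apriori rbar hS hfin h1).2.1
  have hO := EOF_nonneg q.2
  refine ⟨(hM q h1 h3 ?_).trans (le_max_left _ _), le_trans ?_ (le_max_right _ _)⟩
  · nlinarith [sq_nonneg epsbar]
  · refine Real.le_sqrt_of_sq_le ?_
    rw [H1.norm_sq, norm_sq_of_norm_eq_one h1.2]
    have h4 : EOF q.2 ≤ C / epsbar ^ 2 := (le_div_iff₀' (by positivity)).2 (by linarith)
    rw [EOF_eq] at h4
    linarith

/-- The sublevels are sequentially compact in `L²`. -/
theorem exists_subseq_of_sublevel {CW qW : ℝ} {rW : ℝ → ℝ≥0∞} {W : ℝ → M3 → ℝ≥0∞}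
    {Q : ℝ → QuadraticForm ℝ M3} (hW : IsStoredEnergy CW qW rW W Q) {rbar epsbar : ℝ}
    (heps : 0 < epsbar) {S : Set E2} (hS : IsLipschitzDomain S) (hfin : volume S ≠ ⊤) {C : ℝ}
    {q : ℕ → H2 S × H1 S} (hq : ∀ k, q k ∈ sublevel Q rbar epsbar S C) :
    ∃ p ∈ sublevel Q rbar epsbar S C, ∃ φ : ℕ → ℕ, StrictMono φ ∧
      Tendsto (fun k => toL2 (q (φ k))) atTop (𝓝 (toL2 p)) := by
  have hSo := hS.1
  have hA : ∀ k, q k ∈ A2 S := fun k => (hq k).1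
  obtain ⟨M, hM⟩ := exists_norm_le_of_sublevel hW rbar heps hSo hfin C
  obtain ⟨y, φ, hφ, hy⟩ := exists_subseq_weak_tendsto (fun k => (q k).1) M fun k => (hM _ (hq k)).1
  obtain ⟨n, ψ, hψ, hn⟩ := exists_subseq_weak_tendsto (fun k => (q (φ k)).2) M
    fun k => (hM _ (hq _)).2
  set r : ℕ → H2 S × H1 S := fun k => q (φ (ψ k)) with hr
  have hy' : ∀ ℓ : StrongDual ℝ (H2 S), Tendsto (fun k => ℓ (r k).1) atTop (𝓝 (ℓ y)) := fun ℓ =>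
    (hy ℓ).comp hψ.tendsto_atTop
  have hyM : ∀ k, ‖(r k).1‖ ≤ M := fun k => (hM _ (hq _)).1
  obtain ⟨B, hB⟩ := hS.exists_bound C
  have hyfn : Tendsto (fun k => (r k).1.fn) atTop (𝓝 y.fn) :=
    H1.tendsto_fn_of_weak hSo hfin (u := fun k => (r k).1.toH1) (v := y.toH1)
      (fun ℓ => hy' (ℓ.comp (H2.toH1L S))) (M := M) (B := B)
      (fun k => (r k).1.norm_toH1_le.trans (hyM k))
      (fun k => hB _ _ (r k).1.hasWeakPartial
        (fun i => (H2.norm_grad (hA _) i).mono fun _ hx => hx.le) (hq _).2.2)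
  have hnfn : Tendsto (fun k => (r k).2.fn) atTop (𝓝 n.fn) :=
    tendsto_director_of_weak hSo hfin (fun k => hA _) hn
  have hp : (y, n) ∈ A2 S := by
    obtain ⟨χ, -, hχ⟩ := exists_subseq_strainConverges (p := (y, n))
      (H2.tendsto_grad_of_weak hSo hfin (fun k => hA _) hy' hyM) hnfn
    exact hχ.mem_A2 fun k => hA _
  refine ⟨(y, n), ⟨hp, ?_, ?_⟩, fun k => φ (ψ k), hφ.comp hψ, hyfn.prodMk_nhds hnfn⟩
  · refine (energy_le_liminf hW heps hSo hfin (q := r) (fun k => hA _) hp hyfn hnfn).trans ?_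
    refine liminf_le_of_frequently_le' (Eventually.of_forall fun k => ?_).frequently
    exact (hq _).2.1
  · exact le_of_tendsto' hyfn.norm fun k => (hq _).2.2

theorem isCompact_toL2_sublevel {CW qW : ℝ} {rW : ℝ → ℝ≥0∞} {W : ℝ → M3 → ℝ≥0∞}
    {Q : ℝ → QuadraticForm ℝ M3} (hW : IsStoredEnergy CW qW rW W Q) {rbar epsbar : ℝ}
    (heps : 0 < epsbar) {S : Set E2} (hS : IsLipschitzDomain S) (hfin : volume S ≠ ⊤) {C : ℝ} :
    IsCompact (toL2 '' sublevel Q rbar epsbar S C) := by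
  refine IsSeqCompact.isCompact fun x hx => ?_
  choose q hq hqx using hx
  obtain ⟨p, hp, φ, hφ, h⟩ := exists_subseq_of_sublevel hW heps hS hfin hq
  refine ⟨toL2 p, mem_image_of_mem _ hp, φ, hφ, ?_⟩
  simpa only [hqx, Function.comp_def] using h

/-- On a sublevel, which is bounded, the inverse of the embedding into `L²` is continuous for the
weak topology; so weak compactness follows from strong compactness in `L²`. -/
theorem isCompact_toWeakSpace_sublevel {CW qW : ℝ} {rW : ℝ → ℝ≥0∞} {W : ℝ → M3 → ℝ≥0∞}
    {Q : ℝ → QuadraticForm ℝ M3} (hW : IsStoredEnergy CW qW rW W Q) {rbar epsbar : ℝ}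
    (heps : 0 < epsbar) {S : Set E2} (hS : IsLipschitzDomain S) (hfin : volume S ≠ ⊤) {C : ℝ} :
    IsCompact (toWeakSpace ℝ (H2 S × H1 S) '' sublevel Q rbar epsbar S C) := by
  have hinj := toL2_injective hS.1
  obtain ⟨M, hM⟩ := exists_norm_le_of_sublevel hW rbar heps hS.1 hfin C
  set g : L2 S × L2 S → WeakSpace ℝ (H2 S × H1 S) := fun p =>
    toWeakSpace ℝ (H2 S × H1 S) (Function.invFun toL2 p) with hg
  have hgq : ∀ q, g (toL2 q) = toWeakSpace ℝ (H2 S × H1 S) q := fun q =>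
    congrArg (toWeakSpace ℝ (H2 S × H1 S)) (Function.leftInverse_invFun hinj q)
  have himg : toWeakSpace ℝ (H2 S × H1 S) '' sublevel Q rbar epsbar S C =
      g '' (toL2 '' sublevel Q rbar epsbar S C) := by
    rw [image_image]
    exact image_congr fun q _ => (hgq q).symm
  rw [himg]
  refine (isCompact_toL2_sublevel hW heps hS hfin).image_of_continuousOn ?_
  rw [continuousOn_iff_continuous_domRestrict]
  refine WeakBilin.continuous_of_continuous_eval _ fun ℓ => ?_
  rw [continuous_iff_seqContinuous]
  intro x a hxa
  choose q hq hqx using fun k => (x k).2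
  obtain ⟨p, hp, hpa⟩ := a.2
  have e1 : ∀ k, g (x k).1 = toWeakSpace ℝ (H2 S × H1 S) (q k) := fun k => by rw [← hqx, hgq]
  have e2 : g a.1 = toWeakSpace ℝ (H2 S × H1 S) p := by rw [← hpa, hgq]
  have hlim : Tendsto (fun k => toL2 (q k)) atTop (𝓝 (toL2 p)) := by
    have := (continuous_subtype_val.tendsto a).comp hxa
    rw [← hpa] at this
    exact this.congr fun k => (hqx k).symm
  have hsplit : ∀ r : H2 S × H1 S, ℓ r = ℓ.comp (.inl ℝ (H2 S) (H1 S)) r.1 +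
      ℓ.comp (.inr ℝ (H2 S) (H1 S)) r.2 := fun r => by
    rw [ContinuousLinearMap.comp_apply, ContinuousLinearMap.comp_apply, ← map_add]
    simp
  have h1 := tendsto_of_tendsto_injective (fun k => (hM _ (hq k)).1) (H2.fnL S)
    (H2.fnL_injective hS.1) ((continuous_fst.tendsto _).comp hlim)
    (ℓ.comp (.inl ℝ (H2 S) (H1 S)))
  have h2 := tendsto_of_tendsto_injective (fun k => (hM _ (hq k)).2) (H1.fnL S)
    (H1.fnL_injective hS.1) ((continuous_snd.tendsto _).comp hlim)
    (ℓ.comp (.inr ℝ (H2 S) (H1 S)))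
  change Tendsto (fun k => ℓ (g (x k).1)) atTop (𝓝 (ℓ (g a.1)))
  simp only [e1, e2]
  have h3 := h1.add h2
  rw [← hsplit] at h3
  exact h3.congr fun k => (hsplit (q k)).symm

/-! ### Continuity of the energies -/

/-- Weak convergence of the directors suffices, as it implies strong convergence in `L²`. -/
theorem tendsto_Eel_of_weak {CW qW : ℝ} {rW : ℝ → ℝ≥0∞} {W : ℝ → M3 → ℝ≥0∞}
    {Q : ℝ → QuadraticForm ℝ M3} (hW : IsStoredEnergy CW qW rW W Q) {rbar : ℝ} {S : Set E2}
    (hS : IsOpen S) (hfin : volume S ≠ ⊤) {q : ℕ → H2 S × H1 S} {p : H2 S × H1 S}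
    (hq : ∀ k, q k ∈ A2 S) (hy : Tendsto (fun k => (q k).1) atTop (𝓝 p.1))
    (hn : ∀ ℓ : StrongDual ℝ (H1 S), Tendsto (fun k => ℓ (q k).2) atTop (𝓝 (ℓ p.2))) :
    Tendsto (fun k => Eel Q rbar (q k).1 (q k).2) atTop (𝓝 (Eel Q rbar p.1 p.2)) := by
  have hnfn := tendsto_director_of_weak hS hfin hq hn
  refine tendsto_of_subseq_tendsto fun ns hns => ?_
  obtain ⟨φ, hφ, h⟩ := exists_subseq_strainConverges (q := fun k => q (ns k))
    (fun i => (((H2.gradL S i).continuous.tendsto _).comp hy).comp hns) (hnfn.comp hns)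
  exact ⟨φ, h.tendsto_Eel hW hS hfin (fun k => hq _) fun i j =>
    (((H2.hessL S i j).continuous.tendsto _).comp hy).comp (hns.comp hφ.tendsto_atTop)⟩

theorem continuous_EOF (S : Set E2) : Continuous (EOF (S := S)) := by
  have h : EOF (S := S) = fun n => 1 / 2 * ∑ i, ‖H1.gradL S i n‖ ^ 2 := funext EOF_eq
  rw [h]
  fun_prop

end LCEPlate

end

theorem mainTheorem8 (S : Set LCEPlate.E2) (hS : LCEPlate.IsLipschitzDomain S) (CW rbar : ℝ) :
    -- (a) a priori estimate (with a constant depending only on `S`, `C_W` and `r̄`)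
    (∃ C : ℝ, 0 < C ∧
      ∀ (qW : ℝ) (rW : ℝ → ℝ≥0∞) (W : ℝ → LCEPlate.M3 → ℝ≥0∞)
        (Q : ℝ → QuadraticForm ℝ LCEPlate.M3), LCEPlate.IsStoredEnergy CW qW rW W Q →
        ∀ (y : LCEPlate.H2 S) (n : LCEPlate.H1 S), (y, n) ∈ LCEPlate.A2 S →
          IntegrableOn (LCEPlate.elDensity Q rbar y n) S ∧
          ∫ x in S, ∑ i, ∑ j, ‖y.hess i j x‖ ^ 2 ≤ C * (LCEPlate.Eel Q rbar y n + 1)) ∧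
    ∀ (qW : ℝ) (rW : ℝ → ℝ≥0∞) (W : ℝ → LCEPlate.M3 → ℝ≥0∞)
      (Q : ℝ → QuadraticForm ℝ LCEPlate.M3), LCEPlate.IsStoredEnergy CW qW rW W Q →
      ∀ epsbar : ℝ, 0 < epsbar →
      -- (b) compactness
      (∀ C : ℝ, 0 < C →
        IsCompact (LCEPlate.toL2 '' LCEPlate.sublevel Q rbar epsbar S C) ∧
        IsCompact (toWeakSpace ℝ (LCEPlate.H2 S × LCEPlate.H1 S) ''
          LCEPlate.sublevel Q rbar epsbar S C)) ∧
      -- (c) lower semicontinuity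
      (∀ (y' : ℕ → LCEPlate.H2 S) (n' : ℕ → LCEPlate.H1 S)
        (y : LCEPlate.H2 S) (n : LCEPlate.H1 S),
        (∀ k, (y' k, n' k) ∈ LCEPlate.A2 S) → (y, n) ∈ LCEPlate.A2 S →
        Tendsto (fun k => LCEPlate.toL2 (y' k, n' k)) atTop (𝓝 (LCEPlate.toL2 (y, n))) →
        (LCEPlate.EOF n : EReal) ≤ liminf (fun k => (LCEPlate.EOF (n' k) : EReal)) atTop ∧
        (limsup (fun k => (LCEPlate.EOF (n' k) : EReal)) atTop < ⊤ →
          (LCEPlate.Eel Q rbar y n : EReal) ≤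
            liminf (fun k => (LCEPlate.Eel Q rbar (y' k) (n' k) : EReal)) atTop) ∧
        LCEPlate.energy Q rbar epsbar (LCEPlate.toL2 (y, n)) ≤
          liminf (fun k => LCEPlate.energy Q rbar epsbar (LCEPlate.toL2 (y' k, n' k))) atTop) ∧
      -- (d) continuity
      (∀ (y' : ℕ → LCEPlate.H2 S) (n' : ℕ → LCEPlate.H1 S)
        (y : LCEPlate.H2 S) (n : LCEPlate.H1 S),
        (∀ k, (y' k, n' k) ∈ LCEPlate.A2 S) → (y, n) ∈ LCEPlate.A2 S →
        Tendsto y' atTop (𝓝 y) →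
        (Tendsto (fun k => toWeakSpace ℝ (LCEPlate.H1 S) (n' k)) atTop
            (𝓝 (toWeakSpace ℝ (LCEPlate.H1 S) n)) →
          Tendsto (fun k => LCEPlate.Eel Q rbar (y' k) (n' k)) atTop
            (𝓝 (LCEPlate.Eel Q rbar y n))) ∧
        (Tendsto n' atTop (𝓝 n) →
          Tendsto (fun k => LCEPlate.EOF (n' k)) atTop (𝓝 (LCEPlate.EOF n)))) := by
  have hSo := hS.1
  have hfin : volume S ≠ ⊤ := hS.2.2.1.measure_lt_top.ne
  refine ⟨?_, fun qW rW W Q hW epsbar heps => ⟨fun C _ =>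
    ⟨LCEPlate.isCompact_toL2_sublevel hW heps hS hfin,
      LCEPlate.isCompact_toWeakSpace_sublevel hW heps hS hfin⟩, ?_, ?_⟩⟩
  · set K : ℝ := 8 * rbar ^ 2 * (48 * (4 * CW ^ 2 + 1)) * 4 * (volume S).toReal with hK
    have hK0 : 0 ≤ K := by positivity
    refine ⟨96 * |CW| + K + 1, by positivity, fun qW rW W Q hW y n hq => ?_⟩
    obtain ⟨h1, h2, h3⟩ := hW.apriori rbar hSo hfin hq
    refine ⟨h1, ?_⟩
    rw [LCEPlate.integral_hess_eq, abs_of_pos hW.CW_pos]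
    refine h3.trans ?_
    have h4 := mul_nonneg hK0 h2
    have h5 := hW.CW_pos
    dsimp only at h2 h4 ⊢
    linarith
  · intro y' n' y n hq hp h
    have hy := (continuous_fst.tendsto _).comp h
    have hn := (continuous_snd.tendsto _).comp h
    exact ⟨LCEPlate.EOF_le_liminf hSo hn, fun _ =>
      LCEPlate.Eel_le_liminf hW hSo hfin (q := fun k => (y' k, n' k)) (p := (y, n)) hq hy hn,
      LCEPlate.energy_le_liminf hW heps hSo hfin hq hp hy hn⟩
  · intro y' n' y n hq _ hy
    refine ⟨fun hn => ?_, fun hn => ((LCEPlate.continuous_EOF S).tendsto n).comp hn⟩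
    exact LCEPlate.tendsto_Eel_of_weak hW hSo hfin (q := fun k => (y' k, n' k)) (p := (y, n)) hq hy
      fun ℓ => ((WeakBilin.eval_continuous _ ℓ).tendsto _).comp hn
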